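/- Let $q\in\mathbb{C}$ with $0<|q|<1$, let $\rho,\lambda\in\mathbb{R}$, and put $\zeta=q/\overline{q}$, $\sigma=\sqrt{1+|q|^2}$, $\varsigma=|q|^2$. **Braided tensor product.** A $\mathbb{T}$-C*-algebra is a unital C*-algebra with a (point-norm continuous) action $z\mapsto\rho_z$ of the circle group $\mathbb{T}$ by $*$-automorphisms; an element $a$ is homogeneous of degree $n$, written $\deg a=n$, if $\rho_z(a)=z^na$ for all $z\in\mathbb{T}$. Let $\mathrm{C}(\mathbb{T}^2_\zeta)$ be the universal C*-algebra generated by two unitaries $u,v$ with $uv=\zeta vu$. For $\mathbb{T}$-C*-algebras $A,B$ let $\jmath_1:A\to \mathrm{C}(\mathbb{T}^2_\zeta)\otimes A\otimes B$ and $\jmath_2:B\to \mathrm{C}(\mathbb{T}^2_\zeta)\otimes A\otimes B$ (minimal tensor products) be the unital $*$-homomorphisms with $\jmath_1(a)=u^n\otimes a\otimes 1$ and $\jmath_2(b)=v^m\otimes 1\otimes b$ for homogeneous $a\in A$, $b\in B$ of degrees $n$ and $m$, and let $A\boxtimes_\zeta B=[\jmath_1(A)\jmath_2(B)]$, where $[ST]$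 is the closed linear span of $\{st : s\in S, t\in T\}$. This is a C*-algebra, with the unique action of $\mathbb{T}$ for which $\jmath_1,\jmath_2$ are equivariant. For equivariant unital $*$-homomorphisms $\Phi:A\to A'$, $\Psi:B\to B'$, $\Phi\boxtimes_\zeta\Psi:A\boxtimes_\zeta B\to A'\boxtimes_\zeta B'$ is the $*$-homomorphism with $(\Phi\boxtimes_\zeta\Psi)(\jmath_1(a)\jmath_2(b))=\jmath_1(\Phi(a))\jmath_2(\Psi(b))$. **The braided quantum group.** $\mathrm{C}(\mathrm{SU}_q(2))$ is the universal unital C*-algebra generated by $\alpha,\gamma$ with $$\alpha^*\alpha+\gamma^*\gamma=1,\quad \alpha\alpha^*+|q|^2\gamma^*\gamma=1,\quad \alpha\gamma=\overline{q}\gamma\alpha,\quad \gamma\gamma^*=\gamma^*\gamma,$$ with the $\mathbb{T}$-action for which $\deg\alpha=0$, $\deg\gamma=1$. Let $(v_{i,k})_{i,k\in\{-1,0,1\}}$ be the matrix $$\begin{bmatrix}\alpha^2&-\sigma^2\gamma^*\alpha&-q{\gamma^*}^2\\ \zeta\alpha\gamma&1-\sigma^2\gamma^*\gamma&\gamma^*\alpha^*\\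 -q\zeta\gamma^2&-\sigma^2\alpha^*\gamma&{\alpha^*}^2\end{bmatrix}$$ (rows and columns indexed by $-1,0,1$). **The braided Podleś sphere.** Let $\mathrm{C}(\mathbb{X}_{q,\rho,\lambda})$ be the universal unital C*-algebra generated by $e_{-1},e_0,e_1$ with relations $e_i^*=e_{-i}$ for $i=-1,0,1$ and $$e_{-1}e_1+\sigma^2e_0^2+\varsigma e_1e_{-1}=\rho 1,\qquad \sigma^2e_{-1}e_0-\varsigma\sigma^2e_0e_{-1}=\lambda e_{-1},$$ $$\varsigma(e_1e_{-1}-e_{-1}e_1)+(1-\varsigma^2)e_0^2=\lambda e_0,\qquad \sigma^2e_0e_1-\varsigma\sigma^2e_1e_0=\lambda e_1.$$ Then: 1. There is an action of $\mathbb{T}$ on $\mathrm{C}(\mathbb{X}_{q,\rho,\lambda})$ such that $e_i$ is homogeneous of degree $i$ for $i=-1,0,1$. 2. There is a $\mathbb{T}$-equivariant unital $*$-homomorphism $\Gamma:\mathrm{C}(\mathbb{X}_{q,\rho,\lambda})\to \mathrm{C}(\mathrm{SU}_q(2))\boxtimes_\zeta \mathrm{C}(\mathbb{X}_{q,\rho,\lambda})$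 such that $\Gamma(e_i)=\sum_{k=-1}^{1}\jmath_1(v_{i,k})\jmath_2(e_k)$ for $i=-1,0,1$. 3. There is an equivariant unital $*$-homomorphism $\Delta:\mathrm{C}(\mathrm{SU}_q(2))\to \mathrm{C}(\mathrm{SU}_q(2))\boxtimes_\zeta \mathrm{C}(\mathrm{SU}_q(2))$ with $\Delta(\alpha)=\jmath_1(\alpha)\jmath_2(\alpha)-q\jmath_1(\gamma^*)\jmath_2(\gamma)$ and $\Delta(\gamma)=\jmath_1(\gamma)\jmath_2(\alpha)+\jmath_1(\alpha^*)\jmath_2(\gamma)$, and $$(\mathrm{id}\boxtimes_\zeta\Gamma)\circ\Gamma=(\Delta\boxtimes_\zeta\mathrm{id})\circ\Gamma ,$$ where, with $A=\mathrm{C}(\mathrm{SU}_q(2))$ and $X=\mathrm{C}(\mathbb{X}_{q,\rho,\lambda})$, the algebras $(A\boxtimes_\zeta A)\boxtimes_\zeta X$ and $A\boxtimes_\zeta(A\boxtimes_\zeta X)$ are identified by the canonical $*$-isomorphism that respects the embeddings of the three factors (and which exists). Moreover $$\bigl[\jmath_1(\mathrm{C}(\mathrm{SU}_q(2)))\,\Gamma(\mathrm{C}(\mathbb{X}_{q,\rho,\lambda}))\bigr]=\mathrm{C}(\mathrm{SU}_q(2))\boxtimes_\zeta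 \mathrm{C}(\mathbb{X}_{q,\rho,\lambda}).$$ 4. Let $\lambda'=\frac{\lambda}{\sqrt{\varsigma}\,\sigma^2}$, $\rho'=\frac{\rho}{\varsigma\sigma^2}$ and $\mu=|q|$. Then $\mathrm{C}(\mathbb{X}_{q,\rho,\lambda})$ is isomorphic to Podleś's $\mathrm{C}(X_{\mu\lambda'\rho'})$, the universal unital C*-algebra generated by $E_{-1},E_0,E_1$ with relations $E_i^*=E_{-i}$ and $$(1+\mu^2)\bigl(E_{-1}E_1+\mu^{-2}E_1E_{-1}\bigr)+E_0^2=\rho'1,\qquad E_0E_{-1}-\mu^2E_{-1}E_0=\lambda'E_{-1},$$ $$(1+\mu^2)\bigl(E_{-1}E_1-E_1E_{-1}\bigr)+(1-\mu^2)E_0^2=\lambda'E_0,\qquad E_1E_0-\mu^2E_0E_1=\lambda'E_1,$$ by a $*$-isomorphism with $e_{-1}\mapsto\sigma^2E_1$, $e_0\mapsto\sqrt{\varsigma}\,E_0$, $e_1\mapsto\sigma^2E_{-1}$. -/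

import Mathlib

noncomputable section

open scoped TensorProduct ComplexConjugate

namespace BraidedSphere

universe u v

/-- A C*-seminorm on a unital complex *-algebra. -/
structure CStarSeminorm (F : Type u) [Ring F] [StarRing F] [Algebra ℂ F] extends
    Seminorm ℂ F where
  mul_le' : ∀ x y : F, toFun (x * y) ≤ toFun x * toFun y
  star_mul_self' : ∀ x : F, toFun (star x * x) = toFun x * toFun x

namespace CStarSeminorm

variable {F : Type u} [Ring F] [StarRing F] [Algebra ℂ F]

instance : CoeFun (CStarSeminorm F) (fun _ => F → ℝ) := ⟨fun p => p.toSeminorm⟩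

variable (p : CStarSeminorm F)

theorem mul_le (x y : F) : p (x * y) ≤ p x * p y := p.mul_le' x y

theorem star_mul_self (x : F) : p (star x * x) = p x * p x := p.star_mul_self' x

theorem nonneg (x : F) : 0 ≤ p x := apply_nonneg p.toSeminorm x

theorem le_star (x : F) : p x ≤ p (star x) := by
  rcases (p.nonneg x).eq_or_lt with h | h
  · rw [← h]; exact p.nonneg _
  · have h1 := p.star_mul_self x
    have h2 := p.mul_le (star x) x
    rw [h1] at h2
    exact le_of_mul_le_mul_right h2 h

theorem star_eq (x : F) : p (star x) = p x :=
  le_antisymm (by simpa using p.le_star (star x)) (p.le_star x)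

theorem dist_aux₁ (x : F) : p (-x + x) = 0 := by simp

theorem dist_aux₂ (x y : F) : p (-x + y) = p (-y + x) := by
  rw [← map_neg_eq_map p.toSeminorm (-x + y)]
  congr 1
  abel

theorem dist_aux₃ (x y z : F) : p (-x + z) ≤ p (-x + y) + p (-y + z) := by
  have h : -x + z = (-x + y) + (-y + z) := by abel
  rw [h]
  exact map_add_le_add p.toSeminorm _ _

/-- The *-algebra `F` regarded as a seminormed algebra by means of `p`. -/
@[nolint unusedArguments]
def Pre (_p : CStarSeminorm F) : Type u := F

instance : Ring p.Pre := inferInstanceAs (Ring F)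
instance : StarRing p.Pre := inferInstanceAs (StarRing F)
instance : Algebra ℂ p.Pre := inferInstanceAs (Algebra ℂ F)
instance [h : StarModule ℂ F] : StarModule ℂ p.Pre := h

instance : SeminormedRing p.Pre where
  __ : Ring p.Pre := inferInstance
  norm x := p x
  dist x y := p (-x + y)
  dist_self := p.dist_aux₁
  dist_comm := p.dist_aux₂
  dist_triangle := p.dist_aux₃
  dist_eq x y := rfl
  norm_mul_le := p.mul_le

theorem norm_pre (x : p.Pre) : ‖x‖ = p x := rfl

instance : NormedAlgebra ℂ p.Pre where
  norm_smul_le c x := (map_smul_eq_mul p.toSeminorm c x).le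

/-- The C*-algebra obtained from `F` by dividing out the kernel of `p` and completing. -/
def Completion : Type u := UniformSpace.Completion p.Pre

open UniformSpace.Completion

instance : NormedRing p.Completion :=
  inferInstanceAs (NormedRing (UniformSpace.Completion p.Pre))
instance : CompleteSpace p.Completion :=
  inferInstanceAs (CompleteSpace (UniformSpace.Completion p.Pre))
instance : Algebra ℂ p.Completion :=
  inferInstanceAs (Algebra ℂ (UniformSpace.Completion p.Pre))
instance : NormedAlgebra ℂ p.Completion where
  norm_smul_le c x := norm_smul_le (β := UniformSpace.Completion p.Pre) c x

/-- The canonical map from `F` to the completion. -/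
def toCompl (x : F) : p.Completion := UniformSpace.Completion.coe' (α := p.Pre) x

theorem toCompl_mul (x y : F) : p.toCompl (x * y) = p.toCompl x * p.toCompl y :=
  UniformSpace.Completion.coe_mul (α := p.Pre) x y
theorem toCompl_add (x y : F) : p.toCompl (x + y) = p.toCompl x + p.toCompl y :=
  UniformSpace.Completion.coe_add (α := p.Pre) x y
theorem toCompl_one : p.toCompl 1 = 1 := rfl
theorem toCompl_zero : p.toCompl 0 = 0 := rfl
theorem toCompl_smul (c : ℂ) (x : F) : p.toCompl (c • x) = c • p.toCompl x :=
  UniformSpace.Completion.coe_smul (X := p.Pre) c x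
theorem norm_toCompl (x : F) : ‖p.toCompl x‖ = p x :=
  UniformSpace.Completion.norm_coe (E := p.Pre) x
theorem denseRange_toCompl : DenseRange p.toCompl :=
  UniformSpace.Completion.denseRange_coe (α := p.Pre)

theorem completion_induction {P : p.Completion → Prop} (a : p.Completion)
    (hc : IsClosed {a | P a}) (h : ∀ x : F, P (p.toCompl x)) : P a :=
  UniformSpace.Completion.induction_on (α := p.Pre) a hc h

theorem completion_induction₂ {P : p.Completion → p.Completion → Prop} (a b : p.Completion)
    (hc : IsClosed {a : p.Completion × p.Completion | P a.1 a.2})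
    (h : ∀ x y : F, P (p.toCompl x) (p.toCompl y)) : P a b :=
  UniformSpace.Completion.induction_on₂ (α := p.Pre) (β := p.Pre) a b hc h

theorem uniformContinuous_star_pre : UniformContinuous (fun x : p.Pre => star x) := by
  refine (LipschitzWith.of_dist_le_mul (K := 1) fun x y => ?_).uniformContinuous
  rw [dist_eq_norm, dist_eq_norm, ← star_sub, NNReal.coe_one, one_mul]
  exact (p.star_eq (x - y : p.Pre)).le

instance : Star p.Completion :=
  ⟨UniformSpace.Completion.map (fun x : p.Pre => star x)⟩

theorem continuous_star' : Continuous (fun x : p.Completion => star x) :=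
  UniformSpace.Completion.continuous_map

theorem toCompl_star (x : F) : p.toCompl (star x) = star (p.toCompl x) :=
  (UniformSpace.Completion.map_coe p.uniformContinuous_star_pre x).symm

instance : StarRing p.Completion where
  star_involutive x := by
    induction x using p.completion_induction with
    | hc => exact isClosed_eq (p.continuous_star'.comp p.continuous_star') continuous_id
    | h x => rw [← toCompl_star, ← toCompl_star, star_star]
  star_mul x y := by
    induction x, y using p.completion_induction₂ with
    | hc => exact isClosed_eq (p.continuous_star'.comp (by fun_prop))
              ((p.continuous_star'.comp continuous_snd).mul (p.continuous_star'.comp continuous_fst))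
    | h x y => rw [← toCompl_mul, ← toCompl_star, star_mul, toCompl_mul, toCompl_star, toCompl_star]
  star_add x y := by
    induction x, y using p.completion_induction₂ with
    | hc => exact isClosed_eq (p.continuous_star'.comp (by fun_prop))
              ((p.continuous_star'.comp continuous_fst).add (p.continuous_star'.comp continuous_snd))
    | h x y => rw [← toCompl_add, ← toCompl_star, star_add, toCompl_add, toCompl_star, toCompl_star]

instance : CStarRing p.Completion where
  norm_mul_self_le x := by
    induction x using p.completion_induction with
    | hc => exact isClosed_le (by fun_prop)
              ((p.continuous_star'.mul continuous_id).norm)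
    | h x => rw [← toCompl_star, ← toCompl_mul, norm_toCompl, norm_toCompl, star_mul_self]

instance [StarModule ℂ F] : StarModule ℂ p.Completion where
  star_smul c x := by
    induction x using p.completion_induction with
    | hc => exact isClosed_eq (p.continuous_star'.comp (continuous_const_smul c))
              (p.continuous_star'.const_smul (star c))
    | h x => rw [← toCompl_smul, ← toCompl_star, ← toCompl_star, star_smul, toCompl_smul]

instance [StarModule ℂ F] : CStarAlgebra p.Completion where

/-- The canonical *-homomorphism from `F` to the completion. -/
def toComplHom : F →⋆ₐ[ℂ] p.Completion where
  toFun := p.toCompl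
  map_one' := p.toCompl_one
  map_mul' := p.toCompl_mul
  map_zero' := p.toCompl_zero
  map_add' := p.toCompl_add
  commutes' c := by
    rw [Algebra.algebraMap_eq_smul_one, Algebra.algebraMap_eq_smul_one, toCompl_smul, toCompl_one]
  map_star' := p.toCompl_star

variable {p}
variable {B : Type v} [CStarAlgebra B]

/-- A *-homomorphism that is contractive for `p` extends to the completion. -/
def lift (f : F →⋆ₐ[ℂ] B) (hf : ∀ x, ‖f x‖ ≤ p x) : p.Completion →⋆ₐ[ℂ] B :=
  let g : p.Pre →+ B := AddMonoidHom.mk' (M := p.Pre) (fun x => f x) (fun x y => map_add f x y)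
  have hg : UniformContinuous g := AddMonoidHomClass.uniformContinuous_of_bound g 1
    (fun x => (hf x).trans (one_mul (p x)).ge)
  have hc : Continuous (fun x : p.Completion => UniformSpace.Completion.extension g x) :=
    UniformSpace.Completion.continuous_extension
  have he : ∀ x : F, UniformSpace.Completion.extension g (p.toCompl x) = f x := fun x =>
    UniformSpace.Completion.extension_coe hg x
  { toFun := fun x : p.Completion => UniformSpace.Completion.extension g x
    map_one' := by rw [← toCompl_one, he, map_one]
    map_mul' := fun x y => by
      induction x, y using p.completion_induction₂ with
      | hc => exact isClosed_eq (hc.comp continuous_mul)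
                ((hc.comp continuous_fst).mul (hc.comp continuous_snd))
      | h x y => rw [← toCompl_mul, he, he, he, map_mul]
    map_zero' := by rw [← toCompl_zero, he, map_zero]
    map_add' := fun x y => by
      induction x, y using p.completion_induction₂ with
      | hc => exact isClosed_eq (hc.comp continuous_add)
                ((hc.comp continuous_fst).add (hc.comp continuous_snd))
      | h x y => rw [← toCompl_add, he, he, he, map_add]
    commutes' := fun c => by
      rw [Algebra.algebraMap_eq_smul_one, Algebra.algebraMap_eq_smul_one, ← toCompl_one,
        ← toCompl_smul, he, map_smul, map_one]
    map_star' := fun x => by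
      induction x using p.completion_induction with
      | hc => exact isClosed_eq (hc.comp p.continuous_star') hc.star
      | h x => rw [← toCompl_star, he, he, map_star] }

theorem lift_toCompl (f : F →⋆ₐ[ℂ] B) (hf : ∀ x, ‖f x‖ ≤ p x) (x : F) :
    lift f hf (p.toCompl x) = f x :=
  UniformSpace.Completion.extension_coe
    (AddMonoidHomClass.uniformContinuous_of_bound
      (AddMonoidHom.mk' (M := p.Pre) (fun x => f x) (fun x y => map_add f x y)) 1
      (fun x => (hf x).trans (one_mul (p x)).ge)) x

/-- The pointwise supremum of a nonempty, pointwise bounded family of C*-seminorms. -/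
def iSup {ι : Sort*} [Nonempty ι] (P : ι → CStarSeminorm F)
    (hP : ∀ x, BddAbove (Set.range fun i => P i x)) : CStarSeminorm F where
  toFun x := ⨆ i, P i x
  map_zero' := by simp
  add_le' x y := ciSup_le fun i => (map_add_le_add (P i).toSeminorm x y).trans
    (add_le_add (le_ciSup (hP x) i) (le_ciSup (hP y) i))
  neg' x := by simp
  smul' c x := by simp [map_smul_eq_mul, Real.mul_iSup_of_nonneg]
  mul_le' x y := ciSup_le fun i => ((P i).mul_le x y).trans
    (mul_le_mul (le_ciSup (hP x) i) (le_ciSup (hP y) i) ((P i).nonneg y)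
      (((P i).nonneg x).trans (le_ciSup (hP x) i)))
  star_mul_self' x := by
    have h0 : 0 ≤ ⨆ i, P i x := Real.iSup_nonneg fun i => (P i).nonneg x
    apply le_antisymm
    · refine ciSup_le fun i => ?_
      rw [star_mul_self]
      exact mul_self_le_mul_self ((P i).nonneg x) (le_ciSup (hP x) i)
    · have h1 : ∀ i, P i x ≤ √(⨆ i, P i (star x * x)) := fun i => by
        refine Real.le_sqrt_of_sq_le ?_
        rw [sq, ← star_mul_self]
        exact le_ciSup (hP (star x * x)) i
      have h2 := ciSup_le h1
      have h3 : 0 ≤ ⨆ i, P i (star x * x) := Real.iSup_nonneg fun i => (P i).nonneg _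
      calc _ ≤ √(⨆ i, P i (star x * x)) * √(⨆ i, P i (star x * x)) := mul_self_le_mul_self h0 h2
        _ = _ := Real.mul_self_sqrt h3

theorem iSup_apply {ι : Sort*} [Nonempty ι] (P : ι → CStarSeminorm F)
    (hP : ∀ x, BddAbove (Set.range fun i => P i x)) (x : F) :
    CStarSeminorm.iSup P hP x = ⨆ i, P i x := rfl

/-- The C*-seminorm `‖f ·‖` given by a *-homomorphism `f` to a C*-algebra. -/
def ofHom (f : F →⋆ₐ[ℂ] B) : CStarSeminorm F where
  toFun x := ‖f x‖
  map_zero' := by simp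
  add_le' x y := by rw [map_add]; exact norm_add_le _ _
  neg' x := by simp
  smul' c x := by rw [map_smul, norm_smul]
  mul_le' x y := by rw [map_mul]; exact norm_mul_le _ _
  star_mul_self' x := by rw [map_mul, map_star, CStarRing.norm_star_mul_self]

end CStarSeminorm

end BraidedSphere

end

noncomputable section

open scoped TensorProduct ComplexConjugate

namespace BraidedSphere

universe u v

theorem continuous_hom {A : Type u} {B : Type v} [CStarAlgebra A] [CStarAlgebra B]
    (f : A →⋆ₐ[ℂ] B) : Continuous f :=
  AddMonoidHomClass.continuous_of_bound f 1 fun x => by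
    rw [one_mul]; exact NonUnitalStarAlgHom.norm_apply_le f x

/-- The free unital complex *-algebra on `ι`: the monoid algebra of the words in the letters
`(i, false)` (the generator `i`) and `(i, true)` (its adjoint). -/
def FreeStarAlgebra (ι : Type u) : Type u := MonoidAlgebra ℂ (FreeMonoid (ι × Bool))

namespace FreeStarAlgebra

variable {ι : Type u}

instance : Ring (FreeStarAlgebra ι) :=
  inferInstanceAs (Ring (MonoidAlgebra ℂ (FreeMonoid (ι × Bool))))
instance : Algebra ℂ (FreeStarAlgebra ι) :=
  inferInstanceAs (Algebra ℂ (MonoidAlgebra ℂ (FreeMonoid (ι × Bool))))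

/-- The one-letter word `(i, b)`. -/
def letter (i : ι) (b : Bool) : FreeStarAlgebra ι :=
  (MonoidAlgebra.single (FreeMonoid.of (i, b)) 1 : MonoidAlgebra ℂ (FreeMonoid (ι × Bool)))

theorem induction {P : FreeStarAlgebra ι → Prop} (x : FreeStarAlgebra ι)
    (hone : P 1) (hletter : ∀ i b, P (letter i b)) (hadd : ∀ x y, P x → P y → P (x + y))
    (hmul : ∀ x y, P x → P y → P (x * y)) (hsmul : ∀ (c : ℂ) x, P x → P (c • x)) : P x := by
  refine MonoidAlgebra.induction_on (motive := P) x (fun w => ?_) hadd hsmul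
  induction w using FreeMonoid.inductionOn with
  | one => exact hone
  | of a => exact hletter a.1 a.2
  | mul v w hv hw => rw [map_mul]; exact hmul _ _ hv hw

/-- The conjugate-linear anti-automorphism exchanging `(i, false)` and `(i, true)`. -/
def starHom : FreeStarAlgebra ι →+* (FreeStarAlgebra ι)ᵐᵒᵖ :=
  MonoidAlgebra.liftNCRingHom ((algebraMap ℂ (FreeStarAlgebra ι)ᵐᵒᵖ).comp (starRingEnd ℂ))
    (FreeMonoid.lift fun a : ι × Bool => MulOpposite.op (letter a.1 (!a.2)))
    (fun c _ => Algebra.commutes (conj c) _)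

theorem starHom_letter (i : ι) (b : Bool) :
    starHom (letter i b) = MulOpposite.op (letter i (!b)) := by
  unfold starHom letter
  erw [MonoidAlgebra.liftNCRingHom_single]
  simp

theorem starHom_smul (c : ℂ) (x : FreeStarAlgebra ι) :
    starHom (c • x) = conj c • starHom x := by
  have h : ∀ c : ℂ, starHom (algebraMap ℂ (FreeStarAlgebra ι) c) = algebraMap ℂ _ (conj c) := by
    intro c
    unfold starHom
    erw [MonoidAlgebra.liftNCRingHom_single]
    simp
  rw [Algebra.smul_def, map_mul, h, ← Algebra.smul_def]

instance : StarRing (FreeStarAlgebra ι) where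
  star x := (starHom x).unop
  star_involutive x := by
    induction x using FreeStarAlgebra.induction with
    | hone => simp
    | hletter i b => simp [starHom_letter]
    | hadd x y hx hy => simp only [map_add, MulOpposite.unop_add] at *; rw [hx, hy]
    | hmul x y hx hy => simp only [map_mul, MulOpposite.unop_mul] at *; rw [hx, hy]
    | hsmul c x hx => simp only [starHom_smul, MulOpposite.unop_smul] at *; rw [hx]; simp
  star_mul x y := by simp only [map_mul, MulOpposite.unop_mul]
  star_add x y := by simp only [map_add, MulOpposite.unop_add]

theorem star_def (x : FreeStarAlgebra ι) : star x = (starHom x).unop := rfl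

instance : StarModule ℂ (FreeStarAlgebra ι) where
  star_smul c x := by
    rw [star_def, star_def, starHom_smul, MulOpposite.unop_smul, starRingEnd_apply]

/-- The free generator `i`. -/
def gen (i : ι) : FreeStarAlgebra ι := letter i false

@[simp] theorem star_letter (i : ι) (b : Bool) : star (letter i b) = letter i (!b) := by
  rw [star_def, starHom_letter, MulOpposite.unop_op]

theorem letter_true (i : ι) : letter i true = star (gen i) := by simp [gen]

variable {B : Type v} [Ring B] [StarRing B] [Algebra ℂ B] [StarModule ℂ B]

/-- The value in `B` of a *-polynomial at the tuple `f`. -/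
def evalAlgHom (f : ι → B) : FreeStarAlgebra ι →ₐ[ℂ] B :=
  MonoidAlgebra.lift ℂ B (FreeMonoid (ι × Bool))
    (FreeMonoid.lift fun a : ι × Bool => if a.2 then star (f a.1) else f a.1)

theorem evalAlgHom_letter (f : ι → B) (i : ι) (b : Bool) :
    evalAlgHom f (letter i b) = if b then star (f i) else f i := by
  unfold evalAlgHom letter
  erw [MonoidAlgebra.lift_single]
  simp

/-- Evaluation of *-polynomials at the tuple `f`, as a *-homomorphism. -/
def eval (f : ι → B) : FreeStarAlgebra ι →⋆ₐ[ℂ] B where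
  __ := evalAlgHom f
  map_star' x := by
    change evalAlgHom f (star x) = star (evalAlgHom f x)
    induction x using FreeStarAlgebra.induction with
    | hone => simp
    | hletter i b => rw [star_letter, evalAlgHom_letter, evalAlgHom_letter]; cases b <;> simp
    | hadd x y hx hy => rw [star_add, map_add, hx, hy, map_add, star_add]
    | hmul x y hx hy => rw [star_mul, map_mul, hx, hy, map_mul, star_mul]
    | hsmul c x hx => rw [star_smul, map_smul, hx, map_smul, star_smul]

@[simp] theorem eval_gen (f : ι → B) (i : ι) : eval f (gen i) = f i :=
  (evalAlgHom_letter f i false).trans (by simp)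

theorem hom_ext {f g : FreeStarAlgebra ι →⋆ₐ[ℂ] B} (h : ∀ i, f (gen i) = g (gen i)) (x) :
    f x = g x := by
  induction x using FreeStarAlgebra.induction with
  | hone => simp
  | hletter i b =>
    cases b
    · exact h i
    · rw [letter_true, map_star, map_star, h]
  | hadd x y hx hy => rw [map_add, hx, hy, map_add]
  | hmul x y hx hy => rw [map_mul, hx, hy, map_mul]
  | hsmul c x hx => rw [map_smul, hx, map_smul]

end FreeStarAlgebra

open FreeStarAlgebra

variable {ι : Type u}

/-- The C*-seminorms on the free *-algebra for which all elements of `R` vanish. -/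
def RelSeminorm (R : Set (FreeStarAlgebra ι)) : Type u :=
  {p : CStarSeminorm (FreeStarAlgebra ι) // ∀ r ∈ R, p r = 0}

/-- The relations `r = 0`, `r ∈ R`, bound the norms of the generators, so that the universal
C*-algebra with these relations exists. -/
def Admissible (R : Set (FreeStarAlgebra ι)) : Prop :=
  ∀ i, BddAbove (Set.range fun p : RelSeminorm R => p.1 (gen i))

instance (R : Set (FreeStarAlgebra ι)) : Nonempty (RelSeminorm R) :=
  ⟨⟨{ (0 : Seminorm ℂ (FreeStarAlgebra ι)) with
      mul_le' := fun _ _ => (mul_zero (0 : ℝ)).ge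
      star_mul_self' := fun _ => (mul_zero (0 : ℝ)).symm }, fun _ _ => rfl⟩⟩

theorem Admissible.bddAbove {R : Set (FreeStarAlgebra ι)} (h : Admissible R)
    (x : FreeStarAlgebra ι) : BddAbove (Set.range fun p : RelSeminorm R => p.1 x) := by
  induction x using FreeStarAlgebra.induction with
  | hone =>
    refine ⟨1, ?_⟩
    rintro _ ⟨p, rfl⟩
    have h1 := p.1.star_mul_self 1
    simp only [star_one, mul_one] at h1
    by_contra! h2
    change 1 < p.1 1 at h2
    nlinarith
  | hletter i b =>
    cases b
    · exact h i
    · simp only [letter_true, CStarSeminorm.star_eq]; exact h i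
  | hadd x y hx hy =>
    obtain ⟨c, hc⟩ := hx
    obtain ⟨d, hd⟩ := hy
    refine ⟨c + d, ?_⟩
    rintro _ ⟨p, rfl⟩
    exact (map_add_le_add p.1.toSeminorm x y).trans (add_le_add (hc ⟨p, rfl⟩) (hd ⟨p, rfl⟩))
  | hmul x y hx hy =>
    obtain ⟨c, hc⟩ := hx
    obtain ⟨d, hd⟩ := hy
    refine ⟨c * d, ?_⟩
    rintro _ ⟨p, rfl⟩
    exact (p.1.mul_le x y).trans (mul_le_mul (hc ⟨p, rfl⟩) (hd ⟨p, rfl⟩) (p.1.nonneg y)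
      ((p.1.nonneg x).trans (hc ⟨p, rfl⟩)))
  | hsmul c x hx =>
    obtain ⟨d, hd⟩ := hx
    refine ⟨‖c‖ * d, ?_⟩
    rintro _ ⟨p, rfl⟩
    exact (map_smul_eq_mul p.1.toSeminorm c x).le.trans
      (mul_le_mul_of_nonneg_left (hd ⟨p, rfl⟩) (norm_nonneg c))

/-- The largest C*-seminorm for which the elements of `R` vanish. -/
def univSeminorm (R : Set (FreeStarAlgebra ι)) (h : Admissible R) :
    CStarSeminorm (FreeStarAlgebra ι) :=
  CStarSeminorm.iSup (fun p : RelSeminorm R => p.1) h.bddAbove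

/-- The universal unital C*-algebra with generators `ι` and relations `r = 0`, `r ∈ R`. -/
def UnivCStar (R : Set (FreeStarAlgebra ι)) (h : Admissible R) : Type u :=
  (univSeminorm R h).Completion

namespace UnivCStar

variable {R : Set (FreeStarAlgebra ι)} {h : Admissible R}

instance : CStarAlgebra (UnivCStar R h) :=
  inferInstanceAs (CStarAlgebra (univSeminorm R h).Completion)

variable (R h) in
/-- The class of a *-polynomial. -/
def mk : FreeStarAlgebra ι →⋆ₐ[ℂ] UnivCStar R h := (univSeminorm R h).toComplHom

variable (R h) in
/-- The generators. -/
def gen (i : ι) : UnivCStar R h := mk R h (FreeStarAlgebra.gen i)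

theorem denseRange_mk : DenseRange (mk R h) := (univSeminorm R h).denseRange_toCompl

theorem mk_eq_zero {r : FreeStarAlgebra ι} (hr : r ∈ R) : mk R h r = 0 := by
  have h1 : ‖mk R h r‖ = univSeminorm R h r := (univSeminorm R h).norm_toCompl r
  have h2 : univSeminorm R h r = 0 := by
    rw [univSeminorm, CStarSeminorm.iSup_apply]
    simp only [fun p : RelSeminorm R => p.2 r hr, Real.iSup_const_zero]
  rw [h2] at h1
  exact norm_eq_zero.mp h1

variable {B : Type v} [CStarAlgebra B]

/-- The universal property: a tuple in a C*-algebra `B` satisfying the relations defines a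
*-homomorphism to `B`. -/
def lift (f : ι → B) (hf : ∀ r ∈ R, FreeStarAlgebra.eval f r = 0) : UnivCStar R h →⋆ₐ[ℂ] B :=
  CStarSeminorm.lift (p := univSeminorm R h) (FreeStarAlgebra.eval f) fun x =>
    le_ciSup (h.bddAbove x)
      (⟨CStarSeminorm.ofHom (FreeStarAlgebra.eval f), fun r hr => by
        change ‖FreeStarAlgebra.eval f r‖ = 0
        rw [hf r hr, norm_zero]⟩ : RelSeminorm R)

@[simp] theorem lift_mk (f : ι → B) (hf : ∀ r ∈ R, FreeStarAlgebra.eval f r = 0)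
    (x : FreeStarAlgebra ι) :
    lift (h := h) f hf (mk R h x) = FreeStarAlgebra.eval f x :=
  CStarSeminorm.lift_toCompl _ _ x

@[simp] theorem lift_gen (f : ι → B) (hf : ∀ r ∈ R, FreeStarAlgebra.eval f r = 0) (i : ι) :
    lift (h := h) f hf (gen R h i) = f i := by
  rw [gen, lift_mk, eval_gen]

theorem hom_ext {f g : UnivCStar R h →⋆ₐ[ℂ] B} (hfg : ∀ i, f (gen R h i) = g (gen R h i)) :
    f = g := by
  refine StarAlgHom.ext fun x => ?_
  refine congrFun ((denseRange_mk (R := R) (h := h)).equalizer (continuous_hom f)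
    (continuous_hom g) (funext fun y => ?_)) x
  exact FreeStarAlgebra.hom_ext (f := f.comp (mk R h)) (g := g.comp (mk R h)) hfg y

end UnivCStar

/-- A bound on the generators in all C*-algebras makes the relations admissible. -/
theorem admissible_of_bound {ι : Type u} {R : Set (FreeStarAlgebra ι)} (C : ι → ℝ)
    (hC : ∀ (B : Type u) [CStarAlgebra B] (f : ι → B),
      (∀ r ∈ R, FreeStarAlgebra.eval f r = 0) → ∀ i, ‖f i‖ ≤ C i) : Admissible R := by
  refine fun i => ⟨C i, ?_⟩
  rintro _ ⟨p, rfl⟩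
  have h1 : ∀ x, FreeStarAlgebra.eval (fun i => p.1.toComplHom (FreeStarAlgebra.gen i)) x =
      p.1.toComplHom x :=
    FreeStarAlgebra.hom_ext fun i => by simp
  have h2 := hC p.1.Completion (fun i => p.1.toComplHom (FreeStarAlgebra.gen i)) (fun r hr => by
    rw [h1]
    exact norm_eq_zero.mp ((p.1.norm_toCompl r).trans (p.2 r hr))) i
  exact ((p.1.norm_toCompl _).ge).trans h2

end BraidedSphere

end

noncomputable section

open scoped TensorProduct ComplexConjugate InnerProductSpace

namespace BraidedSphere

universe u v

/-- A *-representation of the C*-algebra `A` on a Hilbert space. -/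
structure HilbertRep (A : Type u) [CStarAlgebra A] : Type (u + 1) where
  space : Type u
  [normed : NormedAddCommGroup space]
  [inner : InnerProductSpace ℂ space]
  [complete : CompleteSpace space]
  hom : A →⋆ₐ[ℂ] (space →L[ℂ] space)

attribute [instance] HilbertRep.normed HilbertRep.inner HilbertRep.complete

/-- Restriction of a representation along a *-homomorphism. -/
def HilbertRep.comp {A A' : Type u} [CStarAlgebra A] [CStarAlgebra A']
    (π : HilbertRep A') (f : A →⋆ₐ[ℂ] A') : HilbertRep A where
  space := π.space
  hom := π.hom.comp f

variable {A B : Type u} [CStarAlgebra A] [CStarAlgebra B]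

instance : Inhabited (HilbertRep A) :=
  ⟨{ space := PUnit
     hom :=
      { toFun := fun _ => 0
        map_one' := Subsingleton.elim _ _
        map_mul' := fun _ _ => Subsingleton.elim _ _
        map_zero' := rfl
        map_add' := fun _ _ => Subsingleton.elim _ _
        commutes' := fun _ => Subsingleton.elim _ _
        map_star' := fun _ => Subsingleton.elim _ _ } }⟩

/-- The algebraic tensor product of two Hilbert spaces, with the inner product determined by
`⟪h ⊗ k, h' ⊗ k'⟫ = ⟪h, h'⟫ ⟪k, k'⟫`. -/
def PreTensor (π : HilbertRep A) (σ : HilbertRep B) : Type u := π.space ⊗[ℂ] σ.space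

instance (π : HilbertRep A) (σ : HilbertRep B) : NormedAddCommGroup (PreTensor π σ) :=
  inferInstanceAs (NormedAddCommGroup (π.space ⊗[ℂ] σ.space))
instance (π : HilbertRep A) (σ : HilbertRep B) : InnerProductSpace ℂ (PreTensor π σ) :=
  inferInstanceAs (InnerProductSpace ℂ (π.space ⊗[ℂ] σ.space))

/-- The representation `a ↦ π(a) ⊗ 1`. -/
def leftRep (π : HilbertRep A) (σ : HilbertRep B) :
    A →ₐ[ℂ] (PreTensor π σ →L[ℂ] PreTensor π σ) where
  toFun a := (π.hom a).rTensor σ.space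
  map_one' := by rw [map_one]; exact ContinuousLinearMap.rTensor_one _
  map_mul' x y := by rw [map_mul]; exact ContinuousLinearMap.rTensor_mul _ _ _
  map_zero' := by rw [map_zero]; exact ContinuousLinearMap.rTensor_zero _
  map_add' x y := by rw [map_add]; exact ContinuousLinearMap.rTensor_add _ _ _
  commutes' c := by
    rw [Algebra.algebraMap_eq_smul_one, Algebra.algebraMap_eq_smul_one, map_smul, map_one]
    exact (ContinuousLinearMap.rTensor_smul _ _ _).trans
      (congrArg _ (ContinuousLinearMap.rTensor_one _))

/-- The representation `b ↦ 1 ⊗ σ(b)`. -/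
def rightRep (π : HilbertRep A) (σ : HilbertRep B) :
    B →ₐ[ℂ] (PreTensor π σ →L[ℂ] PreTensor π σ) where
  toFun b := (σ.hom b).lTensor π.space
  map_one' := by rw [map_one]; exact ContinuousLinearMap.lTensor_one _
  map_mul' x y := by rw [map_mul]; exact ContinuousLinearMap.lTensor_mul _ _ _
  map_zero' := by rw [map_zero]; exact ContinuousLinearMap.lTensor_zero _
  map_add' x y := by rw [map_add]; exact ContinuousLinearMap.lTensor_add _ _ _
  commutes' c := by
    rw [Algebra.algebraMap_eq_smul_one, Algebra.algebraMap_eq_smul_one, map_smul, map_one]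
    exact (ContinuousLinearMap.lTensor_smul _ _ _).trans
      (congrArg _ (ContinuousLinearMap.lTensor_one _))

theorem leftRep_mul_rightRep (π : HilbertRep A) (σ : HilbertRep B) (a : A) (b : B) :
    leftRep π σ a * rightRep π σ b = TensorProduct.mapL (π.hom a) (σ.hom b) :=
  ContinuousLinearMap.rTensor_comp_lTensor (π.hom a) (σ.hom b)

theorem rightRep_mul_leftRep (π : HilbertRep A) (σ : HilbertRep B) (a : A) (b : B) :
    rightRep π σ b * leftRep π σ a = TensorProduct.mapL (π.hom a) (σ.hom b) :=
  ContinuousLinearMap.lTensor_comp_rTensor (σ.hom b) (π.hom a)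

/-- The representation `a ⊗ b ↦ π(a) ⊗ σ(b)` of the algebraic tensor product `A ⊗ B`. -/
def tensorRep (π : HilbertRep A) (σ : HilbertRep B) :
    A ⊗[ℂ] B →ₐ[ℂ] (PreTensor π σ →L[ℂ] PreTensor π σ) :=
  Algebra.TensorProduct.lift (leftRep π σ) (rightRep π σ)
    (fun a b => show Commute _ _ from
      (leftRep_mul_rightRep π σ a b).trans (rightRep_mul_leftRep π σ a b).symm)

theorem tensorRep_tmul (π : HilbertRep A) (σ : HilbertRep B) (a : A) (b : B) :
    tensorRep π σ (a ⊗ₜ b) = TensorProduct.mapL (π.hom a) (σ.hom b) := by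
  exact (Algebra.TensorProduct.lift_tmul _ _ _ a b).trans (leftRep_mul_rightRep π σ a b)

theorem norm_tensorRep_tmul (π : HilbertRep A) (σ : HilbertRep B) (a : A) (b : B) :
    ‖tensorRep π σ (a ⊗ₜ b)‖ ≤ ‖π.hom a‖ * ‖σ.hom b‖ := by
  rw [tensorRep_tmul]
  exact TensorProduct.norm_mapL_le _ _

theorem inner_tensorRep_tmul (π : HilbertRep A) (σ : HilbertRep B) (a : A) (b : B)
    (h k : PreTensor π σ) :
    ⟪tensorRep π σ (star a ⊗ₜ star b) h, k⟫_ℂ = ⟪h, tensorRep π σ (a ⊗ₜ b) k⟫_ℂ := by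
  rw [tensorRep_tmul, tensorRep_tmul]
  revert h k
  suffices H : ∀ h k : π.space ⊗[ℂ] σ.space,
      ⟪TensorProduct.mapL (π.hom (star a)) (σ.hom (star b)) h, k⟫_ℂ =
      ⟪h, TensorProduct.mapL (π.hom a) (σ.hom b) k⟫_ℂ from H
  intro h k
  induction h with
  | zero => simp
  | add x y hx hy => simp only [map_add, inner_add_left, hx, hy]
  | tmul h₁ h₂ =>
    induction k with
    | zero => simp
    | add x y hx hy => simp only [map_add, inner_add_right, hx, hy]
    | tmul k₁ k₂ =>
      rw [TensorProduct.mapL_tmul, TensorProduct.mapL_tmul,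
        TensorProduct.inner_tmul, TensorProduct.inner_tmul, map_star, map_star,
        ContinuousLinearMap.star_eq_adjoint, ContinuousLinearMap.star_eq_adjoint]
      exact congrArg₂ _ (ContinuousLinearMap.adjoint_inner_left _ _ _)
        (ContinuousLinearMap.adjoint_inner_left _ _ _)

theorem inner_tensorRep_star (π : HilbertRep A) (σ : HilbertRep B) (x : A ⊗[ℂ] B)
    (h k : PreTensor π σ) :
    ⟪tensorRep π σ (star x) h, k⟫_ℂ = ⟪h, tensorRep π σ x k⟫_ℂ := by
  induction x with
  | zero => simp
  | add x y hx hy => simp only [star_add, map_add, add_apply, inner_add_left,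
      inner_add_right, hx, hy]
  | tmul a b => exact inner_tensorRep_tmul π σ a b h k

theorem norm_tensorRep_sq_le (π : HilbertRep A) (σ : HilbertRep B) (x : A ⊗[ℂ] B) :
    ‖tensorRep π σ x‖ * ‖tensorRep π σ x‖ ≤ ‖tensorRep π σ (star x * x)‖ := by
  have h : ‖tensorRep π σ x‖ ≤ √‖tensorRep π σ (star x * x)‖ := by
    refine ContinuousLinearMap.opNorm_le_bound _ (Real.sqrt_nonneg _) fun k => ?_
    conv_rhs => rw [← Real.sqrt_sq (norm_nonneg k)]
    rw [← Real.sqrt_mul (norm_nonneg _)]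
    refine Real.le_sqrt_of_sq_le ?_
    rw [← inner_self_eq_norm_sq (𝕜 := ℂ), ← inner_tensorRep_star, ← mul_apply_eq_comp,
      ← map_mul]
    refine (Complex.re_le_norm _).trans ((norm_inner_le_norm _ _).trans ?_)
    rw [sq, ← mul_assoc]
    exact mul_le_mul_of_nonneg_right (ContinuousLinearMap.le_opNorm _ _) (norm_nonneg _)
  calc _ ≤ √‖tensorRep π σ (star x * x)‖ * √‖tensorRep π σ (star x * x)‖ :=
        mul_self_le_mul_self (norm_nonneg _) h
    _ = _ := Real.mul_self_sqrt (norm_nonneg _)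

theorem norm_tensorRep_star (π : HilbertRep A) (σ : HilbertRep B) (x : A ⊗[ℂ] B) :
    ‖tensorRep π σ (star x)‖ ≤ ‖tensorRep π σ x‖ := by
  have h := norm_tensorRep_sq_le π σ (star x)
  rw [star_star, map_mul] at h
  have h2 := h.trans (norm_mul_le _ _)
  rcases (norm_nonneg (tensorRep π σ (star x))).eq_or_lt with h0 | h0
  · rw [← h0]; exact norm_nonneg _
  · exact le_of_mul_le_mul_right h2 h0

/-- The C*-seminorm `‖(π ⊗ σ)(x)‖` on the algebraic tensor product. -/
def repSeminorm (π : HilbertRep A) (σ : HilbertRep B) : CStarSeminorm (A ⊗[ℂ] B) where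
  toFun x := ‖tensorRep π σ x‖
  map_zero' := by simp
  add_le' x y := by rw [map_add]; exact norm_add_le _ _
  neg' x := by simp
  smul' c x := by rw [map_smul, norm_smul]
  mul_le' x y := by rw [map_mul]; exact norm_mul_le _ _
  star_mul_self' x := by
    refine le_antisymm ?_ (norm_tensorRep_sq_le π σ x)
    rw [map_mul]
    exact (norm_mul_le _ _).trans
      (mul_le_mul_of_nonneg_right (norm_tensorRep_star π σ x) (norm_nonneg _))

theorem bddAbove_repSeminorm (x : A ⊗[ℂ] B) :
    BddAbove (Set.range fun P : HilbertRep A × HilbertRep B => repSeminorm P.1 P.2 x) := by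
  induction x with
  | zero => exact ⟨0, by rintro _ ⟨P, rfl⟩; simp⟩
  | add x y hx hy =>
    obtain ⟨c, hc⟩ := hx
    obtain ⟨d, hd⟩ := hy
    refine ⟨c + d, ?_⟩
    rintro _ ⟨P, rfl⟩
    exact (map_add_le_add (repSeminorm P.1 P.2).toSeminorm x y).trans
      (add_le_add (hc ⟨P, rfl⟩) (hd ⟨P, rfl⟩))
  | tmul a b =>
    refine ⟨‖a‖ * ‖b‖, ?_⟩
    rintro _ ⟨P, rfl⟩
    change ‖tensorRep P.1 P.2 (a ⊗ₜ b)‖ ≤ _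
    exact (norm_tensorRep_tmul _ _ _ _).trans (mul_le_mul
      (NonUnitalStarAlgHom.norm_apply_le P.1.hom a) (NonUnitalStarAlgHom.norm_apply_le P.2.hom b)
      (norm_nonneg _) (norm_nonneg _))

variable (A B) in
/-- The minimal (spatial) C*-norm: the supremum of `‖(π ⊗ σ)(x)‖` over all representations `π` of
`A` and `σ` of `B`. -/
def minSeminorm : CStarSeminorm (A ⊗[ℂ] B) :=
  CStarSeminorm.iSup (fun P : HilbertRep A × HilbertRep B => repSeminorm P.1 P.2)
    bddAbove_repSeminorm

variable (A B) in
/-- The minimal (spatial) C*-tensor product. -/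
def MinTensor : Type u := (minSeminorm A B).Completion

namespace MinTensor

instance : CStarAlgebra (MinTensor A B) :=
  inferInstanceAs (CStarAlgebra (minSeminorm A B).Completion)

/-- The canonical map from the algebraic tensor product. -/
def ofAlg : A ⊗[ℂ] B →⋆ₐ[ℂ] MinTensor A B := (minSeminorm A B).toComplHom

theorem denseRange_ofAlg : DenseRange (ofAlg : A ⊗[ℂ] B → MinTensor A B) :=
  (minSeminorm A B).denseRange_toCompl

theorem norm_ofAlg (x : A ⊗[ℂ] B) : ‖ofAlg x‖ = minSeminorm A B x :=
  (minSeminorm A B).norm_toCompl x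

variable (A B) in
/-- `a ↦ a ⊗ 1`. -/
def inl : A →⋆ₐ[ℂ] MinTensor A B where
  __ := (ofAlg : A ⊗[ℂ] B →⋆ₐ[ℂ] MinTensor A B).toAlgHom.comp
    Algebra.TensorProduct.includeLeft
  map_star' a := by
    change ofAlg ((star a) ⊗ₜ[ℂ] (1 : B)) = star (ofAlg (a ⊗ₜ[ℂ] (1 : B)))
    rw [← map_star, TensorProduct.star_tmul, star_one]

variable (A B) in
/-- `b ↦ 1 ⊗ b`. -/
def inr : B →⋆ₐ[ℂ] MinTensor A B where
  __ := (ofAlg : A ⊗[ℂ] B →⋆ₐ[ℂ] MinTensor A B).toAlgHom.comp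
    Algebra.TensorProduct.includeRight
  map_star' b := by
    change ofAlg ((1 : A) ⊗ₜ[ℂ] (star b)) = star (ofAlg ((1 : A) ⊗ₜ[ℂ] b))
    rw [← map_star, TensorProduct.star_tmul, star_one]

theorem inl_apply (a : A) : inl A B a = ofAlg (a ⊗ₜ 1) := rfl
theorem inr_apply (b : B) : inr A B b = ofAlg (1 ⊗ₜ b) := rfl

theorem inl_mul_inr (a : A) (b : B) : inl A B a * inr A B b = ofAlg (a ⊗ₜ b) := by
  rw [inl_apply, inr_apply, ← map_mul, Algebra.TensorProduct.tmul_mul_tmul, one_mul, mul_one]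

theorem commute_inl_inr (a : A) (b : B) : Commute (inl A B a) (inr A B b) := by
  change _ * _ = _ * _
  rw [inl_apply, inr_apply, ← map_mul, ← map_mul, Algebra.TensorProduct.tmul_mul_tmul,
    Algebra.TensorProduct.tmul_mul_tmul, one_mul, mul_one, one_mul, mul_one]

variable {A' B' : Type u} [CStarAlgebra A'] [CStarAlgebra B']

/-- The tensor product of two *-homomorphisms, on the algebraic level. -/
def algMap (f : A →⋆ₐ[ℂ] A') (g : B →⋆ₐ[ℂ] B') : A ⊗[ℂ] B →⋆ₐ[ℂ] A' ⊗[ℂ] B' where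
  __ := Algebra.TensorProduct.map f.toAlgHom g.toAlgHom
  map_star' x := by
    change Algebra.TensorProduct.map f.toAlgHom g.toAlgHom (star x) =
      star (Algebra.TensorProduct.map f.toAlgHom g.toAlgHom x)
    induction x with
    | zero => simp
    | add x y hx hy => rw [star_add, map_add, map_add, hx, hy, star_add]
    | tmul a b =>
      rw [TensorProduct.star_tmul, Algebra.TensorProduct.map_tmul, Algebra.TensorProduct.map_tmul,
        TensorProduct.star_tmul]
      exact congrArg₂ _ (map_star f a) (map_star g b)

theorem algMap_tmul (f : A →⋆ₐ[ℂ] A') (g : B →⋆ₐ[ℂ] B') (a : A) (b : B) :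
    algMap f g (a ⊗ₜ b) = f a ⊗ₜ g b := rfl

theorem tensorRep_algMap (f : A →⋆ₐ[ℂ] A') (g : B →⋆ₐ[ℂ] B') (π : HilbertRep A')
    (σ : HilbertRep B') (x : A ⊗[ℂ] B) :
    ‖tensorRep π σ (algMap f g x)‖ = ‖tensorRep (π.comp f) (σ.comp g) x‖ := by
  have h : (tensorRep π σ).comp (algMap f g).toAlgHom = tensorRep (π.comp f) (σ.comp g) := by
    refine Algebra.TensorProduct.ext' fun a b => ?_
    exact (tensorRep_tmul π σ (f a) (g b)).trans
      (tensorRep_tmul (π.comp f) (σ.comp g) a b).symm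
  exact congrArg norm (DFunLike.congr_fun h x)

theorem norm_algMap_le (f : A →⋆ₐ[ℂ] A') (g : B →⋆ₐ[ℂ] B') (x : A ⊗[ℂ] B) :
    ‖(ofAlg : _ →⋆ₐ[ℂ] MinTensor A' B') (algMap f g x)‖ ≤ minSeminorm A B x := by
  rw [norm_ofAlg]
  refine ciSup_le fun P => ?_
  have h : repSeminorm P.1 P.2 (algMap f g x) = repSeminorm (P.1.comp f) (P.2.comp g) x :=
    tensorRep_algMap f g P.1 P.2 x
  rw [h]
  exact le_ciSup (bddAbove_repSeminorm x) (P.1.comp f, P.2.comp g)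

/-- The tensor product `f ⊗ g` of two *-homomorphisms. -/
def map (f : A →⋆ₐ[ℂ] A') (g : B →⋆ₐ[ℂ] B') : MinTensor A B →⋆ₐ[ℂ] MinTensor A' B' :=
  CStarSeminorm.lift (p := minSeminorm A B) (ofAlg.comp (algMap f g)) (norm_algMap_le f g)

theorem map_ofAlg (f : A →⋆ₐ[ℂ] A') (g : B →⋆ₐ[ℂ] B') (x : A ⊗[ℂ] B) :
    map f g (ofAlg x) = ofAlg (algMap f g x) :=
  CStarSeminorm.lift_toCompl _ _ x

@[simp] theorem map_inl (f : A →⋆ₐ[ℂ] A') (g : B →⋆ₐ[ℂ] B') (a : A) :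
    map f g (inl A B a) = inl A' B' (f a) := by
  rw [inl_apply, map_ofAlg, algMap_tmul, map_one, inl_apply]

@[simp] theorem map_inr (f : A →⋆ₐ[ℂ] A') (g : B →⋆ₐ[ℂ] B') (b : B) :
    map f g (inr A B b) = inr A' B' (g b) := by
  rw [inr_apply, map_ofAlg, algMap_tmul, map_one, inr_apply]

theorem hom_ext {D : Type v} [CStarAlgebra D] {f g : MinTensor A B →⋆ₐ[ℂ] D}
    (hl : ∀ a, f (inl A B a) = g (inl A B a)) (hr : ∀ b, f (inr A B b) = g (inr A B b)) :
    f = g := by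
  refine StarAlgHom.ext fun x => ?_
  refine congrFun ((denseRange_ofAlg (A := A) (B := B)).equalizer (continuous_hom f)
    (continuous_hom g) (funext fun y => ?_)) x
  simp only [Function.comp_apply]
  induction y with
  | zero => simp only [map_zero]
  | add x y hx hy => simp only [map_add, hx, hy]
  | tmul a b => rw [← inl_mul_inr, map_mul, map_mul, hl, hr]

end MinTensor

end BraidedSphere

end

noncomputable section

open scoped ComplexConjugate
open MeasureTheory

namespace BraidedSphere

universe u v

/-- A (point-norm continuous) action of the circle group `𝕋` on the C*-algebra `A`. -/
structure CircleAction (A : Type u) [CStarAlgebra A] where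
  toFun : Circle → (A →⋆ₐ[ℂ] A)
  map_one' : ∀ a, toFun 1 a = a
  map_mul' : ∀ z w a, toFun (z * w) a = toFun z (toFun w a)
  continuous' : ∀ a, Continuous fun z => toFun z a

namespace CircleAction

variable {A : Type u} [CStarAlgebra A] {B : Type v} [CStarAlgebra B]

instance : CoeFun (CircleAction A) (fun _ => Circle → (A →⋆ₐ[ℂ] A)) := ⟨toFun⟩

/-- `a` is homogeneous of degree `n`. -/
def IsHomogeneous (ρ : CircleAction A) (n : ℤ) (a : A) : Prop :=
  ∀ z : Circle, ρ z a = (z : ℂ) ^ n • a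

/-- The *-homomorphism `f` is `𝕋`-equivariant. -/
def Equivariant (ρ : CircleAction A) (τ : CircleAction B) (f : A →⋆ₐ[ℂ] B) : Prop :=
  ∀ z a, f (ρ z a) = τ z (f a)

variable (ρ : CircleAction A)

theorem norm_apply_le (z : Circle) (a : A) : ‖ρ z a‖ ≤ ‖a‖ :=
  NonUnitalStarAlgHom.norm_apply_le (ρ z) a

variable {ρ}

theorem IsHomogeneous.mul {m n : ℤ} {a b : A} (ha : ρ.IsHomogeneous m a)
    (hb : ρ.IsHomogeneous n b) : ρ.IsHomogeneous (m + n) (a * b) := fun z => by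
  rw [map_mul, ha, hb, smul_mul_smul_comm, zpow_add₀ (Circle.coe_ne_zero z)]

theorem IsHomogeneous.star {n : ℤ} {a : A} (ha : ρ.IsHomogeneous n a) :
    ρ.IsHomogeneous (-n) (star a) := fun z => by
  rw [map_star, ha, star_smul, star_zpow₀, zpow_neg, ← inv_zpow]
  congr 2
  rw [← Circle.coe_inv, Circle.coe_inv_eq_conj]
  rfl

theorem isHomogeneous_one : ρ.IsHomogeneous 0 1 := fun z => by simp

theorem IsHomogeneous.map {τ : CircleAction B} {f : A →⋆ₐ[ℂ] B} (hf : Equivariant ρ τ f)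
    {n : ℤ} {a : A} (ha : ρ.IsHomogeneous n a) : τ.IsHomogeneous n (f a) := fun z => by
  rw [← hf, ha, map_smul]

theorem fact_pos : Fact (0 < (1 : ℝ)) := ⟨one_pos⟩

attribute [local instance] fact_pos

theorem isHomogeneous_fourierCoeff (a : A) (n : ℤ) :
    ρ.IsHomogeneous n
      (fourierCoeff (T := (1 : ℝ)) (fun x : AddCircle (1 : ℝ) => ρ (AddCircle.toCircle x) a) n) := by
  intro z
  have hcont : Continuous fun x : AddCircle (1 : ℝ) => ρ (AddCircle.toCircle x) a :=
    (ρ.continuous' a).comp AddCircle.continuous_toCircle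
  obtain ⟨y, rfl⟩ : ∃ y : AddCircle (1 : ℝ), AddCircle.toCircle y = z := by
    refine ⟨(AddCircle.homeomorphCircle one_ne_zero).symm z, ?_⟩
    rw [← AddCircle.homeomorphCircle_apply one_ne_zero, Homeomorph.apply_symm_apply]
  have hint : Integrable (fun x : AddCircle (1 : ℝ) =>
      fourier (-n) x • ρ (AddCircle.toCircle x) a) AddCircle.haarAddCircle :=
    (((fourier (-n)).continuous.smul hcont).integrable_of_hasCompactSupport
      (HasCompactSupport.of_compactSpace _))
  let L : A →L[ℂ] A := ⟨(ρ (AddCircle.toCircle y)).toAlgHom.toLinearMap, continuous_hom _⟩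
  have h1 : ρ (AddCircle.toCircle y) (fourierCoeff (T := (1 : ℝ))
      (fun x : AddCircle (1 : ℝ) => ρ (AddCircle.toCircle x) a) n) =
      ∫ x : AddCircle (1 : ℝ), fourier (-n) x • ρ (AddCircle.toCircle (y + x)) a
        ∂AddCircle.haarAddCircle := by
    rw [fourierCoeff]
    refine (L.integral_comp_comm hint).symm.trans (integral_congr_ae (.of_forall fun x => ?_))
    change ρ (AddCircle.toCircle y) (fourier (-n) x • ρ (AddCircle.toCircle x) a) =
      fourier (-n) x • ρ (AddCircle.toCircle (y + x)) a
    rw [map_smul, AddCircle.toCircle_add, ρ.map_mul']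
  rw [h1, fourierCoeff, ← integral_smul]
  refine Eq.trans ?_ (integral_add_left_eq_self (μ := AddCircle.haarAddCircle) _ y)
  refine integral_congr_ae (.of_forall fun x => ?_)
  change fourier (-n) x • ρ (AddCircle.toCircle (y + x)) a =
    (AddCircle.toCircle y : ℂ) ^ n • (fourier (-n) (y + x) • ρ (AddCircle.toCircle (y + x)) a)
  rw [← mul_smul]
  congr 1
  rw [fourier_apply, fourier_apply, smul_add, AddCircle.toCircle_add, AddCircle.toCircle_zsmul y,
    Circle.coe_mul, Circle.coe_zpow, ← mul_assoc, ← zpow_add₀ (Circle.coe_ne_zero _),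
    add_neg_cancel, zpow_zero, one_mul]

variable (ρ) in
/-- The homogeneous elements span a dense subspace. -/
theorem dense_span_homogeneous :
    (Submodule.span ℂ {a : A | ∃ n, ρ.IsHomogeneous n a}).topologicalClosure = ⊤ := by
  set S := (Submodule.span ℂ {a : A | ∃ n, ρ.IsHomogeneous n a}).topologicalClosure with hS
  have hcl : IsClosed (S : Set A) := Submodule.isClosed_topologicalClosure _
  rw [eq_top_iff]
  rintro a -
  by_contra ha
  have := hcl
  have hne : S.mkQL a ≠ 0 := by
    rw [Submodule.mkQL_apply, Submodule.mkQ_apply, Ne, Submodule.Quotient.mk_eq_zero]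
    exact ha
  obtain ⟨φ, hφ⟩ := SeparatingDual.exists_ne_zero (R := ℂ) hne
  let ψ : A →L[ℂ] ℂ := φ.comp S.mkQL
  have hψ : ∀ n b, ρ.IsHomogeneous n b → ψ b = 0 := by
    intro n b hb
    have : b ∈ S := Submodule.le_topologicalClosure _ (Submodule.subset_span ⟨n, hb⟩)
    change φ (S.mkQL b) = 0
    rw [Submodule.mkQL_apply, Submodule.mkQ_apply, (Submodule.Quotient.mk_eq_zero S).mpr this,
      map_zero]
  have hcont : Continuous fun x : AddCircle (1 : ℝ) => ρ (AddCircle.toCircle x) a :=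
    (ρ.continuous' a).comp AddCircle.continuous_toCircle
  let F : C(AddCircle (1 : ℝ), ℂ) := ⟨fun x => ψ (ρ (AddCircle.toCircle x) a),
    ψ.continuous.comp hcont⟩
  have hF : ∀ n, fourierCoeff F n = 0 := by
    intro n
    have hint : Integrable (fun x : AddCircle (1 : ℝ) =>
        fourier (-n) x • ρ (AddCircle.toCircle x) a) AddCircle.haarAddCircle :=
      (((fourier (-n)).continuous.smul hcont).integrable_of_hasCompactSupport
        (HasCompactSupport.of_compactSpace _))
    rw [← hψ n _ (isHomogeneous_fourierCoeff (ρ := ρ) a n), fourierCoeff, fourierCoeff,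
      ← ψ.integral_comp_comm hint]
    refine integral_congr_ae (.of_forall fun x => ?_)
    change _ • ψ (ρ (AddCircle.toCircle x) a) = ψ (_ • ρ (AddCircle.toCircle x) a)
    rw [map_smul]
  have hF' : fourierCoeff F = 0 := funext hF
  have h0 := has_pointwise_sum_fourier_series_of_summable (f := F)
    (by rw [hF']; exact summable_zero) 0
  simp only [hF, zero_smul] at h0
  have h1 : F 0 = 0 := h0.unique hasSum_zero
  refine hφ ?_
  change ψ (ρ (AddCircle.toCircle 0) a) = 0 at h1
  rw [AddCircle.toCircle_zero, ρ.map_one'] at h1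
  exact h1

variable (ρ) in
/-- Induction over homogeneous elements, sums and limits. -/
theorem induction_homogeneous {P : A → Prop} (hc : IsClosed {a | P a}) (h0 : P 0)
    (hadd : ∀ x y, P x → P y → P (x + y)) (hsmul : ∀ (c : ℂ) x, P x → P (c • x))
    (hh : ∀ n a, ρ.IsHomogeneous n a → P a) (a : A) : P a := by
  let S : Submodule ℂ A :=
    { carrier := {a | P a}
      zero_mem' := h0
      add_mem' := fun {x y} hx hy => hadd x y hx hy
      smul_mem' := hsmul }
  have h1 : (Submodule.span ℂ {a : A | ∃ n, ρ.IsHomogeneous n a}).topologicalClosure ≤ S := by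
    refine Submodule.topologicalClosure_minimal _ (Submodule.span_le.mpr ?_) hc
    rintro a ⟨n, ha⟩
    exact hh n a ha
  rw [dense_span_homogeneous] at h1
  exact h1 trivial

end CircleAction

end BraidedSphere

end

noncomputable section

open scoped ComplexConjugate InnerProductSpace
open Filter Topology

namespace BraidedSphere

universe u v

section Estimates

variable {D : Type u} [CStarAlgebra D]

/-- Cauchy-Schwarz inequality in the Hilbert module `D ^ n`. -/
theorem norm_sum_star_mul_sq_le {ι : Type} [Fintype ι] (x y : ι → D) :
    ‖∑ i, star (x i) * y i‖ ^ 2 ≤ ‖∑ i, star (x i) * x i‖ * ‖∑ i, star (y i) * y i‖ := by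
  let _ : PartialOrder D := CStarAlgebra.spectralOrder D
  have _ : StarOrderedRing D := CStarAlgebra.spectralOrderedRing D
  let X : WithCStarModule D (ι → D) := (WithCStarModule.equiv D (ι → D)).symm fun i => star (y i)
  let Y : WithCStarModule D (ι → D) := (WithCStarModule.equiv D (ι → D)).symm fun i => star (x i)
  have h := CStarModule.norm_inner_le (A := D) (WithCStarModule D (ι → D)) (x := X) (y := Y)
  have h1 : (inner D X Y : D) = ∑ i, star (x i) * y i := by
    rw [WithCStarModule.pi_inner]
    refine Finset.sum_congr rfl fun i _ => ?_
    change star (x i) * star (star (y i)) = _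
    rw [star_star]
  have h2 : ‖X‖ ^ 2 = ‖∑ i, star (y i) * y i‖ := by
    rw [WithCStarModule.pi_norm_sq]
    congr 1
    refine Finset.sum_congr rfl fun i _ => ?_
    change star (y i) * star (star (y i)) = _
    rw [star_star]
  have h3 : ‖Y‖ ^ 2 = ‖∑ i, star (x i) * x i‖ := by
    rw [WithCStarModule.pi_norm_sq]
    congr 1
    refine Finset.sum_congr rfl fun i _ => ?_
    change star (x i) * star (star (x i)) = _
    rw [star_star]
  rw [h1] at h
  calc _ ≤ (‖X‖ * ‖Y‖) ^ 2 := pow_le_pow_left₀ (norm_nonneg _) h 2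
    _ = _ := by rw [mul_pow, h2, h3, mul_comm]

theorem norm_sum_conj_le {ι : Type} [Fintype ι] (g b : ι → D) (c : ℝ) (hc : 0 ≤ c)
    (hg : ∑ i, star (g i) * g i = 1) (hb : ∀ i, ‖b i‖ ≤ c) :
    ‖∑ i, star (g i) * b i * g i‖ ≤ c := by
  let _ : PartialOrder D := CStarAlgebra.spectralOrder D
  have _ : StarOrderedRing D := CStarAlgebra.spectralOrderedRing D
  rcases subsingleton_or_nontrivial D with hD | hD
  · rw [Subsingleton.elim (∑ i, star (g i) * b i * g i) 0, norm_zero]; exact hc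
  have h := norm_sum_star_mul_sq_le g (fun i => b i * g i)
  rw [hg, norm_one, one_mul] at h
  have h1 : ‖∑ i, star (b i * g i) * (b i * g i)‖ ≤ c ^ 2 := by
    have h2 : ∑ i, star (b i * g i) * (b i * g i) ≤ (c ^ 2 : ℝ) • (1 : D) := by
      rw [← hg, Finset.smul_sum]
      refine Finset.sum_le_sum fun i _ => ?_
      have h3 := CStarAlgebra.star_left_conjugate_le_norm_smul (a := g i) (b := star (b i) * b i)
        (IsSelfAdjoint.star_mul_self _)
      have h4 : star (b i * g i) * (b i * g i) = star (g i) * (star (b i) * b i) * g i := by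
        rw [star_mul]; simp only [mul_assoc]
      rw [h4]
      refine h3.trans (smul_le_smul_of_nonneg_right ?_ (star_mul_self_nonneg _))
      rw [CStarRing.norm_star_mul_self, sq]
      exact mul_self_le_mul_self (norm_nonneg _) (hb i)
    have h5 := CStarAlgebra.norm_le_norm_of_nonneg_of_le
      (Finset.sum_nonneg fun i _ => star_mul_self_nonneg (b i * g i)) h2
    rwa [norm_smul, norm_one, mul_one, Real.norm_of_nonneg (sq_nonneg c)] at h5
  simp only [mul_assoc]
  exact le_of_sq_le_sq (h.trans h1) hc

end Estimates

section Twist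

variable {D : Type u} [CStarAlgebra D]

/-- The root of unity `exp (2πi / M)`. -/
def root (M : ℕ) : Circle := Circle.exp (2 * Real.pi / M)

theorem coe_root (M : ℕ) : (root M : ℂ) = Complex.exp (2 * Real.pi * Complex.I / M) := by
  rw [root, Circle.coe_exp]
  push_cast
  congr 1
  ring

theorem isPrimitiveRoot_root {M : ℕ} (hM : M ≠ 0) : IsPrimitiveRoot (root M : ℂ) M := by
  rw [coe_root]; exact Complex.isPrimitiveRoot_exp M hM

theorem star_mul_self_circle (z : Circle) : star (z : ℂ) * z = 1 := by
  have h := Circle.coe_inv_eq_conj z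
  rw [← starRingEnd_apply, ← h, Circle.coe_inv, inv_mul_cancel₀ (Circle.coe_ne_zero z)]

theorem sum_root {M : ℕ} (hM : M ≠ 0) {k l : ℕ} (hk : k < M) (hl : l < M) :
    ∑ j : Fin M, (star (((root M : ℂ) ^ (j : ℕ)) ^ l) * ((root M : ℂ) ^ (j : ℕ)) ^ k) =
      if k = l then (M : ℂ) else 0 := by
  set ω : ℂ := (root M : ℂ) with hω
  have hp := isPrimitiveRoot_root hM
  have h1 : star ω * ω = 1 := star_mul_self_circle _
  have h2 : ∀ j : ℕ, star ((ω ^ j) ^ l) * (ω ^ j) ^ k = (star ω ^ l * ω ^ k) ^ j := by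
    intro j
    rw [star_pow, star_pow, mul_pow, ← pow_mul, ← pow_mul, ← pow_mul, ← pow_mul, mul_comm l j,
      mul_comm k j]
  simp only [h2]
  rw [Fin.sum_univ_eq_sum_range (fun j => (star ω ^ l * ω ^ k) ^ j) M]
  split_ifs with h
  · subst h
    rw [← mul_pow, h1]
    simp
  · have h3 : star ω ^ l * ω ^ k ≠ 1 := by
      intro h4
      apply h
      refine hp.pow_inj hk hl ?_
      rw [← hω]
      calc ω ^ k = (star ω * ω) ^ l * ω ^ k := by rw [h1, one_pow, one_mul]
        _ = ω ^ l * (star ω ^ l * ω ^ k) := by rw [mul_pow]; ring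
        _ = _ := by rw [h4, mul_one]
    have h5 := mul_geom_sum (star ω ^ l * ω ^ k) M
    have h6 : (star ω ^ l * ω ^ k) ^ M = 1 := by
      have h7 : ω ^ M = 1 := hp.pow_eq_one
      rw [mul_pow, ← pow_mul, ← pow_mul, mul_comm l, mul_comm k, pow_mul, pow_mul, ← star_pow, h7]
      simp
    rw [h6, sub_self] at h5
    exact (mul_eq_zero.mp h5).resolve_left (sub_ne_zero.mpr h3)

/-- `(1 / M) ∑ (ω ^ (-j) u) ^ k` over `k < M`, with `ω = exp (2πi / M)`. -/
def partition (w : D) (M : ℕ) (j : Fin M) : D :=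
  (M : ℂ)⁻¹ • ∑ k : Fin M, ((star (root M : ℂ) ^ (j : ℕ)) • w) ^ (k : ℕ)

theorem norm_unitary_le {w : D} (hw : w ∈ unitary D) : ‖w‖ ≤ 1 := by
  rcases subsingleton_or_nontrivial D with hD | hD
  · rw [Subsingleton.elim w 0, norm_zero]; exact zero_le_one
  · exact (CStarRing.norm_of_mem_unitary hw).le

theorem star_partition (w : D) (M : ℕ) (j : Fin M) : star (partition w M j) =
    (M : ℂ)⁻¹ • ∑ l : Fin M, star (((star (root M : ℂ) ^ (j : ℕ)) • w) ^ (l : ℕ)) := by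
  rw [partition, star_smul, star_sum, star_inv₀, star_natCast]

theorem sum_partition {w : D} (hw : w ∈ unitary D) {M : ℕ} (hM : M ≠ 0) :
    ∑ j, star (partition w M j) * partition w M j = 1 := by
  have hM' : (M : ℂ) ≠ 0 := Nat.cast_ne_zero.mpr hM
  have h1 : ∀ j : Fin M, star (partition w M j) * partition w M j =
      ((M : ℂ)⁻¹ * (M : ℂ)⁻¹) • ∑ l : Fin M, ∑ k : Fin M,
        (star (((root M : ℂ) ^ (j : ℕ)) ^ (k : ℕ)) * ((root M : ℂ) ^ (j : ℕ)) ^ (l : ℕ)) •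
          (star (w ^ (l : ℕ)) * w ^ (k : ℕ)) := by
    intro j
    rw [star_partition, partition, smul_mul_smul_comm, Finset.sum_mul_sum]
    congr 1
    refine Finset.sum_congr rfl fun l _ => Finset.sum_congr rfl fun k _ => ?_
    rw [smul_pow, smul_pow, star_smul, smul_mul_smul_comm]
    congr 1
    simp only [star_pow, star_star]
    ring
  simp only [h1]
  rw [← Finset.smul_sum, Finset.sum_comm]
  have h2 : ∀ l : Fin M, ∑ j : Fin M, ∑ k : Fin M,
      (star (((root M : ℂ) ^ (j : ℕ)) ^ (k : ℕ)) * ((root M : ℂ) ^ (j : ℕ)) ^ (l : ℕ)) •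
          (star (w ^ (l : ℕ)) * w ^ (k : ℕ)) = (M : ℂ) • (1 : D) := by
    intro l
    rw [Finset.sum_comm]
    simp only [← Finset.sum_smul, sum_root hM l.2 (Fin.is_lt _)]
    rw [Finset.sum_eq_single l]
    · rw [if_pos rfl, (Unitary.mem_iff.mp (pow_mem hw (l : ℕ))).1]
    · intro k _ hk
      rw [if_neg (fun h => hk (Fin.ext h.symm)), zero_smul]
    · simp
  simp only [h2]
  rw [Finset.sum_const, Finset.card_univ, Fintype.card_fin, ← Nat.cast_smul_eq_nsmul ℂ, smul_smul,
    smul_smul]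
  have h3 : (M : ℂ)⁻¹ * (M : ℂ)⁻¹ * ((M : ℂ) * (M : ℂ)) = 1 := by field_simp
  rw [← mul_assoc] at h3
  rw [h3, one_smul]

theorem partition_mul (w : D) {M : ℕ} (hM : M ≠ 0) (j : Fin M) :
    ((root M : ℂ) ^ (j : ℕ)) • partition w M j - partition w M j * w =
      ((root M : ℂ) ^ (j : ℕ)) • ((M : ℂ)⁻¹ • (1 - w ^ M)) := by
  set ω : ℂ := (root M : ℂ) ^ (j : ℕ) with hω
  have h1 : ω * star (root M : ℂ) ^ (j : ℕ) = 1 := by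
    rw [hω, ← mul_pow, mul_comm, star_mul_self_circle, one_pow]
  set x : D := (star (root M : ℂ) ^ (j : ℕ)) • w with hx
  have h2 : w = ω • x := by rw [hx, smul_smul, h1, one_smul]
  have h3 : x ^ M = w ^ M := by
    rw [hx, smul_pow, ← pow_mul, mul_comm, pow_mul, ← star_pow, (isPrimitiveRoot_root hM).pow_eq_one,
      star_one, one_pow, one_smul]
  have h4 := geom_sum_mul x M
  rw [← Fin.sum_univ_eq_sum_range (fun j => x ^ j) M] at h4
  have h5 : partition w M j * w = ω • ((M : ℂ)⁻¹ • ((∑ k : Fin M, x ^ (k : ℕ)) * x)) := by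
    conv_lhs => rw [h2]
    rw [mul_smul_comm, partition, smul_mul_assoc, ← h2]
  rw [h5, partition, ← smul_sub, ← smul_sub, ← h3]
  congr 2
  rw [mul_sub, mul_one] at h4
  rw [← neg_sub, h4, neg_sub]

/-- `∑ ω ^ (j n) g_j⋆ g_j`. -/
def approx (w : D) (M n : ℕ) : D :=
  ∑ j : Fin M, ((root M : ℂ) ^ (j : ℕ)) ^ n • (star (partition w M j) * partition w M j)

theorem norm_approx_succ_sub {w : D} (hw : w ∈ unitary D) {M : ℕ} (hM : M ≠ 0) (n : ℕ) :
    ‖approx w M (n + 1) - approx w M n * w‖ ≤ √(4 / M) := by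
  have hM' : (0 : ℝ) < M := Nat.cast_pos.mpr (Nat.pos_of_ne_zero hM)
  refine Real.le_sqrt_of_sq_le ?_
  set δ : D := (M : ℂ)⁻¹ • (1 - w ^ M) with hδ
  have h1 : approx w M (n + 1) - approx w M n * w =
      ∑ j : Fin M, star (star (((root M : ℂ) ^ (j : ℕ)) ^ n) • partition w M j) *
        (((root M : ℂ) ^ (j : ℕ)) • δ) := by
    rw [approx, approx, Finset.sum_mul, ← Finset.sum_sub_distrib]
    refine Finset.sum_congr rfl fun j _ => ?_
    rw [hδ, ← partition_mul w hM j, star_smul, star_star, smul_mul_assoc, smul_mul_assoc, mul_sub,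
      smul_sub, pow_succ, mul_smul, mul_smul_comm, mul_assoc]
  have hz : ∀ (j : Fin M) (n : ℕ), star (((root M : ℂ) ^ (j : ℕ)) ^ n) *
      ((root M : ℂ) ^ (j : ℕ)) ^ n = 1 := by
    intro j n
    rw [star_pow, star_pow, ← mul_pow, ← mul_pow, star_mul_self_circle, one_pow, one_pow]
  rw [h1]
  refine (norm_sum_star_mul_sq_le _ _).trans ?_
  have h2 : ∑ j : Fin M, star (star (((root M : ℂ) ^ (j : ℕ)) ^ n) • partition w M j) *
      (star (((root M : ℂ) ^ (j : ℕ)) ^ n) • partition w M j) = 1 := by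
    rw [← sum_partition hw hM]
    refine Finset.sum_congr rfl fun j _ => ?_
    rw [star_smul, smul_mul_smul_comm, star_star, mul_comm, hz, one_smul]
  have h3 : ∑ j : Fin M, star (((root M : ℂ) ^ (j : ℕ)) • δ) * (((root M : ℂ) ^ (j : ℕ)) • δ) =
      (M : ℝ) • (star δ * δ) := by
    have h4 : ∀ j : Fin M, star (((root M : ℂ) ^ (j : ℕ)) • δ) * (((root M : ℂ) ^ (j : ℕ)) • δ) =
        star δ * δ := by
      intro j
      have h5 := hz j 1
      rw [pow_one] at h5
      rw [star_smul, smul_mul_smul_comm, h5, one_smul]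
    simp only [h4]
    rw [Finset.sum_const, Finset.card_univ, Fintype.card_fin, ← Nat.cast_smul_eq_nsmul ℝ]
  have h6 : ‖δ‖ ≤ 2 / M := by
    rw [hδ, norm_smul, norm_inv, Complex.norm_natCast, div_eq_inv_mul]
    refine mul_le_mul_of_nonneg_left ?_ (by positivity)
    have h7 := norm_sub_le (1 : D) (w ^ M)
    have h8 := norm_unitary_le (one_mem (unitary D))
    have h9 := norm_unitary_le (pow_mem hw M)
    linarith
  rw [h2, h3, norm_smul, CStarRing.norm_star_mul_self, Real.norm_of_nonneg hM'.le]
  have h10 := norm_unitary_le (one_mem (unitary D))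
  calc ‖(1 : D)‖ * (M * (‖δ‖ * ‖δ‖)) ≤ 1 * (M * (2 / M * (2 / M))) := by gcongr
    _ = _ := by field_simp; norm_num

theorem tendsto_approx {w : D} (hw : w ∈ unitary D) (n : ℕ) :
    Tendsto (fun M => approx w M n) atTop (𝓝 (w ^ n)) := by
  induction n with
  | zero =>
    refine tendsto_const_nhds.congr' ?_
    filter_upwards [eventually_ne_atTop 0] with M hM
    simp only [approx, pow_zero, one_smul]
    exact (sum_partition hw hM).symm
  | succ n ih =>
    have h1 : Tendsto (fun M : ℕ => √(4 / (M : ℝ))) atTop (𝓝 0) := by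
      have := (tendsto_const_div_atTop_nhds_zero_nat (4 : ℝ)).sqrt
      rwa [Real.sqrt_zero] at this
    have h2 : Tendsto (fun M => approx w M (n + 1) - approx w M n * w) atTop (𝓝 0) := by
      refine squeeze_zero_norm' ?_ h1
      filter_upwards [eventually_ne_atTop 0] with M hM
      exact norm_approx_succ_sub hw hM n
    have h3 := h2.add (ih.mul_const w)
    rw [zero_add, ← pow_succ] at h3
    exact h3.congr fun M => sub_add_cancel _ _

end Twist

end BraidedSphere

end

noncomputable section

open scoped ComplexConjugate
open Filter Topology

namespace BraidedSphere

universe u v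

variable {A : Type u} [CStarAlgebra A] {D : Type v} [CStarAlgebra D]

/-- `∑ g_j⋆ κ(ρ_{ω ^ j} a) g_j`, an approximation of the twisted homomorphism below. -/
def twistApprox (ρ : CircleAction A) (κ : A →⋆ₐ[ℂ] D) (w : D) (M : ℕ) (a : A) : D :=
  ∑ j : Fin M, star (partition w M j) * κ (ρ (root M ^ (j : ℕ)) a) * partition w M j

section

variable {ρ : CircleAction A} {κ : A →⋆ₐ[ℂ] D} {w : D}

theorem twistApprox_add (M : ℕ) (a b : A) :
    twistApprox ρ κ w M (a + b) = twistApprox ρ κ w M a + twistApprox ρ κ w M b := by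
  simp only [twistApprox, map_add, mul_add, add_mul, Finset.sum_add_distrib]

theorem twistApprox_smul (M : ℕ) (c : ℂ) (a : A) :
    twistApprox ρ κ w M (c • a) = c • twistApprox ρ κ w M a := by
  simp only [twistApprox, map_smul, mul_smul_comm, smul_mul_assoc, Finset.smul_sum]

theorem twistApprox_star (M : ℕ) (a : A) :
    twistApprox ρ κ w M (star a) = star (twistApprox ρ κ w M a) := by
  simp only [twistApprox, star_sum, star_mul, star_star, map_star, mul_assoc]

theorem twistApprox_sub (M : ℕ) (a b : A) :
    twistApprox ρ κ w M (a - b) = twistApprox ρ κ w M a - twistApprox ρ κ w M b := by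
  simp only [twistApprox, map_sub, mul_sub, sub_mul, Finset.sum_sub_distrib]

theorem norm_twistApprox_le (hw : w ∈ unitary D) (M : ℕ) (a : A) :
    ‖twistApprox ρ κ w M a‖ ≤ ‖a‖ := by
  rcases eq_or_ne M 0 with rfl | hM
  · simp [twistApprox]
  · refine norm_sum_conj_le _ _ _ (norm_nonneg a) (sum_partition hw hM) fun j => ?_
    exact (NonUnitalStarAlgHom.norm_apply_le κ _).trans (ρ.norm_apply_le _ a)

theorem commute_partition {b : D} (hb : Commute w b) (M : ℕ) (j : Fin M) :
    Commute b (partition w M j) := by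
  refine Commute.smul_right (Commute.sum_right _ _ _ fun k _ => ?_) _
  exact ((hb.symm).smul_right _).pow_right _

theorem tendsto_twistApprox_nat (hw : w ∈ unitary D) (hκ : ∀ a, Commute w (κ a)) {n : ℕ} {a : A}
    (ha : ρ.IsHomogeneous n a) :
    Tendsto (fun M => twistApprox ρ κ w M a) atTop (𝓝 (w ^ n * κ a)) := by
  refine ((tendsto_approx hw n).mul_const (κ a)).congr fun M => ?_
  rw [approx, twistApprox, Finset.sum_mul]
  refine Finset.sum_congr rfl fun j _ => ?_
  rw [ha, map_smul, mul_smul_comm, smul_mul_assoc, smul_mul_assoc, mul_assoc, mul_assoc,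
    (commute_partition (hκ a) M j).eq, Circle.coe_pow, zpow_natCast]

theorem tendsto_twistApprox (w : unitary D) (hκ : ∀ a, Commute (w : D) (κ a)) {n : ℤ} {a : A}
    (ha : ρ.IsHomogeneous n a) :
    Tendsto (fun M => twistApprox ρ κ (w : D) M a) atTop
      (𝓝 (((w ^ n : unitary D) : D) * κ a)) := by
  obtain ⟨m, rfl | rfl⟩ := n.eq_nat_or_neg
  · have := tendsto_twistApprox_nat w.2 hκ ha
    rwa [zpow_natCast, SubmonoidClass.coe_pow]
  · have h1 := ha.star
    rw [neg_neg] at h1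
    have h2 := (tendsto_twistApprox_nat w.2 hκ h1).star
    have h3 : star ((w : D) ^ m * κ (star a)) = ((w ^ (-(m : ℤ)) : unitary D) : D) * κ a := by
      rw [((hκ (star a)).pow_left m).eq, star_mul, ← map_star, star_star, zpow_neg, zpow_natCast,
        ← SubmonoidClass.coe_pow]
      rfl
    rw [h3] at h2
    refine h2.congr fun M => ?_
    rw [twistApprox_star, star_star]

theorem exists_tendsto_twistApprox (w : unitary D) (hκ : ∀ a, Commute (w : D) (κ a)) (a : A) :
    ∃ l, Tendsto (fun M => twistApprox ρ κ (w : D) M a) atTop (𝓝 l) := by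
  suffices h : CauchySeq (fun M => twistApprox ρ κ (w : D) M a) from
    cauchySeq_tendsto_of_complete h
  refine ρ.induction_homogeneous
    (P := fun a => CauchySeq (fun M => twistApprox ρ κ (w : D) M a)) ?_ ?_ ?_ ?_ ?_ a
  · refine isClosed_of_closure_subset fun a ha => ?_
    refine Metric.cauchySeq_iff'.mpr fun ε hε => ?_
    obtain ⟨b, hb, hab⟩ := Metric.mem_closure_iff.mp ha (ε / 3) (by positivity)
    obtain ⟨N, hN⟩ := Metric.cauchySeq_iff'.mp hb (ε / 3) (by positivity)
    refine ⟨N, fun n hn => ?_⟩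
    have h1 : ∀ M, dist (twistApprox ρ κ (w : D) M a) (twistApprox ρ κ (w : D) M b) < ε / 3 := by
      intro M
      rw [dist_eq_norm, ← twistApprox_sub]
      rw [dist_eq_norm] at hab
      exact (norm_twistApprox_le w.2 M _).trans_lt hab
    calc _ ≤ _ := dist_triangle4 _ (twistApprox ρ κ (w : D) n b) (twistApprox ρ κ (w : D) N b) _
      _ < ε / 3 + ε / 3 + ε / 3 := by
        have h2 := h1 n
        have h3 := hN n hn
        have h4 := h1 N
        rw [dist_comm] at h4
        linarith
      _ = ε := by ring
  · have h0 : ∀ M, twistApprox ρ κ (w : D) M 0 = 0 := fun M => by simp [twistApprox]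
    simp only [h0]
    exact tendsto_const_nhds.cauchySeq
  · intro x y hx hy
    obtain ⟨l, hl⟩ := cauchySeq_tendsto_of_complete hx
    obtain ⟨m, hm⟩ := cauchySeq_tendsto_of_complete hy
    simp only [twistApprox_add]
    exact (hl.add hm).cauchySeq
  · intro c x hx
    obtain ⟨l, hl⟩ := cauchySeq_tendsto_of_complete hx
    simp only [twistApprox_smul]
    exact (hl.const_smul c).cauchySeq
  · intro n a ha
    exact (tendsto_twistApprox w hκ ha).cauchySeq

end

/-- If the unitary `w` commutes with the image of `κ : A → D`, then there is a (unique)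
*-homomorphism `A → D` that maps every homogeneous `a` of degree `n` to `w ^ n κ(a)`. -/
theorem exists_twist (ρ : CircleAction A) (κ : A →⋆ₐ[ℂ] D) (w : unitary D)
    (hκ : ∀ a, Commute (w : D) (κ a)) :
    ∃ J : A →⋆ₐ[ℂ] D, ∀ n a, ρ.IsHomogeneous n a → J a = ((w ^ n : unitary D) : D) * κ a := by
  choose J hJ using exists_tendsto_twistApprox (ρ := ρ) w hκ
  have hhom : ∀ n a, ρ.IsHomogeneous n a → J a = ((w ^ n : unitary D) : D) * κ a :=
    fun n a ha => tendsto_nhds_unique (hJ a) (tendsto_twistApprox w hκ ha)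
  have hadd : ∀ a b, J (a + b) = J a + J b := fun a b =>
    tendsto_nhds_unique (hJ (a + b)) (((hJ a).add (hJ b)).congr fun M => (twistApprox_add M a b).symm)
  have hsmul : ∀ (c : ℂ) a, J (c • a) = c • J a := fun c a =>
    tendsto_nhds_unique (hJ (c • a)) (((hJ a).const_smul c).congr fun M =>
      (twistApprox_smul M c a).symm)
  have hstar : ∀ a, J (star a) = star (J a) := fun a =>
    tendsto_nhds_unique (hJ (star a)) ((hJ a).star.congr fun M => (twistApprox_star M a).symm)
  have hnorm : ∀ a, ‖J a‖ ≤ ‖a‖ := fun a =>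
    le_of_tendsto' (hJ a).norm fun M => norm_twistApprox_le w.2 M a
  have hzero : J 0 = 0 := by simpa using hsmul 0 0
  have hcont : Continuous J := AddMonoidHomClass.continuous_of_bound (AddMonoidHom.mk' J hadd) 1
    (fun x => (hnorm x).trans (one_mul ‖x‖).ge)
  have hpow : ∀ (n : ℤ) a, Commute ((w ^ n : unitary D) : D) (κ a) := by
    intro n a
    have h1 : ∀ (m : ℕ) b, Commute ((w ^ m : unitary D) : D) (κ b) := fun m b => by
      rw [SubmonoidClass.coe_pow]; exact (hκ b).pow_left m
    obtain ⟨m, rfl | rfl⟩ := n.eq_nat_or_neg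
    · rw [zpow_natCast]; exact h1 m a
    · have h2 := (h1 m (star a)).star_star
      rw [← map_star, star_star] at h2
      rw [zpow_neg, zpow_natCast]
      exact h2
  have hmul : ∀ a b, J (a * b) = J a * J b := by
    intro a b
    refine ρ.induction_homogeneous (P := fun a => J (a * b) = J a * J b)
      (isClosed_eq (hcont.comp (continuous_mul_const b)) (hcont.mul continuous_const))
      (by rw [zero_mul, hzero, zero_mul])
      (fun x y hx hy => by rw [add_mul, hadd, hx, hy, hadd, add_mul])
      (fun c x hx => by rw [smul_mul_assoc, hsmul, hx, hsmul, smul_mul_assoc]) (fun m a ha => ?_) a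
    refine ρ.induction_homogeneous (P := fun b => J (a * b) = J a * J b)
      (isClosed_eq (hcont.comp (continuous_const_mul a)) (continuous_const.mul hcont))
      (by rw [mul_zero, hzero, mul_zero])
      (fun x y hx hy => by rw [mul_add, hadd, hx, hy, hadd, mul_add])
      (fun c x hx => by rw [mul_smul_comm, hsmul, hx, hsmul, mul_smul_comm]) (fun n b hb => ?_) b
    rw [hhom _ _ (ha.mul hb), hhom _ _ ha, hhom _ _ hb, map_mul, zpow_add]
    change _ * _ * (_ * _) = _
    rw [mul_assoc, ← mul_assoc _ (κ a) (κ b), (hpow n a).eq]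
    simp only [mul_assoc]
  have hone : J 1 = 1 := by
    rw [hhom 0 1 CircleAction.isHomogeneous_one, zpow_zero, map_one]
    exact mul_one _
  exact ⟨{ toFun := J
           map_one' := hone
           map_mul' := hmul
           map_zero' := hzero
           map_add' := hadd
           commutes' := fun c => by
            rw [Algebra.algebraMap_eq_smul_one, Algebra.algebraMap_eq_smul_one, hsmul, hone]
           map_star' := hstar }, hhom⟩

/-- The *-homomorphism that maps every homogeneous `a` of degree `n` to `w ^ n κ(a)`. -/
def twist (ρ : CircleAction A) (κ : A →⋆ₐ[ℂ] D) (w : unitary D)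
    (hκ : ∀ a, Commute (w : D) (κ a)) : A →⋆ₐ[ℂ] D := (exists_twist ρ κ w hκ).choose

theorem twist_apply {ρ : CircleAction A} {κ : A →⋆ₐ[ℂ] D} {w : unitary D}
    {hκ : ∀ a, Commute (w : D) (κ a)} {n : ℤ} {a : A} (ha : ρ.IsHomogeneous n a) :
    twist ρ κ w hκ a = ((w ^ n : unitary D) : D) * κ a :=
  (exists_twist ρ κ w hκ).choose_spec n a ha

theorem CircleAction.hom_ext (ρ : CircleAction A) {f g : A →⋆ₐ[ℂ] D}
    (h : ∀ n a, ρ.IsHomogeneous n a → f a = g a) : f = g :=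
  StarAlgHom.ext fun a => ρ.induction_homogeneous (P := fun a => f a = g a)
    (isClosed_eq (continuous_hom f) (continuous_hom g)) (by rw [map_zero, map_zero])
    (fun x y hx hy => by rw [map_add, hx, hy, map_add])
    (fun c x hx => by rw [map_smul, hx, map_smul]) h a

end BraidedSphere

end

noncomputable section

open scoped ComplexConjugate
open Filter Topology

namespace BraidedSphere

universe u v

section Continuity

variable {A : Type u} [CStarAlgebra A] {D : Type v} [CStarAlgebra D]

theorem isClosed_continuous_family (f : Circle → (A →⋆ₐ[ℂ] D)) :
    IsClosed {a | Continuous fun z => f z a} := by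
  refine isClosed_of_closure_subset fun a ha => ?_
  refine continuous_of_uniform_approx_of_continuous fun U hU => ?_
  obtain ⟨ε, hε, hU'⟩ := Metric.mem_uniformity_dist.mp hU
  obtain ⟨b, hb, hab⟩ := Metric.mem_closure_iff.mp ha ε hε
  refine ⟨fun z => f z b, hb, fun z => hU' ?_⟩
  rw [dist_eq_norm, ← map_sub]
  rw [dist_eq_norm] at hab
  exact (NonUnitalStarAlgHom.norm_apply_le (f z) _).trans_lt hab

end Continuity

section Graded

variable {ι : Type u} {R : Set (FreeStarAlgebra ι)} {h : Admissible R}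

/-- The action of `𝕋` on a universal C*-algebra for which the generator `i` has degree `d i`; it
exists if the relations are preserved. -/
def gradedAction (d : ι → ℤ)
    (hd : ∀ z : Circle, ∀ r ∈ R,
      FreeStarAlgebra.eval (fun i => (z : ℂ) ^ d i • UnivCStar.gen R h i) r = 0) :
    CircleAction (UnivCStar R h) where
  toFun z := UnivCStar.lift (fun i => (z : ℂ) ^ d i • UnivCStar.gen R h i) (hd z)
  map_one' a := by
    refine DFunLike.congr_fun (f := UnivCStar.lift _ (hd 1))
      (g := StarAlgHom.id ℂ (UnivCStar R h)) (UnivCStar.hom_ext fun i => ?_) a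
    rw [UnivCStar.lift_gen, Circle.coe_one, one_zpow, one_smul]
    rfl
  map_mul' z w a := by
    refine DFunLike.congr_fun (f := UnivCStar.lift _ (hd (z * w)))
      (g := (UnivCStar.lift _ (hd z)).comp (UnivCStar.lift _ (hd w)))
      (UnivCStar.hom_ext fun i => ?_) a
    rw [StarAlgHom.comp_apply, UnivCStar.lift_gen, UnivCStar.lift_gen, map_smul,
      UnivCStar.lift_gen, smul_smul, Circle.coe_mul, mul_zpow, mul_comm]
  continuous' a := by
    refine UnivCStar.denseRange_mk (R := R) (h := h) |>.induction_on
      (p := fun a => Continuous fun z : Circle =>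
        UnivCStar.lift (fun i => (z : ℂ) ^ d i • UnivCStar.gen R h i) (hd z) a) a
      (isClosed_continuous_family _) fun x => ?_
    simp only [UnivCStar.lift_mk]
    have hz : ∀ n : ℤ, Continuous fun z : Circle => (z : ℂ) ^ n := fun n =>
      Continuous.zpow₀ (by fun_prop) n fun z => Or.inl (Circle.coe_ne_zero z)
    induction x using FreeStarAlgebra.induction with
    | hone => simp only [map_one]; exact continuous_const
    | hletter i b =>
      cases b
      · have h1 : ∀ z : Circle, FreeStarAlgebra.eval
            (fun i => (z : ℂ) ^ d i • UnivCStar.gen R h i) (FreeStarAlgebra.letter i false) =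
            (z : ℂ) ^ d i • UnivCStar.gen R h i := fun z => FreeStarAlgebra.eval_gen _ i
        simp only [h1]
        exact (hz _).smul continuous_const
      · simp only [FreeStarAlgebra.letter_true, map_star, FreeStarAlgebra.eval_gen]
        exact ((hz _).smul continuous_const).star
    | hadd x y hx hy => simp only [map_add]; exact hx.add hy
    | hmul x y hx hy => simp only [map_mul]; exact hx.mul hy
    | hsmul c x hx => simp only [map_smul]; exact hx.const_smul c

theorem gradedAction_gen (d : ι → ℤ)
    (hd : ∀ z : Circle, ∀ r ∈ R,
      FreeStarAlgebra.eval (fun i => (z : ℂ) ^ d i • UnivCStar.gen R h i) r = 0) (i : ι) :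
    (gradedAction d hd).IsHomogeneous (d i) (UnivCStar.gen R h i) := fun z =>
  UnivCStar.lift_gen _ (hd z) i

end Graded

section Torus

open FreeStarAlgebra

/-- The relations of the quantum torus: the generators `u = gen 0`, `v = gen 1` are unitary and
`u v = ζ v u`. -/
def torusRel (ζ : Circle) : Set (FreeStarAlgebra (Fin 2)) :=
  {star (gen 0) * gen 0 - 1, gen 0 * star (gen 0) - 1,
   star (gen 1) * gen 1 - 1, gen 1 * star (gen 1) - 1,
   gen 0 * gen 1 - (ζ : ℂ) • (gen 1 * gen 0)}

theorem forall_torusRel {ζ : Circle} {P : FreeStarAlgebra (Fin 2) → Prop} :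
    (∀ r ∈ torusRel ζ, P r) ↔
      P (star (gen 0) * gen 0 - 1) ∧ P (gen 0 * star (gen 0) - 1) ∧
      P (star (gen 1) * gen 1 - 1) ∧ P (gen 1 * star (gen 1) - 1) ∧
      P (gen 0 * gen 1 - (ζ : ℂ) • (gen 1 * gen 0)) := by
  simp [torusRel]

theorem admissible_torusRel (ζ : Circle) : Admissible (torusRel ζ) := by
  refine admissible_of_bound (fun _ => 1) fun B _ f hf i => ?_
  rw [forall_torusRel] at hf
  simp only [map_sub, map_mul, map_star, eval_gen, map_one, sub_eq_zero] at hf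
  refine norm_unitary_le (Unitary.mem_iff.mpr ?_)
  fin_cases i
  · exact ⟨hf.1, hf.2.1⟩
  · exact ⟨hf.2.2.1, hf.2.2.2.1⟩

/-- The C*-algebra `C(𝕋²_ζ)` of the quantum two-torus: the universal C*-algebra generated by two
unitaries `u`, `v` with `u v = ζ v u`. -/
abbrev QTorus (ζ : Circle) : Type := UnivCStar (torusRel ζ) (admissible_torusRel ζ)

namespace QTorus

variable (ζ : Circle)

theorem rel : ∀ r ∈ torusRel ζ, UnivCStar.mk (torusRel ζ) (admissible_torusRel ζ) r = 0 :=
  fun _ hr => UnivCStar.mk_eq_zero hr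

/-- The first unitary generator. -/
def u : unitary (QTorus ζ) :=
  ⟨UnivCStar.gen (torusRel ζ) (admissible_torusRel ζ) 0, by
    have h := forall_torusRel.mp (rel ζ)
    simp only [map_sub, map_mul, map_star, map_one, sub_eq_zero] at h
    exact Unitary.mem_iff.mpr ⟨h.1, h.2.1⟩⟩

/-- The second unitary generator. -/
def v : unitary (QTorus ζ) :=
  ⟨UnivCStar.gen (torusRel ζ) (admissible_torusRel ζ) 1, by
    have h := forall_torusRel.mp (rel ζ)
    simp only [map_sub, map_mul, map_star, map_one, sub_eq_zero] at h
    exact Unitary.mem_iff.mpr ⟨h.2.2.1, h.2.2.2.1⟩⟩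

theorem u_mul_v : (u ζ : QTorus ζ) * v ζ = (ζ : ℂ) • ((v ζ : QTorus ζ) * u ζ) := by
  have h := forall_torusRel.mp (rel ζ)
  simp only [map_sub, map_mul, map_smul, map_one, sub_eq_zero] at h
  exact h.2.2.2.2

theorem gauge_rel (z : Circle) : ∀ r ∈ torusRel ζ, FreeStarAlgebra.eval (fun i =>
    (z : ℂ) ^ (1 : ℤ) • UnivCStar.gen (torusRel ζ) (admissible_torusRel ζ) i) r = 0 := by
  have hz : star (z : ℂ) * z = 1 := star_mul_self_circle z
  have hz' : (z : ℂ) * star (z : ℂ) = 1 := by rw [mul_comm, hz]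
  have hu := Unitary.mem_iff.mp (u ζ).2
  have hv := Unitary.mem_iff.mp (v ζ).2
  rw [forall_torusRel]
  simp only [map_sub, map_mul, map_star, map_smul, eval_gen, map_one, sub_eq_zero, zpow_one,
    star_smul, smul_mul_smul_comm, hz, hz', one_smul]
  refine ⟨hu.1, hu.2, hv.1, hv.2, ?_⟩
  rw [smul_comm]
  exact congrArg _ (u_mul_v ζ)

/-- The action of `𝕋` on `C(𝕋²_ζ)` that multiplies both generators by `z`. -/
def gauge : CircleAction (QTorus ζ) := gradedAction (fun _ => 1) (gauge_rel ζ)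

theorem gauge_u (z : Circle) : gauge ζ z (u ζ) = (z : ℂ) • (u ζ : QTorus ζ) := by
  have h := gradedAction_gen (h := admissible_torusRel ζ) (fun _ => 1) (gauge_rel ζ) 0 z
  rwa [zpow_one] at h

theorem gauge_v (z : Circle) : gauge ζ z (v ζ) = (z : ℂ) • (v ζ : QTorus ζ) := by
  have h := gradedAction_gen (h := admissible_torusRel ζ) (fun _ => 1) (gauge_rel ζ) 1 z
  rwa [zpow_one] at h

end QTorus

end Torus

end BraidedSphere

end

noncomputable section

open scoped ComplexConjugate
open Filter Topology

namespace BraidedSphere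

universe u v

/-- The map induced by a *-homomorphism on unitary elements. -/
def mapUnitary {A : Type u} {B : Type v} [CStarAlgebra A] [CStarAlgebra B] (f : A →⋆ₐ[ℂ] B) :
    unitary A →* unitary B where
  toFun w := ⟨f w, Unitary.mem_iff.mpr (by
    have h := Unitary.mem_iff.mp w.2
    rw [← map_star, ← map_mul, ← map_mul, h.1, h.2, map_one]
    exact ⟨rfl, rfl⟩)⟩
  map_one' := Subtype.ext (map_one f)
  map_mul' _ _ := Subtype.ext (map_mul f _ _)

/-- The closed linear span `[S T]` of the products `s t`, `s ∈ S`, `t ∈ T`. -/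
def bracket {D : Type u} [CStarAlgebra D] (S T : Set D) : Submodule ℂ D :=
  (Submodule.span ℂ {x | ∃ s ∈ S, ∃ t ∈ T, x = s * t}).topologicalClosure

section Bracket

variable {D : Type u} [CStarAlgebra D]

theorem isClosed_bracket (S T : Set D) : IsClosed (bracket S T : Set D) :=
  Submodule.isClosed_topologicalClosure _

theorem mul_mem_bracket {S T : Set D} {s t : D} (hs : s ∈ S) (ht : t ∈ T) :
    s * t ∈ bracket S T :=
  Submodule.le_topologicalClosure _ (Submodule.subset_span ⟨s, hs, t, ht, rfl⟩)

theorem bracket_le {S T : Set D} {N : Submodule ℂ D} (hN : IsClosed (N : Set D))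
    (h : ∀ s ∈ S, ∀ t ∈ T, s * t ∈ N) : bracket S T ≤ N := by
  refine Submodule.topologicalClosure_minimal _ (Submodule.span_le.mpr ?_) hN
  rintro _ ⟨s, hs, t, ht, rfl⟩
  exact h s hs t ht

theorem isClosed_comap {D' : Type v} [CStarAlgebra D'] {N : Submodule ℂ D'}
    (hN : IsClosed (N : Set D')) (f : D →ₗ[ℂ] D') (hf : Continuous f) :
    IsClosed (N.comap f : Set D) :=
  hN.preimage hf

/-- `[f(A) g(B)]` as a *-subalgebra, if it contains the products in the opposite order. -/
def bracketStarSubalgebra {A : Type u} {B : Type u} [CStarAlgebra A] [CStarAlgebra B]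
    (f : A →⋆ₐ[ℂ] D) (g : B →⋆ₐ[ℂ] D)
    (h : ∀ a b, g b * f a ∈ bracket (Set.range f) (Set.range g)) : StarSubalgebra ℂ D where
  carrier := bracket (Set.range f) (Set.range g)
  zero_mem' := Submodule.zero_mem _
  add_mem' := Submodule.add_mem _
  one_mem' := by
    have := mul_mem_bracket (S := Set.range f) (T := Set.range g) ⟨1, rfl⟩ ⟨1, rfl⟩
    rwa [map_one, map_one, mul_one] at this
  algebraMap_mem' c := by
    have := mul_mem_bracket (S := Set.range f) (T := Set.range g) ⟨1, rfl⟩ ⟨1, rfl⟩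
    rw [map_one, map_one, mul_one] at this
    rw [Algebra.algebraMap_eq_smul_one]
    exact Submodule.smul_mem _ c this
  mul_mem' := by
    intro x y hx hy
    set K := bracket (Set.range f) (Set.range g) with hK
    have hcl : IsClosed (K : Set D) := isClosed_bracket _ _
    have hl : ∀ a, ∀ x ∈ K, f a * x ∈ K := by
      intro a
      have : K ≤ K.comap (LinearMap.mulLeft ℂ (f a)) := by
        refine bracket_le (isClosed_comap hcl _ (continuous_const_mul (f a))) ?_
        rintro _ ⟨a', rfl⟩ _ ⟨b, rfl⟩
        change f a * (f a' * g b) ∈ K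
        rw [← mul_assoc, ← map_mul]
        exact mul_mem_bracket ⟨_, rfl⟩ ⟨_, rfl⟩
      exact this
    have hr : ∀ b, ∀ x ∈ K, x * g b ∈ K := by
      intro b
      have : K ≤ K.comap (LinearMap.mulRight ℂ (g b)) := by
        refine bracket_le (isClosed_comap hcl _ (continuous_mul_const (g b))) ?_
        rintro _ ⟨a', rfl⟩ _ ⟨b', rfl⟩
        change f a' * g b' * g b ∈ K
        rw [mul_assoc, ← map_mul]
        exact mul_mem_bracket ⟨_, rfl⟩ ⟨_, rfl⟩
      exact this
    have h1 : K ≤ K.comap (LinearMap.mulRight ℂ y) := by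
      refine bracket_le (isClosed_comap hcl _ (continuous_mul_const y)) ?_
      rintro _ ⟨a, rfl⟩ _ ⟨b, rfl⟩
      change f a * g b * y ∈ K
      have h2 : K ≤ K.comap (LinearMap.mulLeft ℂ (f a * g b)) := by
        refine bracket_le (isClosed_comap hcl _ (continuous_const_mul _)) ?_
        rintro _ ⟨a', rfl⟩ _ ⟨b', rfl⟩
        change f a * g b * (f a' * g b') ∈ K
        have h3 := hr b' _ (hl a _ (h a' b))
        simpa only [mul_assoc] using h3
      exact h2 hy
    exact h1 hx
  star_mem' := by
    intro x hx
    set K := bracket (Set.range f) (Set.range g) with hK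
    have hcl : IsClosed (K : Set D) := isClosed_bracket _ _
    let N : Submodule ℂ D :=
      { carrier := {x | star x ∈ K}
        zero_mem' := by simp
        add_mem' := fun {x y} hx hy => by
          change star (x + y) ∈ K
          rw [star_add]; exact K.add_mem hx hy
        smul_mem' := fun c x hx => by
          change star (c • x) ∈ K
          rw [star_smul]; exact K.smul_mem _ hx }
    have h1 : K ≤ N := by
      refine bracket_le (hcl.preimage continuous_star) ?_
      rintro _ ⟨a, rfl⟩ _ ⟨b, rfl⟩
      change star (f a * g b) ∈ K
      rw [star_mul, ← map_star, ← map_star]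
      exact h _ _
    exact h1 hx

end Bracket

/-- The C*-algebra `C(𝕋²_ζ) ⊗ A ⊗ B`. -/
abbrev Ambient (ζ : Circle) (A B : Type) [CStarAlgebra A] [CStarAlgebra B] : Type :=
  MinTensor (MinTensor (QTorus ζ) A) B

section Ambient

variable (ζ : Circle) (A B : Type) [CStarAlgebra A] [CStarAlgebra B]

/-- `t ↦ t ⊗ 1 ⊗ 1`. -/
def ambT : QTorus ζ →⋆ₐ[ℂ] Ambient ζ A B := (MinTensor.inl _ _).comp (MinTensor.inl _ _)

/-- `a ↦ 1 ⊗ a ⊗ 1`. -/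
def ambA : A →⋆ₐ[ℂ] Ambient ζ A B := (MinTensor.inl _ _).comp (MinTensor.inr _ _)

/-- `b ↦ 1 ⊗ 1 ⊗ b`. -/
def ambB : B →⋆ₐ[ℂ] Ambient ζ A B := MinTensor.inr _ _

/-- The unitary `u ⊗ 1 ⊗ 1`. -/
def ambU : unitary (Ambient ζ A B) := mapUnitary (ambT ζ A B) (QTorus.u ζ)

/-- The unitary `v ⊗ 1 ⊗ 1`. -/
def ambV : unitary (Ambient ζ A B) := mapUnitary (ambT ζ A B) (QTorus.v ζ)

variable {ζ A B}

theorem commute_ambT_ambA (t : QTorus ζ) (a : A) : Commute (ambT ζ A B t) (ambA ζ A B a) := by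
  change _ * _ = _ * _
  rw [ambT, ambA, StarAlgHom.comp_apply, StarAlgHom.comp_apply, ← map_mul, ← map_mul,
    (MinTensor.commute_inl_inr t a).eq]

theorem commute_ambT_ambB (t : QTorus ζ) (b : B) : Commute (ambT ζ A B t) (ambB ζ A B b) :=
  MinTensor.commute_inl_inr (MinTensor.inl _ _ t) b

theorem commute_ambA_ambB (a : A) (b : B) : Commute (ambA ζ A B a) (ambB ζ A B b) :=
  MinTensor.commute_inl_inr (MinTensor.inr _ _ a) b

/-- `j₁ : A → C(𝕋²_ζ) ⊗ A ⊗ B`, with `j₁(a) = uⁿ ⊗ a ⊗ 1` if `a` is homogeneous of degree `n`. -/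
def amb₁ (ζ : Circle) (ρ : CircleAction A) (B : Type) [CStarAlgebra B] :
    A →⋆ₐ[ℂ] Ambient ζ A B :=
  twist ρ (ambA ζ A B) (ambU ζ A B) (commute_ambT_ambA _)

/-- `j₂ : B → C(𝕋²_ζ) ⊗ A ⊗ B`, with `j₂(b) = vᵐ ⊗ 1 ⊗ b` if `b` is homogeneous of degree `m`. -/
def amb₂ (ζ : Circle) (A : Type) [CStarAlgebra A] (τ : CircleAction B) :
    B →⋆ₐ[ℂ] Ambient ζ A B :=
  twist τ (ambB ζ A B) (ambV ζ A B) (commute_ambT_ambB _)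

theorem amb₁_apply {ρ : CircleAction A} {n : ℤ} {a : A} (ha : ρ.IsHomogeneous n a) :
    amb₁ ζ ρ B a = ((ambU ζ A B ^ n : unitary _) : Ambient ζ A B) * ambA ζ A B a :=
  twist_apply ha

theorem amb₂_apply {τ : CircleAction B} {n : ℤ} {b : B} (hb : τ.IsHomogeneous n b) :
    amb₂ ζ A τ b = ((ambV ζ A B ^ n : unitary _) : Ambient ζ A B) * ambB ζ A B b :=
  twist_apply hb

theorem coe_ambU_zpow (n : ℤ) : ((ambU ζ A B ^ n : unitary _) : Ambient ζ A B) =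
    ambT ζ A B ((QTorus.u ζ ^ n : unitary _) : QTorus ζ) := by
  rw [ambU, ← map_zpow]; rfl

theorem coe_ambV_zpow (n : ℤ) : ((ambV ζ A B ^ n : unitary _) : Ambient ζ A B) =
    ambT ζ A B ((QTorus.v ζ ^ n : unitary _) : QTorus ζ) := by
  rw [ambV, ← map_zpow]; rfl

/-- The scalar `z` as a unitary element. -/
def scalarUnitary (D : Type u) [CStarAlgebra D] : Circle →* unitary D where
  toFun z := ⟨(z : ℂ) • 1, Unitary.mem_iff.mpr (by
    have h := star_mul_self_circle z
    have h' : (z : ℂ) * star (z : ℂ) = 1 := by rw [mul_comm, h]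
    rw [star_smul, smul_mul_smul_comm, smul_mul_smul_comm, h, h']
    simp)⟩
  map_one' := Subtype.ext (by simp)
  map_mul' z w := Subtype.ext (by
    change ((z * w : Circle) : ℂ) • (1 : D) = ((z : ℂ) • (1 : D)) * ((w : ℂ) • (1 : D))
    rw [smul_mul_smul_comm, mul_one, Circle.coe_mul])

theorem commute_scalarUnitary {D : Type u} [CStarAlgebra D] (z : Circle) (w : unitary D) :
    Commute (scalarUnitary D z) w :=
  Subtype.ext (by
    change ((z : ℂ) • (1 : D)) * (w : D) = (w : D) * ((z : ℂ) • (1 : D))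
    simp)

theorem QTorus.v_zpow_mul_u_zpow (ζ : Circle) (m n : ℤ) :
    ((QTorus.v ζ ^ m : unitary _) : QTorus ζ) * ((QTorus.u ζ ^ n : unitary _) : QTorus ζ) =
      (ζ : ℂ) ^ (-(m * n)) •
        (((QTorus.u ζ ^ n : unitary _) : QTorus ζ) * ((QTorus.v ζ ^ m : unitary _) : QTorus ζ)) := by
  set c : Circle →* unitary (QTorus ζ) := scalarUnitary (QTorus ζ) with hc
  have h0 : SemiconjBy (QTorus.u ζ) (QTorus.v ζ) (c ζ * QTorus.v ζ) := Subtype.ext (by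
    change (QTorus.u ζ : QTorus ζ) * QTorus.v ζ = ((ζ : ℂ) • 1) * QTorus.v ζ * QTorus.u ζ
    rw [QTorus.u_mul_v, smul_mul_assoc, smul_mul_assoc, one_mul])
  have h1 := h0.zpow_right m
  rw [(commute_scalarUnitary ζ _).mul_zpow] at h1
  have h2 : SemiconjBy (QTorus.v ζ ^ m) (QTorus.u ζ) (c ζ ^ (-m) * QTorus.u ζ) := by
    have h3 : QTorus.u ζ * QTorus.v ζ ^ m = c ζ ^ m * QTorus.v ζ ^ m * QTorus.u ζ := h1.eq
    change QTorus.v ζ ^ m * QTorus.u ζ = c ζ ^ (-m) * QTorus.u ζ * QTorus.v ζ ^ m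
    rw [mul_assoc (c ζ ^ (-m)), h3, zpow_neg]
    group
  have h4 := h2.zpow_right n
  rw [((commute_scalarUnitary ζ (QTorus.u ζ)).zpow_left (-m)).mul_zpow] at h4
  have h5 := congrArg (Subtype.val) h4.eq
  have h6 : (((c ζ ^ (-m)) ^ n : unitary (QTorus ζ)) : QTorus ζ) = (ζ : ℂ) ^ (-(m * n)) • 1 := by
    rw [← zpow_mul, ← map_zpow, neg_mul]
    change ((ζ ^ (-(m * n)) : Circle) : ℂ) • (1 : QTorus ζ) = _
    rw [Circle.coe_zpow]
  change ((QTorus.v ζ ^ m : unitary _) : QTorus ζ) * ((QTorus.u ζ ^ n : unitary _) : QTorus ζ) =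
    (((c ζ ^ (-m)) ^ n : unitary (QTorus ζ)) : QTorus ζ) * ((QTorus.u ζ ^ n : unitary _) : QTorus ζ)
      * ((QTorus.v ζ ^ m : unitary _) : QTorus ζ) at h5
  rw [h5, h6, smul_mul_assoc, smul_mul_assoc, one_mul]

/-- The braid relation. -/
theorem amb₂_mul_amb₁ {ρ : CircleAction A} {τ : CircleAction B} {m n : ℤ} {a : A} {b : B}
    (ha : ρ.IsHomogeneous n a) (hb : τ.IsHomogeneous m b) :
    amb₂ ζ A τ b * amb₁ ζ ρ B a =
      (ζ : ℂ) ^ (-(m * n)) • (amb₁ ζ ρ B a * amb₂ ζ A τ b) := by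
  rw [amb₁_apply ha, amb₂_apply hb, coe_ambU_zpow, coe_ambV_zpow]
  set x := ((QTorus.u ζ ^ n : unitary _) : QTorus ζ) with hx
  set y := ((QTorus.v ζ ^ m : unitary _) : QTorus ζ) with hy
  calc ambT ζ A B y * ambB ζ A B b * (ambT ζ A B x * ambA ζ A B a)
      = ambT ζ A B y * (ambB ζ A B b * ambT ζ A B x) * ambA ζ A B a := by simp only [mul_assoc]
    _ = ambT ζ A B (y * x) * (ambB ζ A B b * ambA ζ A B a) := by
        rw [← (commute_ambT_ambB x b).eq, map_mul]; simp only [mul_assoc]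
    _ = (ζ : ℂ) ^ (-(m * n)) • (ambT ζ A B x * (ambT ζ A B y * ambA ζ A B a) * ambB ζ A B b) := by
        rw [hx, hy, QTorus.v_zpow_mul_u_zpow, map_smul, map_mul, ← (commute_ambA_ambB a b).eq,
          smul_mul_assoc]
        simp only [mul_assoc]
    _ = _ := by
        rw [(commute_ambT_ambA y a).eq]; simp only [mul_assoc]

theorem amb₂_mul_amb₁_mem (ρ : CircleAction A) (τ : CircleAction B) (a : A) (b : B) :
    amb₂ ζ A τ b * amb₁ ζ ρ B a ∈ bracket (Set.range (amb₁ ζ ρ B)) (Set.range (amb₂ ζ A τ)) := by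
  set K := bracket (Set.range (amb₁ ζ ρ B)) (Set.range (amb₂ ζ A τ)) with hK
  have hcl : IsClosed (K : Set (Ambient ζ A B)) := isClosed_bracket _ _
  refine ρ.induction_homogeneous (P := fun a => amb₂ ζ A τ b * amb₁ ζ ρ B a ∈ K)
    (hcl.preimage (continuous_const.mul (continuous_hom _)))
    (by rw [map_zero, mul_zero]; exact K.zero_mem)
    (fun x y hx hy => by rw [map_add, mul_add]; exact K.add_mem hx hy)
    (fun c x hx => by rw [map_smul, mul_smul_comm]; exact K.smul_mem c hx) (fun n a ha => ?_) a
  refine τ.induction_homogeneous (P := fun b => amb₂ ζ A τ b * amb₁ ζ ρ B a ∈ K)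
    (hcl.preimage ((continuous_hom _).mul continuous_const))
    (by rw [map_zero, zero_mul]; exact K.zero_mem)
    (fun x y hx hy => by rw [map_add, add_mul]; exact K.add_mem hx hy)
    (fun c x hx => by rw [map_smul, smul_mul_assoc]; exact K.smul_mem c hx) (fun m b hb => ?_) b
  rw [amb₂_mul_amb₁ ha hb]
  exact K.smul_mem _ (mul_mem_bracket ⟨a, rfl⟩ ⟨b, rfl⟩)

end Ambient

end BraidedSphere

end

noncomputable section

open scoped ComplexConjugate
open Filter Topology

namespace BraidedSphere

section Braided

variable {A B : Type} [CStarAlgebra A] [CStarAlgebra B]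

/-- The braided tensor product `[j₁(A) j₂(B)]` as a *-subalgebra of `C(𝕋²_ζ) ⊗ A ⊗ B`. -/
def braidedSub (ζ : Circle) (ρ : CircleAction A) (τ : CircleAction B) :
    StarSubalgebra ℂ (Ambient ζ A B) :=
  bracketStarSubalgebra (amb₁ ζ ρ B) (amb₂ ζ A τ) (amb₂_mul_amb₁_mem ρ τ)

theorem coe_braidedSub (ζ : Circle) (ρ : CircleAction A) (τ : CircleAction B) :
    (braidedSub ζ ρ τ : Set (Ambient ζ A B)) =
      bracket (Set.range (amb₁ ζ ρ B)) (Set.range (amb₂ ζ A τ)) := rfl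

theorem isClosed_braidedSub (ζ : Circle) (ρ : CircleAction A) (τ : CircleAction B) :
    IsClosed (braidedSub ζ ρ τ : Set (Ambient ζ A B)) := isClosed_bracket _ _

/-- The braided tensor product `A ⊠_ζ B` of the `𝕋`-C*-algebras `(A, ρ)` and `(B, τ)`. -/
def Braided (ζ : Circle) (ρ : CircleAction A) (τ : CircleAction B) : Type := braidedSub ζ ρ τ

namespace Braided

instance (ζ : Circle) (ρ : CircleAction A) (τ : CircleAction B) :
    CStarAlgebra (Braided ζ ρ τ) :=
  StarSubalgebra.cstarAlgebra (braidedSub ζ ρ τ) (h_closed := isClosed_braidedSub ζ ρ τ)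

/-- The inclusion into `C(𝕋²_ζ) ⊗ A ⊗ B`. -/
def incl (ζ : Circle) (ρ : CircleAction A) (τ : CircleAction B) :
    Braided ζ ρ τ →⋆ₐ[ℂ] Ambient ζ A B := (braidedSub ζ ρ τ).subtype

theorem incl_injective (ζ : Circle) (ρ : CircleAction A) (τ : CircleAction B) :
    Function.Injective (incl ζ ρ τ) := Subtype.val_injective

theorem incl_mem (ζ : Circle) (ρ : CircleAction A) (τ : CircleAction B) (x : Braided ζ ρ τ) :
    incl ζ ρ τ x ∈ braidedSub ζ ρ τ := x.2

/-- Restriction of the codomain to the braided tensor product. -/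
def codRestrict {D : Type} [CStarAlgebra D] {ζ : Circle} {ρ : CircleAction A} {τ : CircleAction B}
    (f : D →⋆ₐ[ℂ] Ambient ζ A B) (hf : ∀ x, f x ∈ braidedSub ζ ρ τ) : D →⋆ₐ[ℂ] Braided ζ ρ τ :=
  f.codRestrict (braidedSub ζ ρ τ) hf

theorem incl_codRestrict {D : Type} [CStarAlgebra D] {ζ : Circle} {ρ : CircleAction A}
    {τ : CircleAction B} (f : D →⋆ₐ[ℂ] Ambient ζ A B) (hf : ∀ x, f x ∈ braidedSub ζ ρ τ) (x : D) :
    incl ζ ρ τ (codRestrict f hf x) = f x := rfl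

/-- The canonical map `j₁ : A → A ⊠_ζ B`. -/
def j₁ (ζ : Circle) (ρ : CircleAction A) (τ : CircleAction B) : A →⋆ₐ[ℂ] Braided ζ ρ τ :=
  codRestrict (amb₁ ζ ρ B) fun a => by
    have := mul_mem_bracket (S := Set.range (amb₁ ζ ρ B)) (T := Set.range (amb₂ ζ A τ))
      ⟨a, rfl⟩ ⟨1, rfl⟩
    rwa [map_one, mul_one] at this

/-- The canonical map `j₂ : B → A ⊠_ζ B`. -/
def j₂ (ζ : Circle) (ρ : CircleAction A) (τ : CircleAction B) : B →⋆ₐ[ℂ] Braided ζ ρ τ :=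
  codRestrict (amb₂ ζ A τ) fun b => by
    have := mul_mem_bracket (S := Set.range (amb₁ ζ ρ B)) (T := Set.range (amb₂ ζ A τ))
      ⟨1, rfl⟩ ⟨b, rfl⟩
    rwa [map_one, one_mul] at this

variable {ζ : Circle} {ρ : CircleAction A} {τ : CircleAction B}

@[simp] theorem incl_j₁ (a : A) : incl ζ ρ τ (j₁ ζ ρ τ a) = amb₁ ζ ρ B a := rfl

@[simp] theorem incl_j₂ (b : B) : incl ζ ρ τ (j₂ ζ ρ τ b) = amb₂ ζ A τ b := rfl

theorem j₂_mul_j₁ {m n : ℤ} {a : A} {b : B} (ha : ρ.IsHomogeneous n a)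
    (hb : τ.IsHomogeneous m b) :
    j₂ ζ ρ τ b * j₁ ζ ρ τ a = (ζ : ℂ) ^ (-(m * n)) • (j₁ ζ ρ τ a * j₂ ζ ρ τ b) := by
  apply incl_injective
  rw [map_mul, map_smul, map_mul]
  exact amb₂_mul_amb₁ ha hb

theorem bracket_j₁_j₂ : bracket (Set.range (j₁ ζ ρ τ)) (Set.range (j₂ ζ ρ τ)) = ⊤ := by
  rw [eq_top_iff]
  rintro x -
  have hx : incl ζ ρ τ x ∈ bracket (Set.range (amb₁ ζ ρ B)) (Set.range (amb₂ ζ A τ)) := x.2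
  set S := Submodule.span ℂ {x | ∃ s ∈ Set.range (j₁ ζ ρ τ), ∃ t ∈ Set.range (j₂ ζ ρ τ), x = s * t}
    with hS
  have h1 : Submodule.span ℂ {x | ∃ s ∈ Set.range (amb₁ ζ ρ B), ∃ t ∈ Set.range (amb₂ ζ A τ),
      x = s * t} ≤ S.map (incl ζ ρ τ).toAlgHom.toLinearMap := by
    refine Submodule.span_le.mpr ?_
    rintro _ ⟨_, ⟨a, rfl⟩, _, ⟨b, rfl⟩, rfl⟩
    refine ⟨j₁ ζ ρ τ a * j₂ ζ ρ τ b, Submodule.subset_span ⟨_, ⟨a, rfl⟩, _, ⟨b, rfl⟩, rfl⟩, ?_⟩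
    exact map_mul (incl ζ ρ τ) _ _
  change x ∈ closure (S : Set (Braided ζ ρ τ))
  rw [Metric.mem_closure_iff]
  intro ε hε
  obtain ⟨y, hy, hxy⟩ := Metric.mem_closure_iff.mp hx ε hε
  obtain ⟨y', hy', rfl⟩ := h1 hy
  exact ⟨y', hy', hxy⟩

theorem hom_ext {D : Type} [CStarAlgebra D] {f g : Braided ζ ρ τ →⋆ₐ[ℂ] D}
    (h₁ : ∀ a, f (j₁ ζ ρ τ a) = g (j₁ ζ ρ τ a)) (h₂ : ∀ b, f (j₂ ζ ρ τ b) = g (j₂ ζ ρ τ b)) :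
    f = g := by
  refine StarAlgHom.ext fun x => ?_
  let N : Submodule ℂ (Braided ζ ρ τ) := LinearMap.eqLocus f.toAlgHom.toLinearMap
    g.toAlgHom.toLinearMap
  have hN : bracket (Set.range (j₁ ζ ρ τ)) (Set.range (j₂ ζ ρ τ)) ≤ N := by
    refine bracket_le (isClosed_eq (continuous_hom f) (continuous_hom g)) ?_
    rintro _ ⟨a, rfl⟩ _ ⟨b, rfl⟩
    change f _ = g _
    rw [map_mul, map_mul, h₁, h₂]
  rw [bracket_j₁_j₂] at hN
  exact hN (Submodule.mem_top (x := x))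

/-- A *-homomorphism between the ambient algebras that maps `j₁(a)` to `j₁(φ a)` and `j₂(b)` to
`j₂(ψ b)` restricts to the braided tensor products. -/
def restrict {A' B' : Type} [CStarAlgebra A'] [CStarAlgebra B'] {ρ' : CircleAction A'}
    {τ' : CircleAction B'} (F : Ambient ζ A B →⋆ₐ[ℂ] Ambient ζ A' B') (φ : A →⋆ₐ[ℂ] A')
    (ψ : B →⋆ₐ[ℂ] B') (h₁ : ∀ a, F (amb₁ ζ ρ B a) = amb₁ ζ ρ' B' (φ a))
    (h₂ : ∀ b, F (amb₂ ζ A τ b) = amb₂ ζ A' τ' (ψ b)) : Braided ζ ρ τ →⋆ₐ[ℂ] Braided ζ ρ' τ' :=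
  codRestrict (F.comp (incl ζ ρ τ)) fun x => by
    have h : bracket (Set.range (amb₁ ζ ρ B)) (Set.range (amb₂ ζ A τ)) ≤
        (bracket (Set.range (amb₁ ζ ρ' B')) (Set.range (amb₂ ζ A' τ'))).comap
          F.toAlgHom.toLinearMap := by
      refine bracket_le (isClosed_comap (isClosed_bracket _ _) _ (continuous_hom F)) ?_
      rintro _ ⟨a, rfl⟩ _ ⟨b, rfl⟩
      change F (amb₁ ζ ρ B a * amb₂ ζ A τ b) ∈
        bracket (Set.range (amb₁ ζ ρ' B')) (Set.range (amb₂ ζ A' τ'))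
      rw [map_mul, h₁, h₂]
      exact mul_mem_bracket ⟨_, rfl⟩ ⟨_, rfl⟩
    exact h x.2

theorem incl_restrict {A' B' : Type} [CStarAlgebra A'] [CStarAlgebra B'] {ρ' : CircleAction A'}
    {τ' : CircleAction B'} (F : Ambient ζ A B →⋆ₐ[ℂ] Ambient ζ A' B') (φ : A →⋆ₐ[ℂ] A')
    (ψ : B →⋆ₐ[ℂ] B') (h₁ : ∀ a, F (amb₁ ζ ρ B a) = amb₁ ζ ρ' B' (φ a))
    (h₂ : ∀ b, F (amb₂ ζ A τ b) = amb₂ ζ A' τ' (ψ b)) (x : Braided ζ ρ τ) :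
    incl ζ ρ' τ' (restrict F φ ψ h₁ h₂ x) = F (incl ζ ρ τ x) := rfl

/-- The map `γ_z ⊗ id ⊗ id`, where `γ_z` multiplies both generators of `C(𝕋²_ζ)` by `z`. -/
def ambGauge (ζ : Circle) (A B : Type) [CStarAlgebra A] [CStarAlgebra B] (z : Circle) :
    Ambient ζ A B →⋆ₐ[ℂ] Ambient ζ A B :=
  MinTensor.map (MinTensor.map (QTorus.gauge ζ z) (StarAlgHom.id ℂ A)) (StarAlgHom.id ℂ B)

theorem ambGauge_ambT (z : Circle) (t : QTorus ζ) :
    ambGauge ζ A B z (ambT ζ A B t) = ambT ζ A B (QTorus.gauge ζ z t) := by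
  rw [ambGauge, ambT, StarAlgHom.comp_apply, MinTensor.map_inl, MinTensor.map_inl,
    StarAlgHom.comp_apply]

theorem ambGauge_ambA (z : Circle) (a : A) : ambGauge ζ A B z (ambA ζ A B a) = ambA ζ A B a := by
  rw [ambGauge, ambA, StarAlgHom.comp_apply, MinTensor.map_inl, MinTensor.map_inr]
  rfl

theorem ambGauge_ambB (z : Circle) (b : B) : ambGauge ζ A B z (ambB ζ A B b) = ambB ζ A B b := by
  rw [ambGauge, ambB, MinTensor.map_inr]
  rfl

theorem gauge_unitary_zpow {w : unitary (QTorus ζ)} {z : Circle}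
    (hw : QTorus.gauge ζ z (w : QTorus ζ) = (z : ℂ) • (w : QTorus ζ)) (n : ℤ) :
    QTorus.gauge ζ z ((w ^ n : unitary _) : QTorus ζ) =
      (z : ℂ) ^ n • ((w ^ n : unitary _) : QTorus ζ) := by
  have h1 : mapUnitary (QTorus.gauge ζ z) w = scalarUnitary (QTorus ζ) z * w := Subtype.ext (by
    change QTorus.gauge ζ z (w : QTorus ζ) = ((z : ℂ) • 1) * (w : QTorus ζ)
    rw [hw, smul_mul_assoc, one_mul])
  have h2 : mapUnitary (QTorus.gauge ζ z) w ^ n = (scalarUnitary (QTorus ζ) z * w) ^ n := by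
    rw [h1]
  rw [← map_zpow, (commute_scalarUnitary z w).mul_zpow, ← map_zpow] at h2
  have h3 := congrArg Subtype.val h2
  change QTorus.gauge ζ z ((w ^ n : unitary _) : QTorus ζ) =
    (((z ^ n : Circle) : ℂ) • 1) * ((w ^ n : unitary _) : QTorus ζ) at h3
  rw [h3, smul_mul_assoc, one_mul, Circle.coe_zpow]

theorem ambGauge_amb₁ (z : Circle) (a : A) :
    ambGauge ζ A B z (amb₁ ζ ρ B a) = amb₁ ζ ρ B (ρ z a) := by
  refine DFunLike.congr_fun (f := (ambGauge ζ A B z).comp (amb₁ ζ ρ B))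
    (g := (amb₁ ζ ρ B).comp (ρ z)) (ρ.hom_ext fun n a ha => ?_) a
  rw [StarAlgHom.comp_apply, StarAlgHom.comp_apply, ha, map_smul, amb₁_apply ha, map_mul,
    ambGauge_ambA, coe_ambU_zpow, ambGauge_ambT, gauge_unitary_zpow (QTorus.gauge_u ζ z), map_smul,
    smul_mul_assoc]

theorem ambGauge_amb₂ (z : Circle) (b : B) :
    ambGauge ζ A B z (amb₂ ζ A τ b) = amb₂ ζ A τ (τ z b) := by
  refine DFunLike.congr_fun (f := (ambGauge ζ A B z).comp (amb₂ ζ A τ))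
    (g := (amb₂ ζ A τ).comp (τ z)) (τ.hom_ext fun n b hb => ?_) b
  rw [StarAlgHom.comp_apply, StarAlgHom.comp_apply, hb, map_smul, amb₂_apply hb, map_mul,
    ambGauge_ambB, coe_ambV_zpow, ambGauge_ambT, gauge_unitary_zpow (QTorus.gauge_v ζ z), map_smul,
    smul_mul_assoc]

variable (ζ ρ τ) in
/-- The automorphism of `A ⊠_ζ B` with `j₁(a) ↦ j₁(ρ_z(a))` and `j₂(b) ↦ j₂(τ_z(b))`. -/
def actionHom (z : Circle) : Braided ζ ρ τ →⋆ₐ[ℂ] Braided ζ ρ τ :=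
  restrict (ambGauge ζ A B z) (ρ z) (τ z) (ambGauge_amb₁ z) (ambGauge_amb₂ z)

theorem actionHom_j₁ (z : Circle) (a : A) :
    actionHom ζ ρ τ z (j₁ ζ ρ τ a) = j₁ ζ ρ τ (ρ z a) :=
  incl_injective ζ ρ τ (ambGauge_amb₁ z a)

theorem actionHom_j₂ (z : Circle) (b : B) :
    actionHom ζ ρ τ z (j₂ ζ ρ τ b) = j₂ ζ ρ τ (τ z b) :=
  incl_injective ζ ρ τ (ambGauge_amb₂ z b)

variable (ζ ρ τ) in
/-- The action of `𝕋` on `A ⊠_ζ B` for which `j₁` and `j₂` are equivariant. -/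
def action : CircleAction (Braided ζ ρ τ) where
  toFun := actionHom ζ ρ τ
  map_one' x := by
    refine DFunLike.congr_fun (f := actionHom ζ ρ τ 1) (g := StarAlgHom.id ℂ (Braided ζ ρ τ))
      (hom_ext (fun a => ?_) fun b => ?_) x
    · rw [actionHom_j₁, ρ.map_one']; rfl
    · rw [actionHom_j₂, τ.map_one']; rfl
  map_mul' z w x := by
    refine DFunLike.congr_fun (f := actionHom ζ ρ τ (z * w))
      (g := (actionHom ζ ρ τ z).comp (actionHom ζ ρ τ w)) (hom_ext (fun a => ?_) fun b => ?_) x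
    · rw [StarAlgHom.comp_apply, actionHom_j₁, actionHom_j₁, actionHom_j₁, ρ.map_mul']
    · rw [StarAlgHom.comp_apply, actionHom_j₂, actionHom_j₂, actionHom_j₂, τ.map_mul']
  continuous' x := by
    let N : Submodule ℂ (Braided ζ ρ τ) :=
      { carrier := {x | Continuous fun z => actionHom ζ ρ τ z x}
        zero_mem' := by
          change Continuous fun z => actionHom ζ ρ τ z 0
          simp only [map_zero]
          exact continuous_const
        add_mem' := fun {x y} hx hy => by
          change Continuous fun z => actionHom ζ ρ τ z (x + y)
          simp only [map_add]
          exact Continuous.add hx hy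
        smul_mem' := fun c x hx => by
          change Continuous fun z => actionHom ζ ρ τ z (c • x)
          simp only [map_smul]
          exact Continuous.const_smul hx c }
    have hN : bracket (Set.range (j₁ ζ ρ τ)) (Set.range (j₂ ζ ρ τ)) ≤ N := by
      refine bracket_le (isClosed_continuous_family (actionHom ζ ρ τ)) ?_
      rintro _ ⟨a, rfl⟩ _ ⟨b, rfl⟩
      change Continuous fun z => actionHom ζ ρ τ z (j₁ ζ ρ τ a * j₂ ζ ρ τ b)
      simp only [map_mul, actionHom_j₁, actionHom_j₂]
      exact ((continuous_hom _).comp (ρ.continuous' a)).mul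
        ((continuous_hom _).comp (τ.continuous' b))
    rw [bracket_j₁_j₂] at hN
    exact hN (Submodule.mem_top (x := x))

section Map

variable {A' B' : Type} [CStarAlgebra A'] [CStarAlgebra B'] {ρ' : CircleAction A'}
  {τ' : CircleAction B'} {Φ : A →⋆ₐ[ℂ] A'} {Ψ : B →⋆ₐ[ℂ] B'}

/-- The map `id ⊗ Φ ⊗ Ψ`. -/
def ambMap (ζ : Circle) (Φ : A →⋆ₐ[ℂ] A') (Ψ : B →⋆ₐ[ℂ] B') :
    Ambient ζ A B →⋆ₐ[ℂ] Ambient ζ A' B' :=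
  MinTensor.map (MinTensor.map (StarAlgHom.id ℂ (QTorus ζ)) Φ) Ψ

theorem ambMap_ambT (t : QTorus ζ) : ambMap ζ Φ Ψ (ambT ζ A B t) = ambT ζ A' B' t := by
  rw [ambMap, ambT, StarAlgHom.comp_apply, MinTensor.map_inl, MinTensor.map_inl]
  rfl

theorem ambMap_ambA (a : A) : ambMap ζ Φ Ψ (ambA ζ A B a) = ambA ζ A' B' (Φ a) := by
  rw [ambMap, ambA, StarAlgHom.comp_apply, MinTensor.map_inl, MinTensor.map_inr]
  rfl

theorem ambMap_ambB (b : B) : ambMap ζ Φ Ψ (ambB ζ A B b) = ambB ζ A' B' (Ψ b) := by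
  rw [ambMap, ambB, MinTensor.map_inr]
  rfl

theorem ambMap_amb₁ (hΦ : CircleAction.Equivariant ρ ρ' Φ) (a : A) :
    ambMap ζ Φ Ψ (amb₁ ζ ρ B a) = amb₁ ζ ρ' B' (Φ a) := by
  refine DFunLike.congr_fun (f := (ambMap ζ Φ Ψ).comp (amb₁ ζ ρ B))
    (g := (amb₁ ζ ρ' B').comp Φ) (ρ.hom_ext fun n a ha => ?_) a
  rw [StarAlgHom.comp_apply, StarAlgHom.comp_apply, amb₁_apply ha, amb₁_apply (ha.map hΦ), map_mul,
    ambMap_ambA, coe_ambU_zpow, ambMap_ambT, coe_ambU_zpow]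

theorem ambMap_amb₂ (hΨ : CircleAction.Equivariant τ τ' Ψ) (b : B) :
    ambMap ζ Φ Ψ (amb₂ ζ A τ b) = amb₂ ζ A' τ' (Ψ b) := by
  refine DFunLike.congr_fun (f := (ambMap ζ Φ Ψ).comp (amb₂ ζ A τ))
    (g := (amb₂ ζ A' τ').comp Ψ) (τ.hom_ext fun n b hb => ?_) b
  rw [StarAlgHom.comp_apply, StarAlgHom.comp_apply, amb₂_apply hb, amb₂_apply (hb.map hΨ), map_mul,
    ambMap_ambB, coe_ambV_zpow, ambMap_ambT, coe_ambV_zpow]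

/-- The *-homomorphism `Φ ⊠ Ψ` for equivariant `Φ` and `Ψ`:
`(Φ ⊠ Ψ)(j₁(a) j₂(b)) = j₁(Φ(a)) j₂(Ψ(b))`. -/
def map (ζ : Circle) (hΦ : CircleAction.Equivariant ρ ρ' Φ)
    (hΨ : CircleAction.Equivariant τ τ' Ψ) : Braided ζ ρ τ →⋆ₐ[ℂ] Braided ζ ρ' τ' :=
  restrict (ambMap ζ Φ Ψ) Φ Ψ (ambMap_amb₁ hΦ) (ambMap_amb₂ hΨ)

theorem map_j₁ (hΦ : CircleAction.Equivariant ρ ρ' Φ) (hΨ : CircleAction.Equivariant τ τ' Ψ)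
    (a : A) : map ζ hΦ hΨ (j₁ ζ ρ τ a) = j₁ ζ ρ' τ' (Φ a) :=
  incl_injective ζ ρ' τ' (ambMap_amb₁ hΦ a)

theorem map_j₂ (hΦ : CircleAction.Equivariant ρ ρ' Φ) (hΨ : CircleAction.Equivariant τ τ' Ψ)
    (b : B) : map ζ hΦ hΨ (j₂ ζ ρ τ b) = j₂ ζ ρ' τ' (Ψ b) :=
  incl_injective ζ ρ' τ' (ambMap_amb₂ hΨ b)

end Map

end Braided

theorem CircleAction.equivariant_id {A : Type} [CStarAlgebra A] (ρ : CircleAction A) :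
    CircleAction.Equivariant ρ ρ (StarAlgHom.id ℂ A) := fun _ _ => rfl

end Braided

end BraidedSphere

end

noncomputable section

open scoped ComplexConjugate

namespace BraidedSphere

universe u

theorem norm_sq_le_of_sum_eq {D : Type u} [CStarAlgebra D] {ι : Type} [Fintype ι] (x : ι → D)
    (r : ℝ) (h : ∑ i, star (x i) * x i = (r : ℂ) • 1) (i : ι) : ‖x i‖ ^ 2 ≤ |r| := by
  let _ : PartialOrder D := CStarAlgebra.spectralOrder D
  have _ : StarOrderedRing D := CStarAlgebra.spectralOrderedRing D
  have h1 : star (x i) * x i ≤ (r : ℂ) • 1 := by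
    rw [← h]
    exact Finset.single_le_sum (f := fun i => star (x i) * x i)
      (fun j _ => star_mul_self_nonneg (x j)) (Finset.mem_univ i)
  have h2 := CStarAlgebra.norm_le_norm_of_nonneg_of_le (star_mul_self_nonneg (x i)) h1
  rw [CStarRing.norm_star_mul_self, ← sq, norm_smul, Complex.norm_real, Real.norm_eq_abs] at h2
  exact h2.trans (mul_le_of_le_one_right (abs_nonneg r) (norm_unitary_le (one_mem (unitary D))))

/-- `ζ = q / q̄`. -/
def zeta (q : ℂ) (hq : q ≠ 0) : Circle :=
  ⟨q / conj q, by
    rw [Submonoid.unitSphere, Submonoid.mem_mk]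
    simp [hq]⟩

/-- `σ = √(1 + |q|²)`. -/
def sig (q : ℂ) : ℝ := √(1 + ‖q‖ ^ 2)

/-- `ς = |q|²`. -/
def vsig (q : ℂ) : ℝ := ‖q‖ ^ 2

theorem sig_sq (q : ℂ) : sig q ^ 2 = 1 + ‖q‖ ^ 2 := Real.sq_sqrt (by positivity)

section SU

open FreeStarAlgebra

/-- The relations of `C(SU_q(2))`, with `α = gen 0` and `γ = gen 1`. -/
def suRel (q : ℂ) : Set (FreeStarAlgebra (Fin 2)) :=
  {star (gen 0) * gen 0 + star (gen 1) * gen 1 - 1,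
   gen 0 * star (gen 0) + ((‖q‖ ^ 2 : ℝ) : ℂ) • (star (gen 1) * gen 1) - 1,
   gen 0 * gen 1 - conj q • (gen 1 * gen 0),
   gen 1 * star (gen 1) - star (gen 1) * gen 1}

theorem forall_suRel {q : ℂ} {P : FreeStarAlgebra (Fin 2) → Prop} :
    (∀ r ∈ suRel q, P r) ↔
      P (star (gen 0) * gen 0 + star (gen 1) * gen 1 - 1) ∧
      P (gen 0 * star (gen 0) + ((‖q‖ ^ 2 : ℝ) : ℂ) • (star (gen 1) * gen 1) - 1) ∧
      P (gen 0 * gen 1 - conj q • (gen 1 * gen 0)) ∧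
      P (gen 1 * star (gen 1) - star (gen 1) * gen 1) := by
  rw [suRel]
  simp only [Set.mem_insert_iff, Set.mem_singleton_iff, forall_eq_or_imp, forall_eq]

theorem admissible_suRel (q : ℂ) : Admissible (suRel q) := by
  refine admissible_of_bound (fun _ => 1) fun B _ f hf i => ?_
  rw [forall_suRel] at hf
  have h1 := hf.1
  simp only [map_sub, map_add, map_mul, map_star, eval_gen, map_one, sub_eq_zero] at h1
  have h2 := norm_sq_le_of_sum_eq f 1 (by rw [Fin.sum_univ_two, h1]; simp) i
  rw [abs_one] at h2
  exact (sq_le_one_iff₀ (norm_nonneg _)).mp h2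

/-- `C(SU_q(2))`, the universal C*-algebra generated by `α` and `γ` with the relations
`α⋆α + γ⋆γ = 1`, `αα⋆ + |q|²γ⋆γ = 1`, `αγ = q̄γα`, `γγ⋆ = γ⋆γ`. -/
abbrev CSU (q : ℂ) : Type := UnivCStar (suRel q) (admissible_suRel q)

namespace CSU

variable (q : ℂ)

/-- The generator `α`. -/
def α : CSU q := UnivCStar.gen (suRel q) (admissible_suRel q) 0

/-- The generator `γ`. -/
def γ : CSU q := UnivCStar.gen (suRel q) (admissible_suRel q) 1

theorem rel : star (α q) * α q + star (γ q) * γ q = 1 ∧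
    α q * star (α q) + ((‖q‖ ^ 2 : ℝ) : ℂ) • (star (γ q) * γ q) = 1 ∧
    α q * γ q = conj q • (γ q * α q) ∧ γ q * star (γ q) = star (γ q) * γ q := by
  have h := forall_suRel.mp fun r hr =>
    UnivCStar.mk_eq_zero (R := suRel q) (h := admissible_suRel q) hr
  simp only [map_sub, map_add, map_mul, map_star, map_smul, map_one, sub_eq_zero] at h
  exact h

theorem action_rel (z : Circle) : ∀ r ∈ suRel q, FreeStarAlgebra.eval (fun i : Fin 2 =>
    (z : ℂ) ^ (![0, 1] i : ℤ) • UnivCStar.gen (suRel q) (admissible_suRel q) i) r = 0 := by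
  have hz : star (z : ℂ) * z = 1 := star_mul_self_circle z
  have hz' : (z : ℂ) * star (z : ℂ) = 1 := by rw [mul_comm, hz]
  have h := rel q
  rw [forall_suRel]
  simp only [map_sub, map_add, map_mul, map_star, map_smul, eval_gen, map_one, sub_eq_zero,
    Matrix.cons_val_zero, Matrix.cons_val_one, zpow_zero, zpow_one, one_smul,
    star_smul, smul_mul_smul_comm, hz, hz']
  refine ⟨h.1, h.2.1, ?_, h.2.2.2⟩
  rw [mul_smul_comm, smul_mul_assoc, smul_comm]
  exact congrArg _ h.2.2.1

/-- The action of `𝕋` on `C(SU_q(2))` with `deg α = 0`, `deg γ = 1`. -/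
def action : CircleAction (CSU q) := gradedAction ![0, 1] (action_rel q)

theorem isHomogeneous_α : (action q).IsHomogeneous 0 (α q) :=
  gradedAction_gen (h := admissible_suRel q) ![0, 1] (action_rel q) 0

theorem isHomogeneous_γ : (action q).IsHomogeneous 1 (γ q) :=
  gradedAction_gen (h := admissible_suRel q) ![0, 1] (action_rel q) 1

/-- The entries `v_{i,k}`, `i, k ∈ {-1, 0, 1}`, of the matrix of the three-dimensional
representation of `SU_q(2)`. -/
def V : SignType → SignType → CSU q
  | .neg, .neg => α q ^ 2
  | .neg, .zero => -(((sig q ^ 2 : ℝ) : ℂ) • (star (γ q) * α q))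
  | .neg, .pos => -(q • star (γ q) ^ 2)
  | .zero, .neg => (q / conj q) • (α q * γ q)
  | .zero, .zero => 1 - ((sig q ^ 2 : ℝ) : ℂ) • (star (γ q) * γ q)
  | .zero, .pos => star (γ q) * star (α q)
  | .pos, .neg => -((q * (q / conj q)) • γ q ^ 2)
  | .pos, .zero => -(((sig q ^ 2 : ℝ) : ℂ) • (star (α q) * γ q))
  | .pos, .pos => star (α q) ^ 2

end CSU

end SU

section Sphere

open FreeStarAlgebra

/-- The relations of `C(𝕏_{q,ρ,λ})`, with `e_i = gen i`. -/
def sphereRel (q : ℂ) (ρ lam : ℝ) : Set (FreeStarAlgebra SignType) :=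
  (Set.range fun i => star (gen i) - gen (-i)) ∪
  {gen (-1) * gen 1 + ((sig q ^ 2 : ℝ) : ℂ) • gen 0 ^ 2 + (vsig q : ℂ) • (gen 1 * gen (-1))
     - (ρ : ℂ) • 1,
   ((sig q ^ 2 : ℝ) : ℂ) • (gen (-1) * gen 0)
     - ((vsig q * sig q ^ 2 : ℝ) : ℂ) • (gen 0 * gen (-1)) - (lam : ℂ) • gen (-1),
   (vsig q : ℂ) • (gen 1 * gen (-1) - gen (-1) * gen 1) + ((1 - vsig q ^ 2 : ℝ) : ℂ) • gen 0 ^ 2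
     - (lam : ℂ) • gen 0,
   ((sig q ^ 2 : ℝ) : ℂ) • (gen 0 * gen 1)
     - ((vsig q * sig q ^ 2 : ℝ) : ℂ) • (gen 1 * gen 0) - (lam : ℂ) • gen 1}

theorem forall_sphereRel {q : ℂ} {ρ lam : ℝ} {P : FreeStarAlgebra SignType → Prop} :
    (∀ r ∈ sphereRel q ρ lam, P r) ↔ (∀ i : SignType, P (star (gen i) - gen (-i))) ∧
      P (gen (-1) * gen 1 + ((sig q ^ 2 : ℝ) : ℂ) • gen 0 ^ 2
        + (vsig q : ℂ) • (gen 1 * gen (-1)) - (ρ : ℂ) • 1) ∧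
      P (((sig q ^ 2 : ℝ) : ℂ) • (gen (-1) * gen 0)
        - ((vsig q * sig q ^ 2 : ℝ) : ℂ) • (gen 0 * gen (-1)) - (lam : ℂ) • gen (-1)) ∧
      P ((vsig q : ℂ) • (gen 1 * gen (-1) - gen (-1) * gen 1)
        + ((1 - vsig q ^ 2 : ℝ) : ℂ) • gen 0 ^ 2 - (lam : ℂ) • gen 0) ∧
      P (((sig q ^ 2 : ℝ) : ℂ) • (gen 0 * gen 1)
        - ((vsig q * sig q ^ 2 : ℝ) : ℂ) • (gen 1 * gen 0) - (lam : ℂ) • gen 1) := by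
  rw [sphereRel]
  simp only [Set.mem_union, or_imp, forall_and, Set.forall_mem_range, Set.mem_insert_iff,
    Set.mem_singleton_iff, forall_eq]

/-- A relation `a x₁⋆x₁ + b x₁x₁⋆ + c x₀⋆x₀ = r` with `a, c > 0` and `b ≥ 0` bounds `x₁`, `x₀`. -/
theorem norm_le_of_sphere {D : Type u} [CStarAlgebra D] (x y : D) {a b c r : ℝ} (ha : 0 < a)
    (hb : 0 ≤ b) (hc : 0 < c)
    (h : (a : ℂ) • (star x * x) + (b : ℂ) • (x * star x) + (c : ℂ) • (star y * y) = (r : ℂ) • 1) :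
    ‖x‖ ≤ √(|r| / a) ∧ ‖y‖ ≤ √(|r| / c) := by
  have hs : ∀ t : ℝ, 0 ≤ t → ∀ w : D,
      star (((√t : ℝ) : ℂ) • w) * (((√t : ℝ) : ℂ) • w) = (t : ℂ) • (star w * w) := by
    intro t ht w
    rw [star_smul, smul_mul_smul_comm, ← starRingEnd_apply, Complex.conj_ofReal,
      ← Complex.ofReal_mul, Real.mul_self_sqrt ht]
  have h1 := norm_sq_le_of_sum_eq
    ![((√a : ℝ) : ℂ) • x, ((√b : ℝ) : ℂ) • star x, ((√c : ℝ) : ℂ) • y] r (by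
      rw [Fin.sum_univ_three]
      simp only [Matrix.cons_val_zero, Matrix.cons_val_one, Matrix.cons_val]
      rw [hs a ha.le, hs b hb, hs c hc.le, star_star, h])
  have hn : ∀ t : ℝ, 0 < t → ∀ w : D, ‖((√t : ℝ) : ℂ) • w‖ ^ 2 ≤ |r| → ‖w‖ ≤ √(|r| / t) := by
    intro t ht w hw
    refine Real.le_sqrt_of_sq_le ?_
    rw [norm_smul, mul_pow, Complex.norm_real, Real.norm_of_nonneg (Real.sqrt_nonneg t),
      Real.sq_sqrt ht.le] at hw
    rw [le_div_iff₀ ht, mul_comm]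
    exact hw
  exact ⟨hn a ha x (h1 0), hn c hc y (h1 2)⟩

theorem admissible_sphereRel (q : ℂ) (ρ lam : ℝ) : Admissible (sphereRel q ρ lam) := by
  refine admissible_of_bound (fun _ => max √(|ρ| / 1) √(|ρ| / (sig q ^ 2))) fun B _ f hf i => ?_
  rw [forall_sphereRel] at hf
  obtain ⟨h0, h1, -⟩ := hf
  simp only [map_sub, map_add, map_mul, map_star, map_smul, map_pow, eval_gen, map_one,
    sub_eq_zero] at h0 h1
  have e1 : f (-1) = star (f 1) := (h0 1).symm
  have e0 : star (f 0) = f 0 := h0 0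
  have hσ : 0 < sig q ^ 2 := by rw [sig_sq]; positivity
  have h2 := norm_le_of_sphere (f 1) (f 0) (a := 1) (b := vsig q) (c := sig q ^ 2) (r := ρ)
    one_pos (sq_nonneg _) hσ (by
      rw [← h1, e1, e0, Complex.ofReal_one, one_smul, sq (f 0)]
      abel)
  cases i with
  | zero => exact h2.2.trans (le_max_right _ _)
  | neg =>
    change ‖f (-1)‖ ≤ _
    rw [e1, norm_star]
    exact h2.1.trans (le_max_left _ _)
  | pos => exact h2.1.trans (le_max_left _ _)

/-- `C(𝕏_{q,ρ,λ})`, the C*-algebra of the braided Podleś sphere. -/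
abbrev Sphere (q : ℂ) (ρ lam : ℝ) : Type :=
  UnivCStar (sphereRel q ρ lam) (admissible_sphereRel q ρ lam)

/-- The generators `e_{-1}, e_0, e_1` of `C(𝕏_{q,ρ,λ})`. -/
def Sphere.e (q : ℂ) (ρ lam : ℝ) (i : SignType) : Sphere q ρ lam :=
  UnivCStar.gen (sphereRel q ρ lam) (admissible_sphereRel q ρ lam) i

/-- The relations of Podleś's `C(X_{μλρ})`. -/
def podlesRel (μ lam ρ : ℝ) : Set (FreeStarAlgebra SignType) :=
  (Set.range fun i => star (gen i) - gen (-i)) ∪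
  {((1 + μ ^ 2 : ℝ) : ℂ) • (gen (-1) * gen 1 + ((μ ^ 2 : ℝ) : ℂ)⁻¹ • (gen 1 * gen (-1)))
     + gen 0 ^ 2 - (ρ : ℂ) • 1,
   gen 0 * gen (-1) - ((μ ^ 2 : ℝ) : ℂ) • (gen (-1) * gen 0) - (lam : ℂ) • gen (-1),
   ((1 + μ ^ 2 : ℝ) : ℂ) • (gen (-1) * gen 1 - gen 1 * gen (-1))
     + ((1 - μ ^ 2 : ℝ) : ℂ) • gen 0 ^ 2 - (lam : ℂ) • gen 0,
   gen 1 * gen 0 - ((μ ^ 2 : ℝ) : ℂ) • (gen 0 * gen 1) - (lam : ℂ) • gen 1}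

theorem forall_podlesRel {μ lam ρ : ℝ} {P : FreeStarAlgebra SignType → Prop} :
    (∀ r ∈ podlesRel μ lam ρ, P r) ↔ (∀ i : SignType, P (star (gen i) - gen (-i))) ∧
      P (((1 + μ ^ 2 : ℝ) : ℂ) • (gen (-1) * gen 1 + ((μ ^ 2 : ℝ) : ℂ)⁻¹ • (gen 1 * gen (-1)))
        + gen 0 ^ 2 - (ρ : ℂ) • 1) ∧
      P (gen 0 * gen (-1) - ((μ ^ 2 : ℝ) : ℂ) • (gen (-1) * gen 0) - (lam : ℂ) • gen (-1)) ∧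
      P (((1 + μ ^ 2 : ℝ) : ℂ) • (gen (-1) * gen 1 - gen 1 * gen (-1))
        + ((1 - μ ^ 2 : ℝ) : ℂ) • gen 0 ^ 2 - (lam : ℂ) • gen 0) ∧
      P (gen 1 * gen 0 - ((μ ^ 2 : ℝ) : ℂ) • (gen 0 * gen 1) - (lam : ℂ) • gen 1) := by
  rw [podlesRel]
  simp only [Set.mem_union, or_imp, forall_and, Set.forall_mem_range, Set.mem_insert_iff,
    Set.mem_singleton_iff, forall_eq]

theorem admissible_podlesRel (μ lam ρ : ℝ) : Admissible (podlesRel μ lam ρ) := by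
  refine admissible_of_bound (fun _ => max √(|ρ| / (1 + μ ^ 2)) √(|ρ| / 1)) fun B _ f hf i => ?_
  rw [forall_podlesRel] at hf
  obtain ⟨h0, h1, -⟩ := hf
  simp only [map_sub, map_add, map_mul, map_star, map_smul, map_pow, eval_gen, map_one,
    sub_eq_zero] at h0 h1
  have e1 : f (-1) = star (f 1) := (h0 1).symm
  have e0 : star (f 0) = f 0 := h0 0
  have h2 := norm_le_of_sphere (f 1) (f 0) (a := 1 + μ ^ 2) (b := (1 + μ ^ 2) * (μ ^ 2)⁻¹) (c := 1)
    (r := ρ) (by positivity) (by positivity) one_pos (by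
      rw [← h1, e1, e0, Complex.ofReal_one, one_smul, sq (f 0), smul_add, smul_smul,
        Complex.ofReal_mul, Complex.ofReal_inv])
  cases i with
  | zero => exact h2.2.trans (le_max_right _ _)
  | neg =>
    change ‖f (-1)‖ ≤ _
    rw [e1, norm_star]
    exact h2.1.trans (le_max_left _ _)
  | pos => exact h2.1.trans (le_max_left _ _)

/-- Podleś's C*-algebra `C(X_{μλρ})`. -/
abbrev Podles (μ lam ρ : ℝ) : Type := UnivCStar (podlesRel μ lam ρ) (admissible_podlesRel μ lam ρ)

/-- The generators `E_{-1}, E_0, E_1` of `C(X_{μλρ})`. -/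
def Podles.E (μ lam ρ : ℝ) (i : SignType) : Podles μ lam ρ :=
  UnivCStar.gen (podlesRel μ lam ρ) (admissible_podlesRel μ lam ρ) i

end Sphere

end BraidedSphere

end

open BraidedSphere

/-! The relations of the sphere are covariant. Write `s = |q|²`. One quadratic form `S` takes the
value `ρ` on the triple `e`, and three forms `V_m` take the values `λ e_m` (`eval_sphereRel_iff`).
The matrix `v` leaves `S` invariant and intertwines the triple `V` with `v` itself (`formS_vMat`,
`formV_vMat`). In these identities a power of `ζ` accompanies every product, because `e_k` has to be
moved past `v_{j,l}` in the braided tensor product. Together with `star_V`, which handles adjoints,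
they show that the elements `∑ v_{i,k} e_k` satisfy the relations of the `e_i`, and the universal
property yields `Γ`. The circle acts because `S` and `V_m` only involve pairs of indices with sum
`0` and `m`.

The map `Δ` comes from the universal property in the same way, by reducing products to ordered
monomials. This needs `αγ* = qγ*α`, which is not among the defining relations: it follows from the
Fuglede-Putnam theorem, since `γ` is normal (`CSU.rules`). Moreover `Δ(v_{i,l}) = ∑ v_{i,k} ⊗
v_{k,l}` (`comul_vMat`), so both sides of the coaction identity send `e_i` to `∑ v_{i,k} v_{k,l}
e_l`.

For the density condition, `S` is nondegenerate, so its invariance makes `v` left invertible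
(`exists_mul_V`). Hence `j₂(e_m)` is a combination of the `Γ(e_j)` with coefficients from `j₁`. The
closed span of `j₁(A) Γ(X)` is therefore stable under left multiplication by every `j₂(e_m)`, thus
by `j₂(X)`, and it contains `1`.

The analytic part is the canonical isomorphism of the two triple products (`Braided.exists_assoc`).
In both, products of three homogeneous elements span a dense *-algebra with the same multiplication
rules. Let `G` be the closed *-algebra generated by the corresponding pairs in the product of the
two algebras. It is the graph of an isomorphism as soon as both projections of `G` are injective. To
see this, test elements against functionals `φ ⊗ α ⊗ β` with `α`, `β` supported in single degrees.
On words, the values on the two sides differ by a factor that depends on the degrees alone and can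
be made nonzero (`prodFun_graph`), so the vanishing of one coordinate forces that of the other. That
such functionals separate points rests on slice maps of the minimal tensor product, whose
boundedness follows from the GNS construction (`HilbertRep.norm_le`,
`MinTensor.eq_zero_of_prodFun`), and on Fourier analysis on the circle (`eq_zero_of_hasDegree`).

The comparison with Podleś's algebra reverses the indices and rescales the generators; every
relation becomes a nonzero multiple of a relation on the other side. -/

noncomputable section

open scoped TensorProduct ComplexConjugate InnerProductSpace ComplexOrder

namespace BraidedSphere

universe u v

/-! ### Norming functionals and the GNS representation -/

section States

variable {A : Type u} [CStarAlgebra A]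

/-- A self-adjoint element of a nontrivial C*-algebra attains its norm on a contractive unital
functional. -/
theorem exists_unital_functional [Nontrivial A] {b : A} (hb : IsSelfAdjoint b) :
    ∃ f : A →L[ℂ] ℂ, ‖f‖ ≤ 1 ∧ f 1 = 1 ∧ ‖f b‖ = ‖b‖ := by
  have : IsStarNormal b := hb.isStarNormal
  let S := StarAlgebra.elemental ℂ b
  let b' : S := ⟨b, StarAlgebra.elemental.self_mem ℂ b⟩
  have hb' : IsSelfAdjoint b' := Subtype.ext hb
  -- In the commutative C*-algebra generated by `b` the norm is the spectral radius, so it is the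
  -- modulus of a spectral value, hence of the value of a character. A Hahn-Banach extension of that
  -- character keeps norm at most `1`.
  obtain ⟨z, hz, hzn⟩ := spectrum.exists_nnnorm_eq_spectralRadius b'
  rw [hb'.spectralRadius_eq_nnnorm] at hzn
  have hzn' : ‖z‖ = ‖b‖ := by
    have h1 : ‖z‖₊ = ‖b'‖₊ := by exact_mod_cast hzn
    exact congrArg NNReal.toReal h1
  obtain ⟨χ, hχ⟩ := WeakDual.CharacterSpace.mem_spectrum_iff_exists.mp hz
  obtain ⟨g, hg, hgn⟩ := exists_extension_norm_eq
    (Subalgebra.toSubmodule S.toSubalgebra) (WeakDual.toStrongDual (χ : WeakDual ℂ S))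
  refine ⟨g, ?_, ?_, ?_⟩
  · rw [hgn]
    exact (WeakDual.CharacterSpace.norm_le_norm_one χ).trans (by simp)
  · have := hg (1 : S)
    refine this.trans ?_
    exact map_one χ
  · have := hg b'
    change g b = χ b' at this
    rw [this, hχ, hzn']

/-- A contractive unital functional on a C*-algebra is positive. -/
theorem nonneg_of_unital_contractive [PartialOrder A] [StarOrderedRing A] {f : A →L[ℂ] ℂ}
    (hf : ‖f‖ ≤ 1) (h1 : f 1 = 1) {x : A} (hx : 0 ≤ x) : 0 ≤ f x := by
  have hle : ∀ y, ‖f y‖ ≤ ‖y‖ := fun y => by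
    simpa using f.le_of_opNorm_le hf y
  have hsa : IsSelfAdjoint x := .of_nonneg hx
  have him : (f x).im = 0 := by
    -- Contractivity on `x + ir` gives `|f x + ir|² ≤ ‖x‖² + r²`. The `r²` cancels and leaves a
    -- bound linear in `r`, which forces the imaginary part to vanish.
    have key : ∀ r : ℝ, (f x).im * r * 2 ≤ ‖x‖ ^ 2 := by
      intro r
      have h2 : ‖x + (Complex.I * r) • (1 : A)‖ ^ 2 ≤ ‖x‖ ^ 2 + r ^ 2 := by
        have h3 : star (x + (Complex.I * r) • (1 : A)) * (x + (Complex.I * r) • (1 : A)) =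
            x * x + ((r ^ 2 : ℝ) : ℂ) • (1 : A) := by
          rw [star_add, hsa.star_eq, star_smul, star_one]
          simp only [mul_add, add_mul, mul_smul_comm, smul_mul_assoc, one_mul, mul_one]
          simp only [star_mul', Complex.star_def, Complex.conj_I, Complex.conj_ofReal]
          have h4 : -Complex.I * (r : ℂ) * (Complex.I * r) = ((r ^ 2 : ℝ) : ℂ) := by
            push_cast
            linear_combination (-(r : ℂ) ^ 2) * Complex.I_mul_I
          rw [smul_add, smul_smul, mul_comm (Complex.I * (r : ℂ)), h4]
          module
        rw [sq, ← CStarRing.norm_star_mul_self, h3]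
        refine (norm_add_le _ _).trans (add_le_add ?_ ?_)
        · rw [sq]; exact norm_mul_le x x
        · rw [norm_smul, Complex.norm_real, Real.norm_of_nonneg (sq_nonneg r)]
          exact mul_le_of_le_one_right (sq_nonneg r) (norm_unitary_le (one_mem (unitary A)))
      have h5 := (pow_le_pow_left₀ (norm_nonneg _) (hle (x + (Complex.I * r) • (1 : A))) 2).trans h2
      rw [map_add, map_smul, h1, ← Complex.normSq_eq_norm_sq, Complex.normSq_apply] at h5
      simp at h5
      nlinarith [sq_nonneg (f x).re, sq_nonneg (f x).im]
    by_contra h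
    -- This `r` turns the bound into `2(‖x‖² + 1) ≤ ‖x‖²`.
    have := key ((‖x‖ ^ 2 + 1) / (f x).im)
    rw [mul_div_cancel₀ _ h] at this
    nlinarith [sq_nonneg ‖x‖]
  have hre : 0 ≤ (f x).re := by
    -- From `0 ≤ ‖x‖ - x ≤ ‖x‖` one gets `‖x‖ - Re (f x) ≤ ‖x‖`.
    have h2 : ‖(‖x‖ : ℂ) • (1 : A) - x‖ ≤ ‖x‖ := by
      have h3 : x ≤ algebraMap ℝ A ‖x‖ := hsa.le_algebraMap_norm_self
      have h4 : (‖x‖ : ℂ) • (1 : A) = algebraMap ℝ A ‖x‖ := by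
        rw [Algebra.algebraMap_eq_smul_one]; exact Complex.coe_smul _ _
      rw [h4]
      rw [CStarAlgebra.norm_le_iff_le_algebraMap _ (norm_nonneg _) (sub_nonneg.mpr h3)]
      exact sub_le_self _ hx
    have h5 := (hle _).trans h2
    rw [map_sub, map_smul, h1, smul_eq_mul, mul_one] at h5
    have h6 := (Complex.re_le_norm _).trans h5
    simp at h6
    exact h6
  exact Complex.nonneg_iff.mpr ⟨hre, him.symm⟩

/-- The norm of a C*-algebra is detected by Hilbert space representations. -/
theorem HilbertRep.norm_le {a : A} {c : ℝ} (hc : 0 ≤ c)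
    (h : ∀ (π : HilbertRep A) (k : π.space), ‖π.hom a k‖ ≤ c * ‖k‖) : ‖a‖ ≤ c := by
  let _ : PartialOrder A := CStarAlgebra.spectralOrder A
  have _ : StarOrderedRing A := CStarAlgebra.spectralOrderedRing A
  rcases subsingleton_or_nontrivial A with hA | hA
  · rwa [Subsingleton.elim a 0, norm_zero]
  -- In the GNS representation of this functional the cyclic vector `ξ` is a unit vector with `‖aξ‖²
  -- = f(a*a) = ‖a‖²`, so testing on `ξ` alone is enough.
  obtain ⟨f, hf, h1, hfa⟩ := exists_unital_functional (IsSelfAdjoint.star_mul_self a)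
  let F : A →ₚ[ℂ] ℂ := PositiveLinearMap.mk₀ f.toLinearMap
    fun x hx => nonneg_of_unital_contractive hf h1 hx
  let π : HilbertRep A := { space := F.GNS, hom := F.gnsStarAlgHom }
  let ξ : F.PreGNS := F.toPreGNS 1
  have hn : ∀ y : F.PreGNS, (‖y‖ : ℂ) ^ 2 = f (star (F.ofPreGNS y) * F.ofPreGNS y) :=
    fun y => F.preGNS_norm_sq y
  have hξ : ‖ξ‖ = 1 := by
    have h2 := hn ξ
    change (‖ξ‖ : ℂ) ^ 2 = f (star 1 * 1) at h2
    rw [star_one, one_mul, h1] at h2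
    have h3 : ‖ξ‖ ^ 2 = 1 := by exact_mod_cast h2
    exact (pow_eq_one_iff_of_nonneg (norm_nonneg _) two_ne_zero).mp h3
  have h2 := h π (ξ : F.GNS)
  have h3 : π.hom a (ξ : F.GNS) = ((F.leftMulMapPreGNS a ξ : F.PreGNS) : F.GNS) :=
    F.gnsNonUnitalStarAlgHom_apply_coe
  have h4 : ‖F.leftMulMapPreGNS a ξ‖ = ‖a‖ := by
    have h5 := hn (F.leftMulMapPreGNS a ξ)
    have h6 : F.ofPreGNS (F.leftMulMapPreGNS a ξ) = a := mul_one a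
    rw [h6] at h5
    have h7 := congrArg norm h5
    rw [hfa, CStarRing.norm_star_mul_self, norm_pow, Complex.norm_real, norm_norm, ← sq] at h7
    exact (pow_left_inj₀ (norm_nonneg _) (norm_nonneg _) two_ne_zero).mp h7
  rw [h3] at h2
  have h8 : ‖((F.leftMulMapPreGNS a ξ : F.PreGNS) : F.GNS)‖ = ‖a‖ :=
    (UniformSpace.Completion.norm_coe _).trans h4
  have h9 : ‖(ξ : F.GNS)‖ = 1 := (UniformSpace.Completion.norm_coe _).trans hξ
  have h10 : ‖((F.leftMulMapPreGNS a ξ : F.PreGNS) : F.GNS)‖ ≤ c * ‖(ξ : F.GNS)‖ := h2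
  rwa [h8, h9, mul_one] at h10

end States

end BraidedSphere

end

/-! ### Slice maps and separation of points in the minimal tensor product -/

noncomputable section

open scoped TensorProduct ComplexConjugate InnerProductSpace

namespace BraidedSphere

universe u v w

/-- A linear map that is bounded for a C*-seminorm extends to the completion. -/
theorem CStarSeminorm.exists_extension {F : Type u} [Ring F] [StarRing F] [Algebra ℂ F]
    (p : CStarSeminorm F) {E : Type v} [NormedAddCommGroup E] [NormedSpace ℂ E] [CompleteSpace E]
    (f : F →ₗ[ℂ] E) (C : ℝ) (hf : ∀ x, ‖f x‖ ≤ C * p x) :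
    ∃ g : p.Completion →L[ℂ] E, ∀ x, g (p.toCompl x) = f x := by
  let e : F →ₗ[ℂ] p.Completion :=
    { toFun := p.toCompl, map_add' := p.toCompl_add, map_smul' := p.toCompl_smul }
  refine ⟨f.extendOfNorm e, fun x => ?_⟩
  exact LinearMap.extendOfNorm_eq p.denseRange_toCompl ⟨C, fun y => by
    have h : ‖e y‖ = p y := p.norm_toCompl y
    rw [h]; exact hf y⟩ x

section Slices

variable {A B : Type u} [CStarAlgebra A] [CStarAlgebra B]

/-- The functional `a ↦ ⟪k', π(a) k⟫`. -/
def HilbertRep.coeff (π : HilbertRep A) (k' k : π.space) : A →L[ℂ] ℂ :=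
  (innerSL ℂ k').comp ((ContinuousLinearMap.apply ℂ π.space k).comp
    ⟨π.hom.toAlgHom.toLinearMap, continuous_hom π.hom⟩)

theorem HilbertRep.coeff_apply (π : HilbertRep A) (k' k : π.space) (a : A) :
    π.coeff k' k a = ⟪k', π.hom a k⟫_ℂ := rfl

/-- `a ⊗ b ↦ φ(a) b` on the algebraic tensor product. -/
def algSliceL (φ : A →L[ℂ] ℂ) : A ⊗[ℂ] B →ₗ[ℂ] B :=
  TensorProduct.lift ((LinearMap.lsmul ℂ B).comp φ.toLinearMap)

/-- `a ⊗ b ↦ ψ(b) a` on the algebraic tensor product. -/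
def algSliceR (ψ : B →L[ℂ] ℂ) : A ⊗[ℂ] B →ₗ[ℂ] A :=
  TensorProduct.lift ((LinearMap.lsmul ℂ A).comp ψ.toLinearMap).flip

theorem algSliceL_tmul (φ : A →L[ℂ] ℂ) (a : A) (b : B) : algSliceL φ (a ⊗ₜ[ℂ] b) = φ a • b := rfl

theorem algSliceR_tmul (ψ : B →L[ℂ] ℂ) (a : A) (b : B) : algSliceR ψ (a ⊗ₜ[ℂ] b) = ψ b • a := rfl

/-- Both sides are `(φ ⊗ ψ)(x)`. This exchange lets a bound for slices on one side be carried over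
to the other side. -/
theorem algSliceL_algSliceR (φ : A →L[ℂ] ℂ) (ψ : B →L[ℂ] ℂ) (x : A ⊗[ℂ] B) :
    ψ (algSliceL φ x) = φ (algSliceR ψ x) := by
  induction x with
  | zero => simp
  | add x y hx hy => simp only [map_add, hx, hy]
  | tmul a b => rw [algSliceL_tmul, algSliceR_tmul, map_smul, map_smul, smul_eq_mul, smul_eq_mul,
      mul_comm]

/-- A product vector in the tensor product of the representation spaces. -/
def PreTensor.tmul (π : HilbertRep A) (σ : HilbertRep B) (h : π.space) (k : σ.space) :
    PreTensor π σ := h ⊗ₜ[ℂ] k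

theorem PreTensor.induction {π : HilbertRep A} {σ : HilbertRep B} {P : PreTensor π σ → Prop}
    (h0 : P 0) (hadd : ∀ ξ η, P ξ → P η → P (ξ + η)) (ht : ∀ h k, P (PreTensor.tmul π σ h k))
    (ξ : PreTensor π σ) : P ξ :=
  TensorProduct.induction_on (motive := P) ξ h0 ht hadd

theorem PreTensor.norm_tmul (π : HilbertRep A) (σ : HilbertRep B) (h : π.space) (k : σ.space) :
    ‖PreTensor.tmul π σ h k‖ = ‖h‖ * ‖k‖ := TensorProduct.norm_tmul h k

/-- The inner product of elementary tensors factors. Slices by vector functionals are thereby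
controlled by the operators that define the minimal norm. -/
theorem inner_tensorRep_eq_coeff (π : HilbertRep A) (σ : HilbertRep B) (h' h : π.space)
    (k' k : σ.space) (x : A ⊗[ℂ] B) :
    ⟪PreTensor.tmul π σ h' k', tensorRep π σ x (PreTensor.tmul π σ h k)⟫_ℂ =
      π.coeff h' h (algSliceR (σ.coeff k' k) x) := by
  induction x with
  | zero => simp
  | add x y hx hy => simp only [map_add, add_apply, inner_add_right, hx, hy]
  | tmul a b =>
    rw [algSliceR_tmul, map_smul, tensorRep_tmul, HilbertRep.coeff_apply, HilbertRep.coeff_apply]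
    refine Eq.trans ?_ (mul_comm _ _)
    exact TensorProduct.inner_tmul (𝕜 := ℂ) h' (π.hom a h) k' (σ.hom b k)

theorem norm_tensorRep_le (π : HilbertRep A) (σ : HilbertRep B) (x : A ⊗[ℂ] B) :
    ‖tensorRep π σ x‖ ≤ minSeminorm A B x :=
  le_ciSup (bddAbove_repSeminorm x) (π, σ)

theorem norm_inner_tensorRep_le (π : HilbertRep A) (σ : HilbertRep B) (ξ η : PreTensor π σ)
    (x : A ⊗[ℂ] B) : ‖⟪ξ, tensorRep π σ x η⟫_ℂ‖ ≤ ‖ξ‖ * ‖η‖ * minSeminorm A B x := by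
  have h1 := (tensorRep π σ x).le_opNorm η
  have h2 := norm_tensorRep_le π σ x
  calc _ ≤ ‖ξ‖ * ‖tensorRep π σ x η‖ := norm_inner_le_norm _ _
    _ ≤ ‖ξ‖ * (minSeminorm A B x * ‖η‖) := by gcongr; exact h1.trans (by gcongr)
    _ = _ := by ring

theorem norm_le_of_norm_inner_self_le {H : Type*} [NormedAddCommGroup H] [InnerProductSpace ℂ H]
    {y : H} {c : ℝ} (hc : 0 ≤ c) (h : ‖⟪y, y⟫_ℂ‖ ≤ c * ‖y‖) : ‖y‖ ≤ c := by
  rw [inner_self_eq_norm_sq_to_K, norm_pow, RCLike.norm_ofReal, abs_norm, sq] at h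
  rcases (norm_nonneg y).eq_or_lt with h0 | h0
  · rw [← h0]; exact hc
  · exact le_of_mul_le_mul_right h h0

/-- Let `y` be the sliced element applied to a vector `h` in a representation `π` of `A`. Then `⟪y,
y⟫` is a coefficient of `(π ⊗ σ)(x)` between `y ⊗ k'` and `h ⊗ k`, so one factor `‖y‖` cancels;
representations detect the norm. -/
theorem norm_algSliceR_coeff_le (σ : HilbertRep B) (k' k : σ.space) (x : A ⊗[ℂ] B) :
    ‖algSliceR (σ.coeff k' k) x‖ ≤ ‖k'‖ * ‖k‖ * minSeminorm A B x := by
  have h0 := (minSeminorm A B).nonneg x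
  refine HilbertRep.norm_le (by positivity) fun π h => ?_
  refine norm_le_of_norm_inner_self_le (by positivity) ?_
  set y := π.hom (algSliceR (σ.coeff k' k) x) h with hy
  have h1 := norm_inner_tensorRep_le π σ (PreTensor.tmul π σ y k') (PreTensor.tmul π σ h k) x
  rw [inner_tensorRep_eq_coeff, PreTensor.norm_tmul, PreTensor.norm_tmul, HilbertRep.coeff_apply,
    ← hy] at h1
  refine h1.trans (le_of_eq ?_)
  ring

/-- The functional `φ` is arbitrary and need not be a vector functional. The inner product `⟪y, y⟫`
is `φ` applied to a slice by a vector functional of `B`, and the preceding bound applies to that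
slice. -/
theorem norm_algSliceL_le (φ : A →L[ℂ] ℂ) (x : A ⊗[ℂ] B) :
    ‖algSliceL φ x‖ ≤ ‖φ‖ * minSeminorm A B x := by
  have h0 := (minSeminorm A B).nonneg x
  refine HilbertRep.norm_le (by positivity) fun σ k => ?_
  refine norm_le_of_norm_inner_self_le (by positivity) ?_
  set y := σ.hom (algSliceL φ x) k with hy
  have h1 : ⟪y, y⟫_ℂ = φ (algSliceR (σ.coeff y k) x) := by
    rw [← algSliceL_algSliceR, HilbertRep.coeff_apply]
  rw [h1]
  refine (φ.le_opNorm _).trans ?_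
  have h2 := norm_algSliceR_coeff_le σ y k x
  calc _ ≤ ‖φ‖ * (‖y‖ * ‖k‖ * minSeminorm A B x) := by gcongr
    _ = _ := by ring

namespace MinTensor

theorem exists_sliceL (φ : A →L[ℂ] ℂ) :
    ∃ g : MinTensor A B →L[ℂ] B, ∀ x, g (ofAlg x) = algSliceL φ x :=
  (minSeminorm A B).exists_extension (algSliceL φ) ‖φ‖ (norm_algSliceL_le φ)

/-- The slice map `φ ⊗ id`. -/
def sliceL (φ : A →L[ℂ] ℂ) : MinTensor A B →L[ℂ] B := (exists_sliceL φ).choose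

theorem sliceL_ofAlg (φ : A →L[ℂ] ℂ) (x : A ⊗[ℂ] B) : sliceL φ (ofAlg x) = algSliceL φ x :=
  (exists_sliceL φ).choose_spec x

/-- The functional `φ ⊗ ψ`. -/
def prodFun (φ : A →L[ℂ] ℂ) (ψ : B →L[ℂ] ℂ) : MinTensor A B →L[ℂ] ℂ := ψ.comp (sliceL φ)

theorem prodFun_tmul (φ : A →L[ℂ] ℂ) (ψ : B →L[ℂ] ℂ) (a : A) (b : B) :
    prodFun φ ψ (ofAlg (a ⊗ₜ b)) = φ a * ψ b := by
  change ψ (sliceL φ _) = _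
  rw [sliceL_ofAlg, algSliceL_tmul, map_smul, smul_eq_mul]

theorem exists_vectorFun (π : HilbertRep A) (σ : HilbertRep B) (ξ η : PreTensor π σ) :
    ∃ g : MinTensor A B →L[ℂ] ℂ, ∀ x, g (ofAlg x) = ⟪ξ, tensorRep π σ x η⟫_ℂ :=
  (minSeminorm A B).exists_extension
    ((innerSL ℂ ξ).toLinearMap.comp (((ContinuousLinearMap.apply ℂ (PreTensor π σ) η).toLinearMap).comp
      (tensorRep π σ).toLinearMap)) (‖ξ‖ * ‖η‖) (norm_inner_tensorRep_le π σ ξ η)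

theorem fun_ext {E : Type*} [NormedAddCommGroup E] [NormedSpace ℂ E] {f g : MinTensor A B →L[ℂ] E}
    (h : ∀ x, f (ofAlg x) = g (ofAlg x)) : f = g :=
  DFunLike.coe_injective
    (denseRange_ofAlg.equalizer f.continuous g.continuous (funext h))

/-- The representations `π ⊗ σ` are only defined on the algebraic tensor product. Hence `y` is
approximated by algebraic elements `x`, and their norm is shown to be at most the distance to `y`.
-/
theorem eq_zero_of_vectorFun {y : MinTensor A B}
    (h : ∀ (π : HilbertRep A) (σ : HilbertRep B) (ξ η : PreTensor π σ) (g : MinTensor A B →L[ℂ] ℂ),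
      (∀ x, g (ofAlg x) = ⟪ξ, tensorRep π σ x η⟫_ℂ) → g y = 0) : y = 0 := by
  have key : ∀ x : A ⊗[ℂ] B, minSeminorm A B x ≤ ‖ofAlg x - y‖ := by
    intro x
    refine ciSup_le fun P => ?_
    refine ContinuousLinearMap.opNorm_le_bound _ (norm_nonneg _) fun η => ?_
    refine norm_le_of_norm_inner_self_le (by positivity) ?_
    -- Testing `(π ⊗ σ)(x) η` against itself is evaluating a vector functional at `x`, or equally at
    -- `x - y`, because the functional vanishes at `y`.
    set ξ := tensorRep P.1 P.2 x η with hξ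
    obtain ⟨g, hg⟩ := exists_vectorFun P.1 P.2 ξ η
    have hgn : ∀ z, ‖g z‖ ≤ ‖ξ‖ * ‖η‖ * ‖z‖ := by
      refine fun z => denseRange_ofAlg.induction_on (p := fun z => ‖g z‖ ≤ ‖ξ‖ * ‖η‖ * ‖z‖) z
        (isClosed_le (by fun_prop) (by fun_prop)) fun x => ?_
      rw [hg, norm_ofAlg]
      exact norm_inner_tensorRep_le _ _ _ _ _
    have h1 : ⟪ξ, ξ⟫_ℂ = g (ofAlg x - y) := by
      rw [map_sub, h _ _ _ _ g hg, sub_zero, hg]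
    rw [h1]
    exact (hgn _).trans (le_of_eq (by ring))
  rw [← norm_le_zero_iff]
  refine le_of_forall_pos_le_add fun ε hε => ?_
  obtain ⟨_, ⟨x, rfl⟩, hx⟩ := Metric.mem_closure_iff.mp (denseRange_ofAlg (A := A) (B := B) y)
    (ε / 2) (by positivity)
  have h1 := key x
  rw [dist_comm, dist_eq_norm] at hx
  rw [← norm_ofAlg] at h1
  have h2 := norm_le_norm_add_norm_sub' y (ofAlg x)
  rw [norm_sub_rev] at h2
  linarith

/-- Products of separating families of functionals separate the points of the minimal tensor
product. -/
theorem eq_zero_of_prodFun {S : Set (A →L[ℂ] ℂ)} {T : Set (B →L[ℂ] ℂ)}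
    (hS : ∀ a, (∀ φ ∈ S, φ a = 0) → a = 0) (hT : ∀ b, (∀ ψ ∈ T, ψ b = 0) → b = 0)
    {y : MinTensor A B} (hy : ∀ φ ∈ S, ∀ ψ ∈ T, prodFun φ ψ y = 0) : y = 0 := by
  -- The family `T` kills the slices of `y` along `S`. For a vector functional of `B`, the right
  -- slice `R y` is then killed by all of `S`, because the two kinds of slices commute.
  have h1 : ∀ φ ∈ S, sliceL φ y = 0 := fun φ hφ => hT _ fun ψ hψ => hy φ hφ ψ hψ
  refine eq_zero_of_vectorFun fun π σ ξ η g hg => ?_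
  have h2 : ∀ (h' h : π.space) (k' k : σ.space) (g : MinTensor A B →L[ℂ] ℂ),
      (∀ x, g (ofAlg x) =
        ⟪PreTensor.tmul π σ h' k', tensorRep π σ x (PreTensor.tmul π σ h k)⟫_ℂ) → g y = 0 := by
    intro h' h k' k g hg
    obtain ⟨R, hR⟩ := (minSeminorm A B).exists_extension (algSliceR (σ.coeff k' k)) (‖k'‖ * ‖k‖)
      (norm_algSliceR_coeff_le σ k' k)
    change MinTensor A B →L[ℂ] A at R
    change ∀ x, R (ofAlg x) = _ at hR
    have h3 : R y = 0 := hS _ fun φ hφ => by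
      have h4 : φ.comp R = (σ.coeff k' k).comp (sliceL φ) := fun_ext fun x => by
        change φ (R _) = (σ.coeff k' k) (sliceL φ _)
        rw [hR, sliceL_ofAlg, algSliceL_algSliceR]
      have h5 := DFunLike.congr_fun h4 y
      change φ (R y) = (σ.coeff k' k) (sliceL φ y) at h5
      rw [h5, h1 φ hφ, map_zero]
    have h4 : g = (π.coeff h' h).comp R := fun_ext fun x => by
      change _ = π.coeff h' h (R _)
      rw [hg, hR, inner_tensorRep_eq_coeff]
    rw [h4]
    change π.coeff h' h (R y) = 0
    rw [h3, map_zero]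
  -- The functional depends sesquilinearly on the two vectors, and these lie in the algebraic tensor
  -- product, so product vectors suffice.
  choose G hG using exists_vectorFun π σ
  have hG' : ∀ ξ η g, (∀ x, g (ofAlg x) = ⟪ξ, tensorRep π σ x η⟫_ℂ) → g = G ξ η :=
    fun ξ η g hg => fun_ext fun x => by rw [hg, hG]
  rw [hG' ξ η g hg]
  clear hg g
  induction ξ using PreTensor.induction with
  | h0 => rw [← hG' 0 η 0 fun x => by simp]; rfl
  | hadd a b ha hb =>
    rw [← hG' (a + b) η (G a η + G b η) fun x => by
      rw [add_apply, hG, hG, inner_add_left], add_apply, ha, hb, add_zero]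
  | ht h' k' =>
    induction η using PreTensor.induction with
    | h0 => rw [← hG' _ 0 0 fun x => by simp]; rfl
    | hadd a b ha hb =>
      rw [← hG' _ (a + b) (G _ a + G _ b) fun x => by
        rw [add_apply, hG, hG, ← inner_add_right, ← map_add], add_apply, ha, hb, add_zero]
    | ht h k => exact h2 h' h k' k _ (hG _ _)

end MinTensor

end Slices

end BraidedSphere

end

/-! ### Spectral projections of a circle action -/

noncomputable section

open scoped ComplexConjugate
open MeasureTheory

namespace BraidedSphere

universe u v

namespace CircleAction

variable {A : Type u} [CStarAlgebra A]

/-- The functional `α` vanishes on the homogeneous elements of degree different from `n`. -/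
def HasDegree (ρ : CircleAction A) (n : ℤ) (α : A →L[ℂ] ℂ) : Prop :=
  ∀ m a, m ≠ n → ρ.IsHomogeneous m a → α a = 0

section

attribute [local instance] fact_pos

theorem integrable_orbit (ρ : CircleAction A) (n : ℤ) (a : A) :
    Integrable (fun x : AddCircle (1 : ℝ) => fourier (-n) x • ρ (AddCircle.toCircle x) a)
      AddCircle.haarAddCircle :=
  ((fourier (-n)).continuous.smul ((ρ.continuous' a).comp
    AddCircle.continuous_toCircle)).integrable_of_hasCompactSupport
      (HasCompactSupport.of_compactSpace _)

/-- The spectral projections. -/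
def specProj (ρ : CircleAction A) (n : ℤ) : A →L[ℂ] A :=
  LinearMap.mkContinuous
    { toFun := fun a =>
        fourierCoeff (T := (1 : ℝ)) (fun x : AddCircle (1 : ℝ) => ρ (AddCircle.toCircle x) a) n
      map_add' := fun a b => by
        simp only [fourierCoeff, map_add, smul_add]
        exact integral_add (ρ.integrable_orbit n a) (ρ.integrable_orbit n b)
      map_smul' := fun c a => by
        simp only [map_smul]
        exact fourierCoeff.const_smul _ c n } 1 fun a => by
    rw [one_mul]
    refine (norm_integral_le_of_norm_le_const (C := ‖a‖) (.of_forall fun x => ?_)).trans ?_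
    · rw [norm_smul, fourier_apply, Circle.norm_coe, one_mul]
      exact ρ.norm_apply_le _ a
    · simp

theorem specProj_apply (ρ : CircleAction A) (n : ℤ) (a : A) : ρ.specProj n a =
    fourierCoeff (T := (1 : ℝ)) (fun x : AddCircle (1 : ℝ) => ρ (AddCircle.toCircle x) a) n := rfl

/-- The orbit of an element of degree `m` is the `m`-th character times `a`, and distinct characters
are orthogonal. -/
theorem specProj_of_ne (ρ : CircleAction A) {m n : ℤ} (hmn : m ≠ n) {a : A}
    (ha : ρ.IsHomogeneous m a) : ρ.specProj n a = 0 := by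
  have h1 := congrFun (fourierCoeff_fourier (T := (1 : ℝ)) m) n
  rw [Pi.single_eq_of_ne hmn.symm] at h1
  rw [specProj_apply, fourierCoeff]
  have h2 : ∀ x : AddCircle (1 : ℝ), fourier (-n) x • ρ (AddCircle.toCircle x) a =
      (fourier (-n) x • fourier m x) • a := fun x => by
    rw [ha, smul_assoc, fourier_apply (n := m), AddCircle.toCircle_zsmul, Circle.coe_zpow]
  simp only [h2]
  rw [integral_smul_const]
  change fourierCoeff (T := (1 : ℝ)) (fourier m) n • a = 0
  rw [h1, zero_smul]

/-- A functional evaluated along the orbit of `a` is a continuous function all of whose Fourier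
coefficients vanish. Its Fourier series is trivially summable, so it converges pointwise to the
function; the value at the neutral element, which is the functional at `a`, is therefore zero. -/
theorem eq_zero_of_specProj (ρ : CircleAction A) {a : A} (h : ∀ n, ρ.specProj n a = 0) : a = 0 := by
  by_contra ha
  obtain ⟨ψ, hψ⟩ := SeparatingDual.exists_ne_zero (R := ℂ) ha
  let F : C(AddCircle (1 : ℝ), ℂ) := ⟨fun x => ψ (ρ (AddCircle.toCircle x) a),
    ψ.continuous.comp ((ρ.continuous' a).comp AddCircle.continuous_toCircle)⟩
  have hF : ∀ n, fourierCoeff F n = 0 := by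
    intro n
    have h1 := congrArg ψ (h n)
    rw [map_zero, specProj_apply, fourierCoeff, ← ψ.integral_comp_comm (ρ.integrable_orbit n a)]
      at h1
    rw [← h1, fourierCoeff]
    refine integral_congr_ae (.of_forall fun x => ?_)
    exact (map_smul ψ _ _).symm
  have h0 := has_pointwise_sum_fourier_series_of_summable (f := F)
    (by rw [show fourierCoeff F = 0 from funext hF]; exact summable_zero) 0
  simp only [hF, zero_smul] at h0
  have h1 : ψ (ρ (AddCircle.toCircle 0) a) = 0 := h0.unique hasSum_zero
  rw [AddCircle.toCircle_zero, ρ.map_one'] at h1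
  exact hψ h1

end

/-- The functionals that are supported on a single degree separate the points. -/
theorem eq_zero_of_hasDegree (ρ : CircleAction A) {a : A}
    (h : ∀ φ ∈ {φ : A →L[ℂ] ℂ | ∃ n, ρ.HasDegree n φ}, φ a = 0) : a = 0 := by
  refine ρ.eq_zero_of_specProj fun n => ?_
  refine (SeparatingDual.eq_zero_iff_forall_dual_eq_zero (R := ℂ) _).mpr fun φ => ?_
  -- Any bounded functional precomposed with a spectral projection is supported in one degree.
  exact h (φ.comp (ρ.specProj n)) ⟨n, fun m b hm hb => by
    change φ (ρ.specProj n b) = 0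
    rw [ρ.specProj_of_ne hm hb, map_zero]⟩

end CircleAction

end BraidedSphere

end

/-! ### Isomorphisms from closed graphs -/

noncomputable section

open scoped ComplexConjugate

namespace BraidedSphere

section Graph

/-- A closed *-subalgebra of `L × R` that is the graph of a bijection on dense subsets defines an
isomorphism. -/
theorem exists_equiv_of_graph {L R : Type} [CStarAlgebra L] [CStarAlgebra R]
    (G : StarSubalgebra ℂ (L × R)) (hG : IsClosed (G : Set (L × R)))
    (h₁ : ∀ g ∈ G, g.1 = 0 → g.2 = 0) (h₂ : ∀ g ∈ G, g.2 = 0 → g.1 = 0)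
    (hL : ∀ N : StarSubalgebra ℂ L, IsClosed (N : Set L) → (∀ g ∈ G, g.1 ∈ N) → ∀ y, y ∈ N)
    (hR : ∀ N : StarSubalgebra ℂ R, IsClosed (N : Set R) → (∀ g ∈ G, g.2 ∈ N) → ∀ y, y ∈ N) :
    ∃ Θ : L ≃⋆ₐ[ℂ] R, ∀ g ∈ G, Θ g.1 = g.2 := by
  let _ : CStarAlgebra G := StarSubalgebra.cstarAlgebra G (h_closed := hG)
  let p : G →⋆ₐ[ℂ] L := (StarAlgHom.fst ℂ L R).comp G.subtype
  let r : G →⋆ₐ[ℂ] R := (StarAlgHom.snd ℂ L R).comp G.subtype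
  have hp : Function.Injective p := (injective_iff_map_eq_zero p).mpr fun g hg =>
    Subtype.ext (Prod.ext hg (h₁ g.1 g.2 hg))
  have hr : Function.Injective r := (injective_iff_map_eq_zero r).mpr fun g hg =>
    Subtype.ext (Prod.ext (h₂ g.1 g.2 hg) hg)
  -- An injective *-homomorphism of C*-algebras is isometric, so its range is closed; being dense by
  -- `hL`, it is everything.
  have hp' : Function.Surjective p := fun y => by
    have hc := (NonUnitalStarAlgHom.isometry p hp).isClosedEmbedding.isClosed_range
    refine hL p.range ?_ (fun g hg => ⟨⟨g, hg⟩, rfl⟩) y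
    exact hc
  have hr' : Function.Surjective r := fun y => by
    have hc := (NonUnitalStarAlgHom.isometry r hr).isClosedEmbedding.isClosed_range
    refine hR r.range ?_ (fun g hg => ⟨⟨g, hg⟩, rfl⟩) y
    exact hc
  let P : G ≃⋆ₐ[ℂ] L := StarAlgEquiv.ofBijective p ⟨hp, hp'⟩
  let Q : G ≃⋆ₐ[ℂ] R := StarAlgEquiv.ofBijective r ⟨hr, hr'⟩
  refine ⟨P.symm.trans Q, fun g hg => ?_⟩
  have h : P.symm g.1 = ⟨g, hg⟩ := P.symm_apply_apply ⟨g, hg⟩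
  change Q (P.symm g.1) = g.2
  rw [h]
  rfl

end Graph

/-! ### Associativity of the braided tensor product -/

section Triple

variable {A B X : Type} [CStarAlgebra A] [CStarAlgebra B] [CStarAlgebra X]

theorem Braided.mem_of_gen {ζ : Circle} {ρ : CircleAction A} {τ : CircleAction B} {D : Type}
    [CStarAlgebra D] {N : StarSubalgebra ℂ D} (hN : IsClosed (N : Set D))
    (f : Braided ζ ρ τ →⋆ₐ[ℂ] D) (h₁ : ∀ a, f (j₁ ζ ρ τ a) ∈ N) (h₂ : ∀ b, f (j₂ ζ ρ τ b) ∈ N)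
    (y : Braided ζ ρ τ) : f y ∈ N := by
  have h : bracket (Set.range (j₁ ζ ρ τ)) (Set.range (j₂ ζ ρ τ)) ≤
      (Subalgebra.toSubmodule N.toSubalgebra).comap f.toAlgHom.toLinearMap := by
    refine bracket_le (isClosed_comap hN _ (continuous_hom f)) ?_
    rintro _ ⟨a, rfl⟩ _ ⟨b, rfl⟩
    change f _ ∈ N
    rw [map_mul]
    exact mul_mem (h₁ a) (h₂ b)
  rw [bracket_j₁_j₂] at h
  exact h (Submodule.mem_top (x := y))

/-- Three homogeneous *-homomorphisms into `D` whose images braid. -/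
structure BraidTriple (ζ : Circle) (ρ : CircleAction A) (σ : CircleAction B) (τ : CircleAction X)
    (D : Type) [CStarAlgebra D] where
  f : A →⋆ₐ[ℂ] D
  g : B →⋆ₐ[ℂ] D
  h : X →⋆ₐ[ℂ] D
  gf : ∀ {n m a b}, ρ.IsHomogeneous n a → σ.IsHomogeneous m b →
    g b * f a = (ζ : ℂ) ^ (-(m * n)) • (f a * g b)
  hf : ∀ {n k a x}, ρ.IsHomogeneous n a → τ.IsHomogeneous k x →
    h x * f a = (ζ : ℂ) ^ (-(k * n)) • (f a * h x)
  hg : ∀ {m k b x}, σ.IsHomogeneous m b → τ.IsHomogeneous k x →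
    h x * g b = (ζ : ℂ) ^ (-(k * m)) • (g b * h x)

namespace BraidTriple

variable {ζ : Circle} {ρ : CircleAction A} {σ : CircleAction B} {τ : CircleAction X}
  {D : Type} [CStarAlgebra D] (T : BraidTriple ζ ρ σ τ D)

/-- The products of three homogeneous elements. -/
def words : Set D := {y | ∃ n a m b k x, ρ.IsHomogeneous n a ∧ σ.IsHomogeneous m b ∧
  τ.IsHomogeneous k x ∧ y = T.f a * T.g b * T.h x}

/-- Each letter of the second word passes the later letters of the first one at the cost of a
scalar. Words of homogeneous elements are thus closed under multiplication up to scalars, which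
makes their span an algebra. -/
theorem mul_words {R : Type*} [Ring R] [Algebra ℂ R] {F F' G G' H H' : R} {r s t : ℂ}
    (h1 : G * F' = r • (F' * G)) (h2 : H * F' = s • (F' * H)) (h3 : H * G' = t • (G' * H)) :
    F * G * H * (F' * G' * H') = (s * t * r) • (F * F' * (G * G') * (H * H')) := by
  calc F * G * H * (F' * G' * H') = F * G * (H * F') * G' * H' := by simp only [mul_assoc]
    _ = s • (F * (G * F') * (H * G') * H') := by
      rw [h2]; simp only [mul_smul_comm, smul_mul_assoc, mul_assoc]
    _ = _ := by
      rw [h1, h3]; simp only [mul_smul_comm, smul_mul_assoc, mul_assoc, smul_smul]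

/-- This restores the order of the three letters after taking an adjoint, so that the span of the
words is stable under adjoints. -/
theorem star_words {R : Type*} [Ring R] [Algebra ℂ R] {F G H : R} {r s t : ℂ}
    (h1 : G * F = r • (F * G)) (h2 : H * F = s • (F * H)) (h3 : H * G = t • (G * H)) :
    H * (G * F) = (r * s * t) • (F * G * H) := by
  rw [h1, mul_smul_comm, ← mul_assoc, h2, smul_mul_assoc, mul_assoc, h3, mul_smul_comm, smul_smul,
    smul_smul, ← mul_assoc]

/-- The *-algebra spanned by the products of three homogeneous elements. -/
def alg : StarSubalgebra ℂ D where
  carrier := Submodule.span ℂ T.words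
  zero_mem' := Submodule.zero_mem _
  add_mem' := Submodule.add_mem _
  one_mem' := Submodule.subset_span ⟨0, 1, 0, 1, 0, 1, CircleAction.isHomogeneous_one,
    CircleAction.isHomogeneous_one, CircleAction.isHomogeneous_one, by simp⟩
  algebraMap_mem' c := by
    rw [Algebra.algebraMap_eq_smul_one]
    exact Submodule.smul_mem _ c (Submodule.subset_span ⟨0, 1, 0, 1, 0, 1,
      CircleAction.isHomogeneous_one, CircleAction.isHomogeneous_one,
      CircleAction.isHomogeneous_one, by simp⟩)
  mul_mem' := by
    intro y z hy hz
    have h : Submodule.span ℂ T.words * Submodule.span ℂ T.words ≤ Submodule.span ℂ T.words := by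
      rw [Submodule.span_mul_span, Submodule.span_le]
      rintro _ ⟨_, ⟨n, a, m, b, k, x, ha, hb, hx, rfl⟩, _, ⟨n', a', m', b', k', x', ha', hb', hx',
        rfl⟩, rfl⟩
      change T.f a * T.g b * T.h x * (T.f a' * T.g b' * T.h x') ∈ Submodule.span ℂ T.words
      rw [mul_words (T.gf ha' hb) (T.hf ha' hx) (T.hg hb' hx), ← map_mul, ← map_mul, ← map_mul]
      exact Submodule.smul_mem _ _ (Submodule.subset_span
        ⟨_, _, _, _, _, _, ha.mul ha', hb.mul hb', hx.mul hx', rfl⟩)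
    exact h (Submodule.mul_mem_mul hy hz)
  star_mem' := by
    intro y hy
    change y ∈ Submodule.span ℂ T.words at hy
    change star y ∈ Submodule.span ℂ T.words
    induction hy using Submodule.span_induction with
    | mem y hy =>
      obtain ⟨n, a, m, b, k, x, ha, hb, hx, rfl⟩ := hy
      rw [star_mul, star_mul, ← map_star, ← map_star, ← map_star,
        star_words (T.gf ha.star hb.star) (T.hf ha.star hx.star) (T.hg hb.star hx.star)]
      exact Submodule.smul_mem _ _ (Submodule.subset_span
        ⟨_, _, _, _, _, _, ha.star, hb.star, hx.star, rfl⟩)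
    | zero => rw [star_zero]; exact Submodule.zero_mem _
    | add y z _ _ hy hz => rw [star_add]; exact Submodule.add_mem _ hy hz
    | smul c y _ hy => rw [star_smul]; exact Submodule.smul_mem _ _ hy

theorem word_mem {n m k : ℤ} {a : A} {b : B} {x : X} (ha : ρ.IsHomogeneous n a)
    (hb : σ.IsHomogeneous m b) (hx : τ.IsHomogeneous k x) :
    T.f a * T.g b * T.h x ∈ T.alg.topologicalClosure :=
  T.alg.le_topologicalClosure (Submodule.subset_span ⟨n, a, m, b, k, x, ha, hb, hx, rfl⟩)

theorem mem_of_homogeneous {E : Type} [CStarAlgebra E] (κ : CircleAction E) {N : StarSubalgebra ℂ D}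
    (hN : IsClosed (N : Set D)) (j : E →⋆ₐ[ℂ] D) (h : ∀ n e, κ.IsHomogeneous n e → j e ∈ N) (e : E) :
    j e ∈ N :=
  κ.induction_homogeneous (P := fun e => j e ∈ N) (hN.preimage (continuous_hom j))
    (by rw [map_zero]; exact zero_mem N) (fun x y hx hy => by rw [map_add]; exact add_mem hx hy)
    (fun c x hx => by rw [map_smul]; exact SMulMemClass.smul_mem c hx) h e

theorem f_mem (a : A) : T.f a ∈ T.alg.topologicalClosure :=
  mem_of_homogeneous ρ T.alg.isClosed_topologicalClosure T.f (fun n a ha => by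
    simpa using T.word_mem ha (b := 1) (x := 1) CircleAction.isHomogeneous_one
      CircleAction.isHomogeneous_one) a

theorem g_mem (b : B) : T.g b ∈ T.alg.topologicalClosure :=
  mem_of_homogeneous σ T.alg.isClosed_topologicalClosure T.g (fun n b hb => by
    simpa using T.word_mem (a := 1) (x := 1) CircleAction.isHomogeneous_one hb
      CircleAction.isHomogeneous_one) b

theorem h_mem (x : X) : T.h x ∈ T.alg.topologicalClosure :=
  mem_of_homogeneous τ T.alg.isClosed_topologicalClosure T.h (fun n x hx => by
    simpa using T.word_mem (a := 1) (b := 1) CircleAction.isHomogeneous_one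
      CircleAction.isHomogeneous_one hx) x

/-- A closed linear condition holds on the closed *-algebra generated by the three images if it holds
for products of homogeneous elements. -/
theorem le_of_words {N : Submodule ℂ D} (hN : IsClosed (N : Set D)) (h : T.words ⊆ N) {y : D}
    (hy : y ∈ T.alg.topologicalClosure) : y ∈ N :=
  Submodule.topologicalClosure_minimal (Submodule.span ℂ T.words) (Submodule.span_le.mpr h) hN hy

/-- The pair of two triples. -/
def prod {D' : Type} [CStarAlgebra D'] (T' : BraidTriple ζ ρ σ τ D') :
    BraidTriple ζ ρ σ τ (D × D') where
  f := T.f.prod T'.f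
  g := T.g.prod T'.g
  h := T.h.prod T'.h
  gf ha hb := Prod.ext (T.gf ha hb) (T'.gf ha hb)
  hf ha hb := Prod.ext (T.hf ha hb) (T'.hf ha hb)
  hg ha hb := Prod.ext (T.hg ha hb) (T'.hg ha hb)

end BraidTriple

/-! ### Product functionals and the comparison of the two triple products -/

namespace Braided

variable (ζ : Circle) (ρ : CircleAction A) (σ : CircleAction B) (τ : CircleAction X)

variable {ρ σ} in
theorem isHomogeneous_j₁ {n : ℤ} {a : A} (ha : ρ.IsHomogeneous n a) :
    (action ζ ρ σ).IsHomogeneous n (j₁ ζ ρ σ a) := fun z => by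
  change actionHom ζ ρ σ z _ = _
  rw [actionHom_j₁, ha, map_smul]

variable {ρ σ} in
theorem isHomogeneous_j₂ {n : ℤ} {b : B} (hb : σ.IsHomogeneous n b) :
    (action ζ ρ σ).IsHomogeneous n (j₂ ζ ρ σ b) := fun z => by
  change actionHom ζ ρ σ z _ = _
  rw [actionHom_j₂, hb, map_smul]

/-- The three factors of `(A ⊠ B) ⊠ X`. -/
def tripleL : BraidTriple ζ ρ σ τ (Braided ζ (action ζ ρ σ) τ) where
  f := (j₁ ζ (action ζ ρ σ) τ).comp (j₁ ζ ρ σ)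
  g := (j₁ ζ (action ζ ρ σ) τ).comp (j₂ ζ ρ σ)
  h := j₂ ζ (action ζ ρ σ) τ
  gf ha hb := by
    rw [StarAlgHom.comp_apply, StarAlgHom.comp_apply, ← map_mul, ← map_mul, j₂_mul_j₁ ha hb,
      map_smul]
  hf ha hx := j₂_mul_j₁ (isHomogeneous_j₁ ζ ha) hx
  hg hb hx := j₂_mul_j₁ (isHomogeneous_j₂ ζ hb) hx

/-- The three factors of `A ⊠ (B ⊠ X)`. -/
def tripleR : BraidTriple ζ ρ σ τ (Braided ζ ρ (action ζ σ τ)) where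
  f := j₁ ζ ρ (action ζ σ τ)
  g := (j₂ ζ ρ (action ζ σ τ)).comp (j₁ ζ σ τ)
  h := (j₂ ζ ρ (action ζ σ τ)).comp (j₂ ζ σ τ)
  gf ha hb := j₂_mul_j₁ ha (isHomogeneous_j₁ ζ hb)
  hf ha hx := j₂_mul_j₁ ha (isHomogeneous_j₂ ζ hx)
  hg hb hx := by
    rw [StarAlgHom.comp_apply, StarAlgHom.comp_apply, ← map_mul, ← map_mul, j₂_mul_j₁ hb hx,
      map_smul]

/-- The restriction of `φ ⊗ α ⊗ β` to `A ⊠ B`. -/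
def prodFun (φ : QTorus ζ →L[ℂ] ℂ) (α : A →L[ℂ] ℂ) (β : B →L[ℂ] ℂ) : Braided ζ ρ σ →L[ℂ] ℂ :=
  (MinTensor.prodFun (MinTensor.prodFun φ α) β).comp
    ⟨(incl ζ ρ σ).toAlgHom.toLinearMap, continuous_hom (incl ζ ρ σ)⟩

theorem prodFun_eq (φ : QTorus ζ →L[ℂ] ℂ) (α : A →L[ℂ] ℂ) (β : B →L[ℂ] ℂ) (y : Braided ζ ρ σ) :
    prodFun ζ ρ σ φ α β y = MinTensor.prodFun (MinTensor.prodFun φ α) β (incl ζ ρ σ y) := rfl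

/-- The element `uⁿ vᵐ` of the quantum torus. -/
def uv (n m : ℤ) : QTorus ζ :=
  ((QTorus.u ζ ^ n : unitary _) : QTorus ζ) * ((QTorus.v ζ ^ m : unitary _) : QTorus ζ)

variable {ρ σ τ}

/-- In the ambient algebra the leg of `A` commutes with the torus leg, so the product is the
elementary tensor `uⁿvᵐ ⊗ a ⊗ b`. -/
theorem prodFun_apply (φ : QTorus ζ →L[ℂ] ℂ) (α : A →L[ℂ] ℂ) (β : B →L[ℂ] ℂ) {n m : ℤ} {a : A}
    {b : B} (ha : ρ.IsHomogeneous n a) (hb : σ.IsHomogeneous m b) :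
    prodFun ζ ρ σ φ α β (j₁ ζ ρ σ a * j₂ ζ ρ σ b) = φ (uv ζ n m) * α a * β b := by
  have h : incl ζ ρ σ (j₁ ζ ρ σ a * j₂ ζ ρ σ b) =
      MinTensor.ofAlg (MinTensor.ofAlg (uv ζ n m ⊗ₜ a) ⊗ₜ b) := by
    rw [map_mul, incl_j₁, incl_j₂, amb₁_apply ha, amb₂_apply hb, coe_ambU_zpow, coe_ambV_zpow,
      mul_assoc, ← mul_assoc (ambA ζ A B a), ← (commute_ambT_ambA _ a).eq, ← mul_assoc,
      ← mul_assoc, ← map_mul, ← MinTensor.inl_mul_inr, ← MinTensor.inl_mul_inr,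
      map_mul (MinTensor.inl (MinTensor (QTorus ζ) A) B)]
    rfl
  rw [prodFun_eq, h, MinTensor.prodFun_tmul, MinTensor.prodFun_tmul]

/-- The ambient algebra is an iterated minimal tensor product: separation is applied to its outer
factor and then to the inner one, where all functionals of the torus are allowed. -/
theorem eq_zero_of_prodFun {S : Set (A →L[ℂ] ℂ)} {T : Set (B →L[ℂ] ℂ)}
    (hS : ∀ a, (∀ φ ∈ S, φ a = 0) → a = 0) (hT : ∀ b, (∀ ψ ∈ T, ψ b = 0) → b = 0)
    {y : Braided ζ ρ σ} (hy : ∀ φ, ∀ α ∈ S, ∀ β ∈ T, prodFun ζ ρ σ φ α β y = 0) : y = 0 := by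
  refine incl_injective ζ ρ σ ?_
  rw [map_zero]
  refine MinTensor.eq_zero_of_prodFun
    (S := {ψ | ∃ φ, ∃ α ∈ S, ψ = MinTensor.prodFun φ α}) (T := T) (fun x hx => ?_) hT ?_
  · refine MinTensor.eq_zero_of_prodFun (S := Set.univ) (T := S) (fun t ht => ?_) hS ?_
    · exact (SeparatingDual.eq_zero_iff_forall_dual_eq_zero (R := ℂ) t).mpr fun φ => ht φ trivial
    · exact fun φ _ α hα => hx _ ⟨φ, α, hα, rfl⟩
  · rintro _ ⟨φ, α, hα, rfl⟩ β hβ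
    exact hy φ α hα β hβ

/-- If `A ⊠ B ≠ 0`, then some functional does not vanish at `uⁿ vᵐ`. -/
theorem exists_fun_uv_ne_zero {y : Braided ζ ρ σ} (hy : y ≠ 0) (n m : ℤ) :
    ∃ φ : QTorus ζ →L[ℂ] ℂ, φ (uv ζ n m) ≠ 0 := by
  refine SeparatingDual.exists_ne_zero (R := ℂ) fun h => hy ?_
  -- The element `uⁿvᵐ` is unitary, so if it were zero the torus algebra would be trivial. The
  -- ambient algebra would then be trivial too, contradicting `y ≠ 0`; the nontriviality of the
  -- torus algebra is not needed beforehand.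
  have h1 : (1 : QTorus ζ) = 0 := by
    have h2 := (Unitary.mem_iff.mp (QTorus.u ζ ^ n * QTorus.v ζ ^ m : unitary (QTorus ζ)).2).1
    rw [← h2]
    change star (uv ζ n m) * uv ζ n m = 0
    rw [h, mul_zero]
  refine incl_injective ζ ρ σ ?_
  rw [map_zero, ← one_mul (incl ζ ρ σ y), ← map_one (ambT ζ A B), h1, map_zero, zero_mul]

variable (ρ σ τ)

theorem dense_tripleL {N : StarSubalgebra ℂ (Braided ζ (action ζ ρ σ) τ)}
    (hN : IsClosed (N : Set (Braided ζ (action ζ ρ σ) τ)))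
    (hf : ∀ a, (tripleL ζ ρ σ τ).f a ∈ N) (hg : ∀ b, (tripleL ζ ρ σ τ).g b ∈ N)
    (hh : ∀ x, (tripleL ζ ρ σ τ).h x ∈ N) (y : Braided ζ (action ζ ρ σ) τ) : y ∈ N :=
  mem_of_gen hN (StarAlgHom.id ℂ _) (fun c => mem_of_gen hN (j₁ ζ (action ζ ρ σ) τ) hf hg c) hh y

theorem dense_tripleR {N : StarSubalgebra ℂ (Braided ζ ρ (action ζ σ τ))}
    (hN : IsClosed (N : Set (Braided ζ ρ (action ζ σ τ))))
    (hf : ∀ a, (tripleR ζ ρ σ τ).f a ∈ N) (hg : ∀ b, (tripleR ζ ρ σ τ).g b ∈ N)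
    (hh : ∀ x, (tripleR ζ ρ σ τ).h x ∈ N) (y : Braided ζ ρ (action ζ σ τ)) : y ∈ N :=
  mem_of_gen hN (StarAlgHom.id ℂ _) hf (fun c => mem_of_gen hN (j₂ ζ ρ (action ζ σ τ)) hg hh c) y

variable {ρ σ τ}

/-- On a word of degrees `n, m, k` the left functional gives `φ(u^{n+m}v^k) φ'(uⁿvᵐ)` times `α(a)
β(b) χ(x)`, and the right one gives `ψ(uⁿv^{m+k}) ψ'(uᵐv^k)` times the same product. Cross
multiplication makes them equal. In other degrees both sides vanish, and this is why `α`, `β`, `χ`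
must be supported in single degrees: the torus factors are then constants. Linearity and continuity
extend the identity to the closure. -/
theorem prodFun_graph {n m k : ℤ} {α : A →L[ℂ] ℂ} {β : B →L[ℂ] ℂ} {χ : X →L[ℂ] ℂ}
    (hα : ρ.HasDegree n α) (hβ : σ.HasDegree m β) (hχ : τ.HasDegree k χ)
    (φ φ' ψ ψ' : QTorus ζ →L[ℂ] ℂ)
    {y : Braided ζ (action ζ ρ σ) τ × Braided ζ ρ (action ζ σ τ)}
    (hy : y ∈ ((tripleL ζ ρ σ τ).prod (tripleR ζ ρ σ τ)).alg.topologicalClosure) :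
    (ψ (uv ζ n (m + k)) * ψ' (uv ζ m k)) *
        prodFun ζ (action ζ ρ σ) τ φ (prodFun ζ ρ σ φ' α β) χ y.1 =
      (φ (uv ζ (n + m) k) * φ' (uv ζ n m)) *
        prodFun ζ ρ (action ζ σ τ) ψ α (prodFun ζ σ τ ψ' β χ) y.2 := by
  set f₁ := ((ψ (uv ζ n (m + k)) * ψ' (uv ζ m k)) •
    prodFun ζ (action ζ ρ σ) τ φ (prodFun ζ ρ σ φ' α β) χ).comp (ContinuousLinearMap.fst ℂ
      (Braided ζ (action ζ ρ σ) τ) (Braided ζ ρ (action ζ σ τ)))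
  set f₂ := ((φ (uv ζ (n + m) k) * φ' (uv ζ n m)) •
    prodFun ζ ρ (action ζ σ τ) ψ α (prodFun ζ σ τ ψ' β χ)).comp (ContinuousLinearMap.snd ℂ
      (Braided ζ (action ζ ρ σ) τ) (Braided ζ ρ (action ζ σ τ)))
  refine BraidTriple.le_of_words _ (N := LinearMap.eqLocus f₁.toLinearMap f₂.toLinearMap)
    (isClosed_eq f₁.continuous f₂.continuous) ?_ hy
  rintro _ ⟨n', a, m', b, k', x, ha, hb, hx, rfl⟩
  change (ψ (uv ζ n (m + k)) * ψ' (uv ζ m k)) *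
      prodFun ζ (action ζ ρ σ) τ φ (prodFun ζ ρ σ φ' α β) χ
        (j₁ ζ (action ζ ρ σ) τ (j₁ ζ ρ σ a) * j₁ ζ (action ζ ρ σ) τ (j₂ ζ ρ σ b) *
          j₂ ζ (action ζ ρ σ) τ x) =
    (φ (uv ζ (n + m) k) * φ' (uv ζ n m)) *
      prodFun ζ ρ (action ζ σ τ) ψ α (prodFun ζ σ τ ψ' β χ)
        (j₁ ζ ρ (action ζ σ τ) a * j₂ ζ ρ (action ζ σ τ) (j₁ ζ σ τ b) *
          j₂ ζ ρ (action ζ σ τ) (j₂ ζ σ τ x))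
  rw [← map_mul, mul_assoc (j₁ ζ ρ (action ζ σ τ) a), ← map_mul,
    prodFun_apply ζ _ _ _ ((isHomogeneous_j₁ ζ ha).mul (isHomogeneous_j₂ ζ hb)) hx,
    prodFun_apply ζ _ _ _ ha ((isHomogeneous_j₁ ζ hb).mul (isHomogeneous_j₂ ζ hx)),
    prodFun_apply ζ _ _ _ ha hb, prodFun_apply ζ _ _ _ hb hx]
  by_cases hn : n' = n
  · by_cases hm : m' = m
    · by_cases hk : k' = k
      · subst hn hm hk
        ring
      · rw [hχ k' x hk hx]; ring
    · rw [hβ m' b hm hb]; ring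
  · rw [hα n' a hn ha]; ring

variable (ρ σ τ)

/-- The associativity of the braided tensor product. -/
theorem exists_assoc : ∃ Θ : Braided ζ (action ζ ρ σ) τ ≃⋆ₐ[ℂ] Braided ζ ρ (action ζ σ τ),
    (∀ a, Θ (j₁ ζ (action ζ ρ σ) τ (j₁ ζ ρ σ a)) = j₁ ζ ρ (action ζ σ τ) a) ∧
    (∀ b, Θ (j₁ ζ (action ζ ρ σ) τ (j₂ ζ ρ σ b)) = j₂ ζ ρ (action ζ σ τ) (j₁ ζ σ τ b)) ∧
    ∀ x, Θ (j₂ ζ (action ζ ρ σ) τ x) = j₂ ζ ρ (action ζ σ τ) (j₂ ζ σ τ x) := by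
  -- The closed *-algebra generated by this pair of triples is the graph of the isomorphism sought.
  let T := (tripleL ζ ρ σ τ).prod (tripleR ζ ρ σ τ)
  let G := T.alg.topologicalClosure
  have sepA := fun a => ρ.eq_zero_of_hasDegree (a := a)
  have sepB := fun a => σ.eq_zero_of_hasDegree (a := a)
  have sepX := fun a => τ.eq_zero_of_hasDegree (a := a)
  obtain ⟨Θ, hΘ⟩ := exists_equiv_of_graph G T.alg.isClosed_topologicalClosure
    (fun y hy h0 => by
      by_contra hne
      refine hne (eq_zero_of_prodFun ζ (S := {φ | ∃ n, ρ.HasDegree n φ})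
        (T := {φ | ∃ ψ, ∃ β ∈ {φ | ∃ n, σ.HasDegree n φ}, ∃ χ ∈ {φ | ∃ n, τ.HasDegree n φ},
          φ = prodFun ζ σ τ ψ β χ}) sepA (fun z hz => ?_) ?_)
      · exact eq_zero_of_prodFun ζ sepB sepX fun ψ β hβ χ hχ => hz _ ⟨ψ, β, hβ, χ, hχ, rfl⟩
      · rintro ψ α ⟨n, hα⟩ _ ⟨ψ', β, ⟨m, hβ⟩, χ, ⟨k, hχ⟩, rfl⟩
        -- The torus functionals on the side already known to vanish are free. They are chosen so
        -- that the coefficient in front of the other side is nonzero and can be cancelled.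
        obtain ⟨φ, hφ⟩ := exists_fun_uv_ne_zero ζ hne (n + m) k
        obtain ⟨φ', hφ'⟩ := exists_fun_uv_ne_zero ζ hne n m
        have h := prodFun_graph ζ hα hβ hχ φ φ' ψ ψ' hy
        rw [h0, map_zero, mul_zero] at h
        exact (mul_eq_zero.mp h.symm).resolve_left (mul_ne_zero hφ hφ'))
    (fun y hy h0 => by
      by_contra hne
      refine hne (eq_zero_of_prodFun ζ (S := {φ | ∃ ψ, ∃ α ∈ {φ | ∃ n, ρ.HasDegree n φ},
          ∃ β ∈ {φ | ∃ n, σ.HasDegree n φ}, φ = prodFun ζ ρ σ ψ α β})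
        (T := {φ | ∃ n, τ.HasDegree n φ}) (fun z hz => ?_) sepX ?_)
      · exact eq_zero_of_prodFun ζ sepA sepB fun ψ β hβ χ hχ => hz _ ⟨ψ, β, hβ, χ, hχ, rfl⟩
      · rintro φ _ ⟨φ', α, ⟨n, hα⟩, β, ⟨m, hβ⟩, rfl⟩ χ ⟨k, hχ⟩
        obtain ⟨ψ, hψ⟩ := exists_fun_uv_ne_zero ζ hne n (m + k)
        obtain ⟨ψ', hψ'⟩ := exists_fun_uv_ne_zero ζ hne m k
        have h := prodFun_graph ζ hα hβ hχ φ φ' ψ ψ' hy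
        rw [h0, map_zero, mul_zero] at h
        exact (mul_eq_zero.mp h).resolve_left (mul_ne_zero hψ hψ'))
    -- Each projection of the graph contains the images of all three factors, and these generate.
    (fun N hN h y => dense_tripleL ζ ρ σ τ hN (fun a => h _ (T.f_mem a)) (fun b => h _ (T.g_mem b))
      (fun x => h _ (T.h_mem x)) y)
    (fun N hN h y => dense_tripleR ζ ρ σ τ hN (fun a => h _ (T.f_mem a)) (fun b => h _ (T.g_mem b))
      (fun x => h _ (T.h_mem x)) y)
  exact ⟨Θ, fun a => hΘ _ (T.f_mem a), fun b => hΘ _ (T.g_mem b), fun x => hΘ _ (T.h_mem x)⟩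

end Braided

end Triple

end BraidedSphere

end

/-! ### Invariant quadratic forms of the three-dimensional representation -/

noncomputable section

open scoped ComplexConjugate

namespace BraidedSphere

set_option linter.unusedSimpArgs false

section Algebra

variable {R : Type*} [Ring R] [Algebra ℂ R]

/-- The commutation rules of `α`, `α⋆`, `γ`, `γ⋆` in `C(SU_q(2))`, with `p = q̄`. -/
structure SURules (q p : ℂ) (a a' c c' : R) : Prop where
  ac : a * c = p • (c * a)
  ac' : a * c' = q • (c' * a)
  a'c : a' * c = p⁻¹ • (c * a')
  a'c' : a' * c' = q⁻¹ • (c' * a')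
  cc : c' * c = c * c'
  aa' : a * a' = 1 - (q * p) • (c * c')
  a'a : a' * a = 1 - c * c'

namespace SURules

variable {q p : ℂ} {a a' c c' : R}

/-- The rules move `c`, `c'` to the left of `a`, `a'` and eliminate mixed products of `a` and `a'`.
The versions with a trailing factor let the same rewriting act inside right-associated words, so
that every expression reaches a combination of ordered monomials. -/
theorem ac_mul (H : SURules q p a a' c c') (x : R) : a * (c * x) = p • (c * (a * x)) := by
  rw [← mul_assoc, H.ac, smul_mul_assoc, mul_assoc]

theorem ac'_mul (H : SURules q p a a' c c') (x : R) : a * (c' * x) = q • (c' * (a * x)) := by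
  rw [← mul_assoc, H.ac', smul_mul_assoc, mul_assoc]

theorem a'c_mul (H : SURules q p a a' c c') (x : R) : a' * (c * x) = p⁻¹ • (c * (a' * x)) := by
  rw [← mul_assoc, H.a'c, smul_mul_assoc, mul_assoc]

theorem a'c'_mul (H : SURules q p a a' c c') (x : R) : a' * (c' * x) = q⁻¹ • (c' * (a' * x)) := by
  rw [← mul_assoc, H.a'c', smul_mul_assoc, mul_assoc]

theorem cc_mul (H : SURules q p a a' c c') (x : R) : c' * (c * x) = c * (c' * x) := by
  rw [← mul_assoc, H.cc, mul_assoc]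

theorem aa'_mul (H : SURules q p a a' c c') (x : R) : a * (a' * x) = x - (q * p) • (c * (c' * x)) := by
  rw [← mul_assoc, H.aa', sub_mul, one_mul, smul_mul_assoc, mul_assoc]

theorem a'a_mul (H : SURules q p a a' c c') (x : R) : a' * (a * x) = x - c * (c' * x) := by
  rw [← mul_assoc, H.a'a, sub_mul, one_mul, mul_assoc]

end SURules

/-- The matrix of the three-dimensional representation, in terms of `α`, `α⋆`, `γ`, `γ⋆`. -/
def vMat (q p : ℂ) (a a' c c' : R) : SignType → SignType → R
  | .neg, .neg => a * a
  | .neg, .zero => -((1 + q * p) • (c' * a))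
  | .neg, .pos => -(q • (c' * c'))
  | .zero, .neg => (q / p) • (a * c)
  | .zero, .zero => 1 - (1 + q * p) • (c' * c)
  | .zero, .pos => c' * a'
  | .pos, .neg => -((q * (q / p)) • (c * c))
  | .pos, .zero => -((1 + q * p) • (a' * c))
  | .pos, .pos => a' * a'

/-- The invariant quadratic form. -/
def formS (s : ℂ) : SignType → SignType → ℂ
  | .neg, .pos => 1
  | .zero, .zero => 1 + s
  | .pos, .neg => s
  | _, _ => 0

/-- The three quadratic forms that transform like the generators. -/
def formV (s : ℂ) : SignType → SignType → SignType → ℂ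
  | .neg, .neg, .zero => 1 + s
  | .neg, .zero, .neg => -(s * (1 + s))
  | .zero, .pos, .neg => s
  | .zero, .neg, .pos => -s
  | .zero, .zero, .zero => 1 - s ^ 2
  | .pos, .zero, .pos => 1 + s
  | .pos, .pos, .zero => -(s * (1 + s))
  | _, _, _ => 0

theorem sum_signType {M : Type*} [AddCommMonoid M] (f : SignType → M) :
    ∑ k, f k = f .neg + f .zero + f .pos := by
  have : (Finset.univ : Finset SignType) = {.neg, .zero, .pos} := by decide
  rw [this, Finset.sum_insert (by decide), Finset.sum_insert (by decide), Finset.sum_singleton,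
    add_assoc]

/-- `ζ ^ (-k (j - l))`, the factor in `e_k v_{j,l} = ζ ^ (-k (j - l)) v_{j,l} e_k`. -/
def braidFactor (q p : ℂ) (k j l : SignType) : ℂ := (q / p) ^ (-((k : ℤ) * ((j : ℤ) - (l : ℤ))))

/-- When `S` is expanded on the elements `∑ v_{i,k} e_k`, the left side is the coefficient of `e_k
e_l`; the braiding factor comes from moving `e_k` past `v_{j,l}`. The identity therefore expresses
invariance of `S` under the coaction. Each entry is checked by ordering the monomials and comparing
coefficients. -/
theorem formS_vMat {q p : ℂ} (hq : q ≠ 0) (hp : p ≠ 0) {a a' c c' : R}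
    (H : SURules q p a a' c c') (k l : SignType) :
    ∑ i, ∑ j, (formS (q * p) i j * braidFactor q p k j l) •
      (vMat q p a a' c c' i k * vMat q p a a' c c' j l) = formS (q * p) k l • 1 := by
  simp only [sum_signType, formS, zero_mul, zero_smul, add_zero, zero_add, one_mul]
  rcases k <;> rcases l <;>
    simp only [vMat, braidFactor, SignType.neg_eq_neg_one, SignType.zero_eq_zero,
      SignType.pos_eq_one, SignType.coe_neg_one, SignType.coe_zero, SignType.coe_one,
      mul_assoc, mul_add, add_mul, mul_sub, sub_mul, mul_neg,
      neg_mul, mul_one, one_mul, mul_smul_comm, smul_mul_assoc, smul_sub, smul_add, smul_neg,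
      smul_smul, H.ac, H.ac', H.a'c, H.a'c', H.cc, H.aa', H.a'a, H.ac_mul, H.ac'_mul, H.a'c_mul,
      H.a'c'_mul, H.cc_mul, H.aa'_mul, H.a'a_mul] <;>
    match_scalars <;> (norm_num <;> field_simp <;> ring)

-- The same expansion for the three forms `V_f`. The value is now a combination of row `f` of the
-- matrix itself, so the forms transform like the generators. This covariance lets `λ e_f` appear on
-- the right of a relation.
set_option maxHeartbeats 2000000 in
theorem formV_vMat {q p : ℂ} (hq : q ≠ 0) (hp : p ≠ 0) {a a' c c' : R}
    (H : SURules q p a a' c c') (f k l : SignType) :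
    ∑ i, ∑ j, (formV (q * p) f i j * braidFactor q p k j l) •
      (vMat q p a a' c c' i k * vMat q p a a' c c' j l) =
        ∑ m, formV (q * p) m k l • vMat q p a a' c c' f m := by
  rcases f <;> rcases k <;> rcases l <;>
    simp only [sum_signType, formV, zero_mul, zero_smul, add_zero, zero_add,
      vMat, braidFactor, SignType.neg_eq_neg_one, SignType.zero_eq_zero,
      SignType.pos_eq_one, SignType.coe_neg_one, SignType.coe_zero, SignType.coe_one,
      mul_assoc, mul_add, add_mul, mul_sub, sub_mul, mul_neg,
      neg_mul, mul_one, one_mul, mul_smul_comm, smul_mul_assoc, smul_sub, smul_add, smul_neg,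
      smul_smul, H.ac, H.ac', H.a'c, H.a'c', H.cc, H.aa', H.a'a, H.ac_mul, H.ac'_mul, H.a'c_mul,
      H.a'c'_mul, H.cc_mul, H.aa'_mul, H.a'a_mul] <;>
    match_scalars <;> (norm_num <;> field_simp <;> ring)

/-! ### Identities behind the comultiplication -/

/-- The commutation rules of the second copy `b, b', d, d'` with the first copy `a, a', c, c'`. -/
structure BraidRules (q p : ℂ) (a a' c c' b b' d d' : R) : Prop where
  ba : b * a = a * b
  ba' : b * a' = a' * b
  bc : b * c = c * b
  bc' : b * c' = c' * b
  b'a : b' * a = a * b'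
  b'a' : b' * a' = a' * b'
  b'c : b' * c = c * b'
  b'c' : b' * c' = c' * b'
  da : d * a = a * d
  da' : d * a' = a' * d
  dc : d * c = (p / q) • (c * d)
  dc' : d * c' = (q / p) • (c' * d)
  d'a : d' * a = a * d'
  d'a' : d' * a' = a' * d'
  d'c : d' * c = (q / p) • (c * d')
  d'c' : d' * c' = (p / q) • (c' * d')

namespace BraidRules

variable {q p : ℂ} {a a' c c' b b' d d' : R}

theorem ba_mul (K : BraidRules q p a a' c c' b b' d d') (x : R) :
    b * (a * x) = a * (b * x) := by
  rw [← mul_assoc, K.ba, mul_assoc]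

theorem ba'_mul (K : BraidRules q p a a' c c' b b' d d') (x : R) :
    b * (a' * x) = a' * (b * x) := by
  rw [← mul_assoc, K.ba', mul_assoc]

theorem bc_mul (K : BraidRules q p a a' c c' b b' d d') (x : R) :
    b * (c * x) = c * (b * x) := by
  rw [← mul_assoc, K.bc, mul_assoc]

theorem bc'_mul (K : BraidRules q p a a' c c' b b' d d') (x : R) :
    b * (c' * x) = c' * (b * x) := by
  rw [← mul_assoc, K.bc', mul_assoc]

theorem b'a_mul (K : BraidRules q p a a' c c' b b' d d') (x : R) :
    b' * (a * x) = a * (b' * x) := by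
  rw [← mul_assoc, K.b'a, mul_assoc]

theorem b'a'_mul (K : BraidRules q p a a' c c' b b' d d') (x : R) :
    b' * (a' * x) = a' * (b' * x) := by
  rw [← mul_assoc, K.b'a', mul_assoc]

theorem b'c_mul (K : BraidRules q p a a' c c' b b' d d') (x : R) :
    b' * (c * x) = c * (b' * x) := by
  rw [← mul_assoc, K.b'c, mul_assoc]

theorem b'c'_mul (K : BraidRules q p a a' c c' b b' d d') (x : R) :
    b' * (c' * x) = c' * (b' * x) := by
  rw [← mul_assoc, K.b'c', mul_assoc]

theorem da_mul (K : BraidRules q p a a' c c' b b' d d') (x : R) :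
    d * (a * x) = a * (d * x) := by
  rw [← mul_assoc, K.da, mul_assoc]

theorem da'_mul (K : BraidRules q p a a' c c' b b' d d') (x : R) :
    d * (a' * x) = a' * (d * x) := by
  rw [← mul_assoc, K.da', mul_assoc]

theorem dc_mul (K : BraidRules q p a a' c c' b b' d d') (x : R) :
    d * (c * x) = (p / q) • (c * (d * x)) := by
  rw [← mul_assoc, K.dc, smul_mul_assoc, mul_assoc]

theorem dc'_mul (K : BraidRules q p a a' c c' b b' d d') (x : R) :
    d * (c' * x) = (q / p) • (c' * (d * x)) := by
  rw [← mul_assoc, K.dc', smul_mul_assoc, mul_assoc]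

theorem d'a_mul (K : BraidRules q p a a' c c' b b' d d') (x : R) :
    d' * (a * x) = a * (d' * x) := by
  rw [← mul_assoc, K.d'a, mul_assoc]

theorem d'a'_mul (K : BraidRules q p a a' c c' b b' d d') (x : R) :
    d' * (a' * x) = a' * (d' * x) := by
  rw [← mul_assoc, K.d'a', mul_assoc]

theorem d'c_mul (K : BraidRules q p a a' c c' b b' d d') (x : R) :
    d' * (c * x) = (q / p) • (c * (d' * x)) := by
  rw [← mul_assoc, K.d'c, smul_mul_assoc, mul_assoc]

theorem d'c'_mul (K : BraidRules q p a a' c c' b b' d d') (x : R) :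
    d' * (c' * x) = (p / q) • (c' * (d' * x)) := by
  rw [← mul_assoc, K.d'c', smul_mul_assoc, mul_assoc]

end BraidRules

/-- This lemma and the next three are the defining relations of `SU_q(2)` for `Δ(α)` and `Δ(γ)`. The
adjoints have their factors in reversed order, second copy first. Ordering moves the first copy to
the left by the braid rules and then orders each copy separately. -/
theorem comul_a'a {q p : ℂ} (hq : q ≠ 0) (hp : p ≠ 0) {a a' c c' b b' d d' : R}
    (H : SURules q p a a' c c') (H' : SURules q p b b' d d')
    (K : BraidRules q p a a' c c' b b' d d') :
    (b' * a' - p • (d' * c)) * (a * b - q • (c' * d)) + (b' * c' + d' * a) * (c * b + a' * d) = 1 := by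
  simp only [mul_assoc, mul_add, add_mul, mul_sub, sub_mul, mul_neg, neg_mul, mul_one, one_mul,
      mul_smul_comm, smul_mul_assoc, smul_sub, smul_add, smul_neg, smul_smul, H.ac, H.ac',
      H.a'c, H.a'c', H.cc, H.aa', H.a'a, H.ac_mul, H.ac'_mul, H.a'c_mul, H.a'c'_mul,
      H.cc_mul, H.aa'_mul, H.a'a_mul, H'.ac, H'.ac', H'.a'c, H'.a'c', H'.cc, H'.aa', H'.a'a,
      H'.ac_mul, H'.ac'_mul, H'.a'c_mul, H'.a'c'_mul, H'.cc_mul, H'.aa'_mul, H'.a'a_mul,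
      K.ba, K.ba_mul, K.ba', K.ba'_mul, K.bc, K.bc_mul, K.bc', K.bc'_mul, K.b'a, K.b'a_mul,
      K.b'a', K.b'a'_mul, K.b'c, K.b'c_mul, K.b'c', K.b'c'_mul, K.da, K.da_mul, K.da',
      K.da'_mul, K.dc, K.dc_mul, K.dc', K.dc'_mul, K.d'a, K.d'a_mul, K.d'a', K.d'a'_mul,
      K.d'c, K.d'c_mul, K.d'c', K.d'c'_mul]
  match_scalars <;> (first | ring1 | (field_simp; done) | (field_simp; ring1))

theorem comul_aa' {q p : ℂ} (hp : p ≠ 0) {a a' c c' b b' d d' : R}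
    (H : SURules q p a a' c c') (H' : SURules q p b b' d d')
    (K : BraidRules q p a a' c c' b b' d d') :
    (a * b - q • (c' * d)) * (b' * a' - p • (d' * c)) +
      (q * p) • ((b' * c' + d' * a) * (c * b + a' * d)) = 1 := by
  simp only [mul_assoc, mul_add, add_mul, mul_sub, sub_mul, mul_neg, neg_mul, mul_one, one_mul,
      mul_smul_comm, smul_mul_assoc, smul_sub, smul_add, smul_neg, smul_smul, H.ac, H.ac',
      H.a'c, H.a'c', H.cc, H.aa', H.a'a, H.ac_mul, H.ac'_mul, H.a'c_mul, H.a'c'_mul,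
      H.cc_mul, H.aa'_mul, H.a'a_mul, H'.ac, H'.ac', H'.a'c, H'.a'c', H'.cc, H'.aa', H'.a'a,
      H'.ac_mul, H'.ac'_mul, H'.a'c_mul, H'.a'c'_mul, H'.cc_mul, H'.aa'_mul, H'.a'a_mul,
      K.ba, K.ba_mul, K.ba', K.ba'_mul, K.bc, K.bc_mul, K.bc', K.bc'_mul, K.b'a, K.b'a_mul,
      K.b'a', K.b'a'_mul, K.b'c, K.b'c_mul, K.b'c', K.b'c'_mul, K.da, K.da_mul, K.da',
      K.da'_mul, K.dc, K.dc_mul, K.dc', K.dc'_mul, K.d'a, K.d'a_mul, K.d'a', K.d'a'_mul,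
      K.d'c, K.d'c_mul, K.d'c', K.d'c'_mul]
  match_scalars <;> (first | ring1 | (field_simp; done) | (field_simp; ring1))

theorem comul_ac {q p : ℂ} (hq : q ≠ 0) (hp : p ≠ 0) {a a' c c' b b' d d' : R}
    (H : SURules q p a a' c c') (H' : SURules q p b b' d d')
    (K : BraidRules q p a a' c c' b b' d d') :
    (a * b - q • (c' * d)) * (c * b + a' * d) = p • ((c * b + a' * d) * (a * b - q • (c' * d))) := by
  simp only [mul_assoc, mul_add, add_mul, mul_sub, sub_mul, mul_neg, neg_mul, mul_one, one_mul,
      mul_smul_comm, smul_mul_assoc, smul_sub, smul_add, smul_neg, smul_smul, H.ac, H.ac',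
      H.a'c, H.a'c', H.cc, H.aa', H.a'a, H.ac_mul, H.ac'_mul, H.a'c_mul, H.a'c'_mul,
      H.cc_mul, H.aa'_mul, H.a'a_mul, H'.ac, H'.ac', H'.a'c, H'.a'c', H'.cc, H'.aa', H'.a'a,
      H'.ac_mul, H'.ac'_mul, H'.a'c_mul, H'.a'c'_mul, H'.cc_mul, H'.aa'_mul, H'.a'a_mul,
      K.ba, K.ba_mul, K.ba', K.ba'_mul, K.bc, K.bc_mul, K.bc', K.bc'_mul, K.b'a, K.b'a_mul,
      K.b'a', K.b'a'_mul, K.b'c, K.b'c_mul, K.b'c', K.b'c'_mul, K.da, K.da_mul, K.da',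
      K.da'_mul, K.dc, K.dc_mul, K.dc', K.dc'_mul, K.d'a, K.d'a_mul, K.d'a', K.d'a'_mul,
      K.d'c, K.d'c_mul, K.d'c', K.d'c'_mul]
  match_scalars <;> (first | ring1 | (field_simp; done) | (field_simp; ring1))

theorem comul_cc' {q p : ℂ} (hq : q ≠ 0) (hp : p ≠ 0) {a a' c c' b b' d d' : R}
    (H : SURules q p a a' c c') (H' : SURules q p b b' d d')
    (K : BraidRules q p a a' c c' b b' d d') :
    (c * b + a' * d) * (b' * c' + d' * a) = (b' * c' + d' * a) * (c * b + a' * d) := by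
  simp only [mul_assoc, mul_add, add_mul, mul_sub, sub_mul, mul_neg, neg_mul, mul_one, one_mul,
      mul_smul_comm, smul_mul_assoc, smul_sub, smul_add, smul_neg, smul_smul, H.ac, H.ac',
      H.a'c, H.a'c', H.cc, H.aa', H.a'a, H.ac_mul, H.ac'_mul, H.a'c_mul, H.a'c'_mul,
      H.cc_mul, H.aa'_mul, H.a'a_mul, H'.ac, H'.ac', H'.a'c, H'.a'c', H'.cc, H'.aa', H'.a'a,
      H'.ac_mul, H'.ac'_mul, H'.a'c_mul, H'.a'c'_mul, H'.cc_mul, H'.aa'_mul, H'.a'a_mul,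
      K.ba, K.ba_mul, K.ba', K.ba'_mul, K.bc, K.bc_mul, K.bc', K.bc'_mul, K.b'a, K.b'a_mul,
      K.b'a', K.b'a'_mul, K.b'c, K.b'c_mul, K.b'c', K.b'c'_mul, K.da, K.da_mul, K.da',
      K.da'_mul, K.dc, K.dc_mul, K.dc', K.dc'_mul, K.d'a, K.d'a_mul, K.d'a', K.d'a'_mul,
      K.d'c, K.d'c_mul, K.d'c', K.d'c'_mul]
  match_scalars <;> (first | ring1 | field_simp)

-- The matrix is a corepresentation: applying `Δ` to its entries is the matrix product of its two
-- copies. Coassociativity of the coaction needs nothing else about `Δ`.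
set_option maxHeartbeats 2000000 in
theorem comul_vMat {q p : ℂ} (hq : q ≠ 0) (hp : p ≠ 0) {a a' c c' b b' d d' : R}
    (H : SURules q p a a' c c') (H' : SURules q p b b' d d')
    (K : BraidRules q p a a' c c' b b' d d') (i l : SignType) :
    vMat q p (a * b - q • (c' * d)) (b' * a' - p • (d' * c))
      (c * b + a' * d) (b' * c' + d' * a) i l =
        ∑ k, vMat q p a a' c c' i k * vMat q p b b' d d' k l := by
  rcases i <;> rcases l <;> simp only [sum_signType, vMat,
      mul_assoc, mul_add, add_mul, mul_sub, sub_mul, mul_neg, neg_mul, mul_one, one_mul,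
      mul_smul_comm, smul_mul_assoc, smul_sub, smul_add, smul_neg, smul_smul, H.ac, H.ac',
      H.a'c, H.a'c', H.cc, H.aa', H.a'a, H.ac_mul, H.ac'_mul, H.a'c_mul, H.a'c'_mul,
      H.cc_mul, H.aa'_mul, H.a'a_mul, H'.ac, H'.ac', H'.a'c, H'.a'c', H'.cc, H'.aa', H'.a'a,
      H'.ac_mul, H'.ac'_mul, H'.a'c_mul, H'.a'c'_mul, H'.cc_mul, H'.aa'_mul, H'.a'a_mul,
      K.ba, K.ba_mul, K.ba', K.ba'_mul, K.bc, K.bc_mul, K.bc', K.bc'_mul, K.b'a, K.b'a_mul,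
      K.b'a', K.b'a'_mul, K.b'c, K.b'c_mul, K.b'c', K.b'c'_mul, K.da, K.da_mul, K.da',
      K.da'_mul, K.dc, K.dc_mul, K.dc', K.dc'_mul, K.d'a, K.d'a_mul, K.d'a', K.d'a'_mul,
      K.d'c, K.d'c_mul, K.d'c', K.d'c'_mul] <;>
    match_scalars <;> (first | ring1 | (field_simp; done) | (field_simp; ring1))

end Algebra

end BraidedSphere

end

/-! ### Homogeneity and transport of relations -/

noncomputable section

open scoped ComplexConjugate

namespace BraidedSphere

universe u v

namespace CircleAction

variable {A : Type u} [CStarAlgebra A] {ρ : CircleAction A} {n : ℤ} {a b : A}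

theorem IsHomogeneous.add (ha : ρ.IsHomogeneous n a) (hb : ρ.IsHomogeneous n b) :
    ρ.IsHomogeneous n (a + b) := fun z => by rw [map_add, ha, hb, smul_add]

theorem IsHomogeneous.sub (ha : ρ.IsHomogeneous n a) (hb : ρ.IsHomogeneous n b) :
    ρ.IsHomogeneous n (a - b) := fun z => by rw [map_sub, ha, hb, smul_sub]

theorem IsHomogeneous.neg (ha : ρ.IsHomogeneous n a) : ρ.IsHomogeneous n (-a) := fun z => by
  rw [map_neg, ha, smul_neg]

theorem IsHomogeneous.smul (c : ℂ) (ha : ρ.IsHomogeneous n a) : ρ.IsHomogeneous n (c • a) :=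
  fun z => by rw [map_smul, ha, smul_comm]

theorem IsHomogeneous.sum {ι : Type*} {s : Finset ι} {f : ι → A}
    (h : ∀ i ∈ s, ρ.IsHomogeneous n (f i)) : ρ.IsHomogeneous n (∑ i ∈ s, f i) := fun z => by
  rw [map_sum, Finset.smul_sum]
  exact Finset.sum_congr rfl fun i hi => h i hi z

theorem IsHomogeneous.congr {m : ℤ} (ha : ρ.IsHomogeneous m a) (h : m = n) :
    ρ.IsHomogeneous n a := h ▸ ha

end CircleAction

namespace UnivCStar

variable {ι : Type u} {R : Set (FreeStarAlgebra ι)} {h : Admissible R}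

variable (R h) in
theorem eval_gen_eq_zero : ∀ r ∈ R, FreeStarAlgebra.eval (gen R h) r = 0 := fun r hr => by
  rw [← mk_eq_zero (h := h) hr]
  exact FreeStarAlgebra.hom_ext (fun i => FreeStarAlgebra.eval_gen _ i) r

/-- A *-homomorphism on a universal C*-algebra is equivariant if it preserves the degrees of the
generators. -/
theorem equivariant_of_gen {B : Type v} [CStarAlgebra B] {ρ : CircleAction (UnivCStar R h)}
    {τ : CircleAction B} {f : UnivCStar R h →⋆ₐ[ℂ] B} (d : ι → ℤ)
    (hρ : ∀ i, ρ.IsHomogeneous (d i) (gen R h i))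
    (hf : ∀ i, τ.IsHomogeneous (d i) (f (gen R h i))) : CircleAction.Equivariant ρ τ f := by
  intro z a
  refine DFunLike.congr_fun (f := f.comp (ρ z)) (g := (τ z).comp f) (hom_ext fun i => ?_) a
  rw [StarAlgHom.comp_apply, StarAlgHom.comp_apply, hρ, map_smul, hf]

end UnivCStar

theorem coe_norm_sq (q : ℂ) : ((‖q‖ ^ 2 : ℝ) : ℂ) = q * conj q := by
  rw [Complex.mul_conj, Complex.normSq_eq_norm_sq]

theorem coe_vsig (q : ℂ) : (vsig q : ℂ) = q * conj q := coe_norm_sq q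

theorem coe_sig_sq (q : ℂ) : ((sig q ^ 2 : ℝ) : ℂ) = 1 + q * conj q := by
  rw [sig_sq, Complex.ofReal_add, coe_norm_sq, Complex.ofReal_one]

section Maps

variable {R S : Type*} [Ring R] [Algebra ℂ R] [Ring S] [Algebra ℂ S] {q p : ℂ} {a a' c c' : R}

/-- Adjoints are independent letters in the rules, so an algebra homomorphism transports them. -/
theorem SURules.map (H : SURules q p a a' c c') (f : R →ₐ[ℂ] S) :
    SURules q p (f a) (f a') (f c) (f c') where
  ac := by rw [← map_mul, H.ac, map_smul, map_mul]
  ac' := by rw [← map_mul, H.ac', map_smul, map_mul]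
  a'c := by rw [← map_mul, H.a'c, map_smul, map_mul]
  a'c' := by rw [← map_mul, H.a'c', map_smul, map_mul]
  cc := by rw [← map_mul, H.cc, map_mul]
  aa' := by rw [← map_mul, H.aa', map_sub, map_smul, map_mul, map_one]
  a'a := by rw [← map_mul, H.a'a, map_sub, map_mul, map_one]

theorem map_vMat (f : R →ₐ[ℂ] S) (i k : SignType) :
    f (vMat q p a a' c c' i k) = vMat q p (f a) (f a') (f c) (f c') i k := by
  rcases i <;> rcases k <;> simp only [vMat, map_neg, map_sub, map_smul, map_mul, map_one]

end Maps

/-! ### The quantum group `SU_q(2)` and its comultiplication -/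

namespace CSU

variable {q : ℂ}

theorem V_eq (i k : SignType) :
    V q i k = vMat q (conj q) (α q) (star (α q)) (γ q) (star (γ q)) i k := by
  rcases i <;> rcases k <;> simp only [V, vMat, coe_sig_sq] <;> simp only [sq]

theorem eval_suRel_iff {B : Type u} [CStarAlgebra B] (x y : B) :
    (∀ r ∈ suRel q, FreeStarAlgebra.eval ![x, y] r = 0) ↔
      star x * x + star y * y = 1 ∧ x * star x + (q * conj q) • (star y * y) = 1 ∧
        x * y = conj q • (y * x) ∧ y * star y = star y * y := by
  rw [forall_suRel]
  simp only [map_sub, map_add, map_mul, map_star, map_smul, FreeStarAlgebra.eval_gen, map_one,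
    sub_eq_zero, Matrix.cons_val_zero, Matrix.cons_val_one, Matrix.cons_val_fin_one, coe_norm_sq]

/-- All rules are the defining relations or their adjoints except those for `αγ*` and `α*γ`. These
need an argument, since `αγ = q̄γα` alone does not determine how `α` commutes with `γ*`. -/
theorem rules (hq : q ≠ 0) : SURules q (conj q) (α q) (star (α q)) (γ q) (star (γ q)) := by
  obtain ⟨h1, h2, h3, h4⟩ := rel q
  have hp : conj q ≠ 0 := (map_ne_zero _).mpr hq
  have hn : IsStarNormal (γ q) := ⟨h4.symm⟩
  have hn' : IsStarNormal (conj q • γ q) := ⟨by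
    change _ * _ = _ * _
    rw [star_smul, smul_mul_smul_comm, smul_mul_smul_comm, h4, mul_comm]⟩
  have h5 : SemiconjBy (α q) (γ q) (conj q • γ q) := by
    change _ * _ = _ * _
    rw [h3, smul_mul_assoc]
  -- This is the Fuglede-Putnam theorem: `α` intertwines the normal elements `γ` and `q̄γ`, hence
  -- also their adjoints.
  have h6 := (h5.star_right hn hn').eq
  rw [star_smul, smul_mul_assoc, Complex.star_def, Complex.conj_conj] at h6
  have h7 := congrArg star h3
  have h8 := congrArg star h6
  rw [star_mul, star_smul, star_mul, Complex.star_def, Complex.conj_conj] at h7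
  rw [star_mul, star_smul, star_mul, star_star, Complex.star_def] at h8
  exact
    { ac := h3
      ac' := h6
      a'c := by rw [h8, smul_smul, inv_mul_cancel₀ hp, one_smul]
      a'c' := by rw [h7, smul_smul, inv_mul_cancel₀ hq, one_smul]
      cc := h4.symm
      aa' := by rw [← h2, coe_norm_sq, h4]; abel
      a'a := by rw [← h1, h4]; abel }

/-- This degree determines the power of `ζ` picked up when `e_k` passes an entry of `V`, and it
gives `v_{i,k} e_k` degree `i`. -/
theorem isHomogeneous_V (i k : SignType) :
    (action q).IsHomogeneous ((i : ℤ) - (k : ℤ)) (V q i k) := by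
  have ha := isHomogeneous_α q
  have hc := isHomogeneous_γ q
  have ha' := ha.star
  have hc' := hc.star
  rw [V_eq]
  rcases i <;> rcases k <;> simp only [vMat]
  · exact (CircleAction.isHomogeneous_one.sub (((hc'.mul hc).congr (by decide)).smul _)).congr
      (by decide)
  · exact ((ha.mul hc).smul _).congr (by decide)
  · exact (hc'.mul ha').congr (by decide)
  · exact (((hc'.mul ha).smul _).neg).congr (by decide)
  · exact (ha.mul ha).congr (by decide)
  · exact (((hc'.mul hc').smul _).neg).congr (by decide)
  · exact (((ha'.mul hc).smul _).neg).congr (by decide)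
  · exact (((hc.mul hc).smul _).neg).congr (by decide)
  · exact (ha'.mul ha').congr (by decide)

/-- The power of `ζ` is the one produced when `e_{-k}` is moved past `v_{i,k}*` in the adjoint of
`v_{i,k} e_k`. With it, `Γ(e_i)* = Γ(e_{-i})`. -/
theorem star_V (hq : q ≠ 0) (i k : SignType) :
    (q / conj q) ^ ((k : ℤ) * ((k : ℤ) - (i : ℤ))) • star (V q i k) = V q (-i) (-k) := by
  have hp : conj q ≠ 0 := (map_ne_zero _).mpr hq
  rcases i <;> rcases k <;>
    simp only [V_eq, vMat, SignType.neg_eq_neg_one, SignType.pos_eq_one, SignType.zero_eq_zero,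
      neg_neg, neg_zero]
  all_goals simp only [star_sub, star_neg, star_smul, star_mul, star_star, star_one,
    Complex.star_def, map_mul, map_div₀, map_add, map_one, Complex.conj_conj, mul_comm (conj q) q,
    SignType.coe_neg_one, SignType.coe_zero, SignType.coe_one]
  all_goals match_scalars <;> norm_num <;> field_simp

section Comul

variable (q) (hq : q ≠ 0)

/-- The map `j₁` for two copies of `C(SU_q(2))`. -/
abbrev ι₁ : CSU q →⋆ₐ[ℂ] Braided (zeta q hq) (action q) (action q) := Braided.j₁ _ _ _

/-- The map `j₂` for two copies of `C(SU_q(2))`. -/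
abbrev ι₂ : CSU q →⋆ₐ[ℂ] Braided (zeta q hq) (action q) (action q) := Braided.j₂ _ _ _

/-- Since `α` has degree `0`, only `γ` and `γ*` braid nontrivially, with `ζ = q / q̄` or its
inverse. -/
theorem braidRules : BraidRules q (conj q) (ι₁ q hq (α q)) (ι₁ q hq (star (α q)))
    (ι₁ q hq (γ q)) (ι₁ q hq (star (γ q))) (ι₂ q hq (α q)) (ι₂ q hq (star (α q)))
    (ι₂ q hq (γ q)) (ι₂ q hq (star (γ q))) := by
  have ha := isHomogeneous_α q
  have hc := isHomogeneous_γ q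
  have ha' := ha.star
  have hc' := hc.star
  have key : ∀ {n m : ℤ} {x y : CSU q}, (action q).IsHomogeneous n x →
      (action q).IsHomogeneous m y → ι₂ q hq y * ι₁ q hq x =
        (q / conj q) ^ (-(m * n)) • (ι₁ q hq x * ι₂ q hq y) :=
    fun hx hy => Braided.j₂_mul_j₁ hx hy
  exact
    { ba := by simpa using key ha ha
      ba' := by simpa using key ha' ha
      bc := by simpa using key hc ha
      bc' := by simpa using key hc' ha
      b'a := by simpa using key ha ha'
      b'a' := by simpa using key ha' ha'
      b'c := by simpa using key hc ha'
      b'c' := by simpa using key hc' ha'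
      da := by simpa using key ha hc
      da' := by simpa using key ha' hc
      dc := by simpa using key hc hc
      dc' := by simpa using key hc' hc
      d'a := by simpa using key ha hc'
      d'a' := by simpa using key ha' hc'
      d'c := by simpa using key hc hc'
      d'c' := by simpa using key hc' hc' }

/-- The image of `α` under the comultiplication. -/
def comulα : Braided (zeta q hq) (action q) (action q) :=
  ι₁ q hq (α q) * ι₂ q hq (α q) - q • (ι₁ q hq (star (γ q)) * ι₂ q hq (γ q))

/-- The image of `γ` under the comultiplication. -/
def comulγ : Braided (zeta q hq) (action q) (action q) :=
  ι₁ q hq (γ q) * ι₂ q hq (α q) + ι₁ q hq (star (α q)) * ι₂ q hq (γ q)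

theorem star_comulα : star (comulα q hq) =
    ι₂ q hq (star (α q)) * ι₁ q hq (star (α q)) -
      conj q • (ι₂ q hq (star (γ q)) * ι₁ q hq (γ q)) := by
  simp only [comulα, star_sub, star_mul, star_smul, ← map_star, star_star, Complex.star_def]

theorem star_comulγ : star (comulγ q hq) =
    ι₂ q hq (star (α q)) * ι₁ q hq (star (γ q)) +
      ι₂ q hq (star (γ q)) * ι₁ q hq (α q) := by
  simp only [comulγ, star_add, star_mul, ← map_star, star_star]

theorem rules₁ : SURules q (conj q) (ι₁ q hq (α q)) (ι₁ q hq (star (α q))) (ι₁ q hq (γ q))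
    (ι₁ q hq (star (γ q))) := (rules hq).map (ι₁ q hq).toAlgHom

theorem rules₂ : SURules q (conj q) (ι₂ q hq (α q)) (ι₂ q hq (star (α q))) (ι₂ q hq (γ q))
    (ι₂ q hq (star (γ q))) := (rules hq).map (ι₂ q hq).toAlgHom

theorem comul_rel : ∀ r ∈ suRel q,
    FreeStarAlgebra.eval ![comulα q hq, comulγ q hq] r = 0 := by
  have hp : conj q ≠ 0 := (map_ne_zero _).mpr hq
  have H₁ := rules₁ q hq
  have H₂ := rules₂ q hq
  have K := braidRules q hq
  rw [eval_suRel_iff, star_comulα, star_comulγ, comulα, comulγ]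
  exact ⟨comul_a'a hq hp H₁ H₂ K, comul_aa' hp H₁ H₂ K, comul_ac hq hp H₁ H₂ K,
    comul_cc' hq hp H₁ H₂ K⟩

/-- The comultiplication of `SU_q(2)`. -/
def comul : CSU q →⋆ₐ[ℂ] Braided (zeta q hq) (action q) (action q) :=
  UnivCStar.lift ![comulα q hq, comulγ q hq] (comul_rel q hq)

theorem comul_α : comul q hq (α q) = comulα q hq := UnivCStar.lift_gen _ _ 0

theorem comul_γ : comul q hq (γ q) = comulγ q hq := UnivCStar.lift_gen _ _ 1

theorem comul_equivariant : CircleAction.Equivariant (action q)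
    (Braided.action (zeta q hq) (action q) (action q)) (comul q hq) := by
  have h₁ : ∀ {n x}, (action q).IsHomogeneous n x →
      (Braided.action (zeta q hq) (action q) (action q)).IsHomogeneous n (ι₁ q hq x) :=
    fun hx => Braided.isHomogeneous_j₁ (zeta q hq) hx
  have h₂ : ∀ {n x}, (action q).IsHomogeneous n x →
      (Braided.action (zeta q hq) (action q) (action q)).IsHomogeneous n (ι₂ q hq x) :=
    fun hx => Braided.isHomogeneous_j₂ (zeta q hq) hx
  have ha := isHomogeneous_α q
  have hc := isHomogeneous_γ q
  have hΔα : (Braided.action (zeta q hq) (action q) (action q)).IsHomogeneous 0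
      (comul q hq (α q)) := by
    rw [comul_α, comulα]
    exact (((h₁ ha).mul (h₂ ha)).congr (by decide)).sub
      ((((h₁ hc.star).mul (h₂ hc)).congr (by decide)).smul q)
  have hΔγ : (Braided.action (zeta q hq) (action q) (action q)).IsHomogeneous 1
      (comul q hq (γ q)) := by
    rw [comul_γ, comulγ]
    exact (((h₁ hc).mul (h₂ ha)).congr (by decide)).add
      (((h₁ ha.star).mul (h₂ hc)).congr (by decide))
  refine UnivCStar.equivariant_of_gen ![0, 1] (fun i => ?_) (fun i => ?_)
  · fin_cases i
    · exact ha
    · exact hc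
  · fin_cases i
    · exact hΔα
    · exact hΔγ

theorem map_V {B : Type*} [CStarAlgebra B] (f : CSU q →⋆ₐ[ℂ] B) (i k : SignType) :
    f (V q i k) = vMat q (conj q) (f (α q)) (f (star (α q))) (f (γ q)) (f (star (γ q))) i k := by
  rw [V_eq]
  exact map_vMat f.toAlgHom i k

theorem comul_V (i l : SignType) :
    comul q hq (V q i l) = ∑ k, ι₁ q hq (V q i k) * ι₂ q hq (V q k l) := by
  have hp : conj q ≠ 0 := (map_ne_zero _).mpr hq
  simp only [map_V]
  rw [map_star, map_star, comul_α, comul_γ, star_comulα, star_comulγ]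
  exact comul_vMat hq hp (rules₁ q hq) (rules₂ q hq) (braidRules q hq) i l

end Comul

end CSU

end BraidedSphere

end

/-! ### Quadratic forms in twisted generators -/

noncomputable section

open scoped ComplexConjugate

namespace BraidedSphere

universe u

theorem forall_signType {P : SignType → Prop} : (∀ i, P i) ↔ P .neg ∧ P .zero ∧ P .pos :=
  ⟨fun h => ⟨h _, h _, h _⟩, fun h i => by
    cases i with
    | zero => exact h.2.1
    | neg => exact h.1
    | pos => exact h.2.2⟩

/-- Weight preservation of the forms, here for `S` and next for `V`, makes the relations of the
sphere homogeneous for the circle. -/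
theorem formS_eq_zero (s : ℂ) {i j : SignType} (h : (i : ℤ) + (j : ℤ) ≠ 0) : formS s i j = 0 := by
  rcases i <;> rcases j <;> first | rfl | exact absurd (by decide) h

theorem formV_eq_zero (s : ℂ) {f i j : SignType} (h : (i : ℤ) + (j : ℤ) ≠ (f : ℤ)) :
    formV s f i j = 0 := by
  rcases f <;> rcases i <;> rcases j <;> first | rfl | exact absurd (by decide) h

/-- A quadratic form of degree `n` in elements `x k` twisted by scalars `z ^ k`. -/
theorem sum_form_zpow_smul {R : Type*} [Ring R] [Algebra ℂ R] {z : ℂ} (hz : z ≠ 0)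
    {F : SignType → SignType → ℂ} {n : ℤ} (hF : ∀ i j : SignType, (i : ℤ) + j ≠ n → F i j = 0)
    (x : SignType → R) :
    ∑ i : SignType, ∑ j : SignType, F i j • ((z ^ (i : ℤ) • x i) * (z ^ (j : ℤ) • x j)) =
      z ^ n • ∑ i, ∑ j, F i j • (x i * x j) := by
  simp only [Finset.smul_sum]
  refine Finset.sum_congr rfl fun i _ => Finset.sum_congr rfl fun j _ => ?_
  by_cases h : (i : ℤ) + j = n
  · rw [smul_mul_smul_comm, ← zpow_add₀ hz, h, smul_comm]
  · rw [hF i j h, zero_smul, zero_smul, smul_zero]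

/-- A quadratic form in the elements `∑ k, Y i k * x k` when the `x k` commute with the entries of
`Y` up to scalars. -/
theorem sum_form_mul {R I : Type*} [Ring R] [Algebra ℂ R] [Fintype I] (F : I → I → ℂ)
    (Y : I → I → R) (x : I → R) (w : I → I → I → ℂ)
    (hw : ∀ k j l, x k * Y j l = w k j l • (Y j l * x k)) :
    ∑ i, ∑ j, F i j • ((∑ k, Y i k * x k) * ∑ l, Y j l * x l) =
      ∑ k, ∑ l, (∑ i, ∑ j, (F i j * w k j l) • (Y i k * Y j l)) * (x k * x l) := by
  have h : ∀ i j k l, F i j • (Y i k * x k * (Y j l * x l)) =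
      (F i j * w k j l) • (Y i k * Y j l) * (x k * x l) := fun i j k l => by
    rw [mul_assoc, ← mul_assoc (x k), hw, smul_mul_assoc, mul_smul_comm, smul_smul,
      smul_mul_assoc, mul_assoc, mul_assoc]
  simp only [Finset.sum_mul_sum, Finset.smul_sum, h]
  simp only [Finset.sum_mul]
  calc _ = ∑ i, ∑ k, ∑ j, ∑ l, (F i j * w k j l) • (Y i k * Y j l) * (x k * x l) :=
        Finset.sum_congr rfl fun i _ => Finset.sum_comm
    _ = ∑ k, ∑ i, ∑ l, ∑ j, (F i j * w k j l) • (Y i k * Y j l) * (x k * x l) := by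
        rw [Finset.sum_comm]
        exact Finset.sum_congr rfl fun k _ => Finset.sum_congr rfl fun i _ => Finset.sum_comm
    _ = _ := Finset.sum_congr rfl fun k _ => Finset.sum_comm

/-- After covariance has turned the coefficient of `e_k e_l` into a combination of the `V n`,
summing over `k` and `l` first reproduces the original relations in `X`. -/
theorem sum_form_hom {A X D : Type*} {I : Type*} [CStarAlgebra A] [CStarAlgebra X]
    [CStarAlgebra D] [Fintype I] (f : A →⋆ₐ[ℂ] D) (g : X →⋆ₐ[ℂ] D) (V : I → A) (e : I → I → X)
    (y : I → X) (F : I → I → I → ℂ) {c : ℂ} (h : ∀ n, ∑ k, ∑ l, F n k l • e k l = c • y n) :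
    ∑ k, ∑ l, f (∑ n, F n k l • V n) * g (e k l) = c • ∑ n, f (V n) * g (y n) := by
  have h' : ∀ n, c • (f (V n) * g (y n)) = ∑ k, ∑ l, F n k l • (f (V n) * g (e k l)) := fun n => by
    rw [← mul_smul_comm, ← map_smul, ← h]
    simp only [map_sum, Finset.mul_sum, map_smul, mul_smul_comm]
  simp only [Finset.smul_sum, h', map_sum, Finset.sum_mul, map_smul, smul_mul_assoc]
  refine Eq.trans ?_ Finset.sum_comm
  exact Finset.sum_congr rfl fun k _ => Finset.sum_comm

namespace CSU

variable {q : ℂ}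

theorem formS_V (hq : q ≠ 0) (k l : SignType) :
    ∑ i, ∑ j, (formS (q * conj q) i j * braidFactor q (conj q) k j l) • (V q i k * V q j l) =
      formS (q * conj q) k l • 1 := by
  simp only [V_eq]
  exact formS_vMat hq ((map_ne_zero _).mpr hq) (rules hq) k l

theorem formV_V (hq : q ≠ 0) (f k l : SignType) :
    ∑ i, ∑ j, (formV (q * conj q) f i j * braidFactor q (conj q) k j l) • (V q i k * V q j l) =
      ∑ m, formV (q * conj q) m k l • V q f m := by
  simp only [V_eq]
  exact formV_vMat hq ((map_ne_zero _).mpr hq) (rules hq) f k l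

/-- The matrix `V` is left invertible. -/
theorem exists_mul_V (hq : q ≠ 0) (m : SignType) :
    ∃ U : SignType → CSU q, ∀ l, ∑ j, U j * V q j l = if l = m then 1 else 0 := by
  have hp : conj q ≠ 0 := (map_ne_zero _).mpr hq
  have hz : q / conj q ≠ 0 := div_ne_zero hq hp
  -- The form `S` pairs `-m` with `m` alone, and its value there, one of `1`, `1 + |q|²`, `|q|²`, is
  -- nonzero. Invariance in row `-m` then reads as a left inverse at index `m`.
  have hc : formS (q * conj q) (-m) m ≠ 0 := by
    have h1 : 1 + q * conj q ≠ 0 := by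
      rw [← coe_sig_sq, sig_sq]
      exact_mod_cast (by positivity : (0 : ℝ) < 1 + ‖q‖ ^ 2).ne'
    cases m
    · exact h1
    · exact mul_ne_zero hq hp
    · exact one_ne_zero
  have hne : ∀ l, l ≠ m → formS (q * conj q) (-m) l = 0 := fun l hl =>
    formS_eq_zero _ (by clear hc; revert m l; decide)
  refine ⟨fun j => ∑ i, ((formS (q * conj q) (-m) m)⁻¹ * (formS (q * conj q) i j *
    braidFactor q (conj q) (-m) j m)) • V q i (-m), fun l => ?_⟩
  have h := formS_V hq (-m) l
  rw [Finset.sum_comm] at h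
  -- The coefficients of the inverse must not depend on `l`. Replacing `l` by `m` in the braiding
  -- factor changes it by a scalar independent of `j`, which leaves the sum and equals `1` when `l =
  -- m`.
  have hb : ∀ j, braidFactor q (conj q) (-m) j m =
      (q / conj q) ^ ((m : ℤ) * ((l : ℤ) - m)) * braidFactor q (conj q) (-m) j l := fun j => by
    rw [braidFactor, braidFactor, ← zpow_add₀ hz]
    congr 1
    rw [SignType.coe_neg]
    ring
  have h' : ∑ j, (∑ i, ((formS (q * conj q) (-m) m)⁻¹ * (formS (q * conj q) i j *
      braidFactor q (conj q) (-m) j m)) • V q i (-m)) * V q j l =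
      ((formS (q * conj q) (-m) m)⁻¹ * (q / conj q) ^ ((m : ℤ) * ((l : ℤ) - m))) •
        (formS (q * conj q) (-m) l • (1 : CSU q)) := by
    rw [← h]
    simp only [Finset.smul_sum, Finset.sum_mul]
    refine Finset.sum_congr rfl fun j _ => Finset.sum_congr rfl fun i _ => ?_
    rw [hb, smul_mul_assoc, smul_smul]
    congr 1
    ring
  rw [h']
  split_ifs with hl
  · rw [hl, sub_self, mul_zero, zpow_zero, mul_one, smul_smul, inv_mul_cancel₀ hc, one_smul]
  · rw [hne l hl, zero_smul, smul_zero]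

end CSU

/-! ### The braided sphere: relations, circle action and coaction -/

namespace Sphere

variable {q : ℂ} {ρ lam : ℝ}

/-- In this shape the relations are visibly covariant: an invariant form equals a scalar, and a
triple of forms transforming like the generators equals a multiple of the generators. -/
theorem eval_sphereRel_iff {B : Type u} [CStarAlgebra B] (x : SignType → B) :
    (∀ r ∈ sphereRel q ρ lam, FreeStarAlgebra.eval x r = 0) ↔
      (∀ i, star (x i) = x (-i)) ∧
      ∑ i, ∑ j, formS (q * conj q) i j • (x i * x j) = (ρ : ℂ) • 1 ∧
      ∀ m, ∑ i, ∑ j, formV (q * conj q) m i j • (x i * x j) = (lam : ℂ) • x m := by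
  rw [forall_sphereRel, forall_signType (P := fun m => _ = (lam : ℂ) • x m)]
  simp only [sum_signType, formS, formV, zero_smul, add_zero, zero_add, one_smul]
  simp only [map_sub, map_add, map_mul, map_star, map_smul, map_pow, FreeStarAlgebra.eval_gen,
    map_one, sub_eq_zero, SignType.neg_eq_neg_one, SignType.zero_eq_zero, SignType.pos_eq_one,
    Complex.ofReal_mul, Complex.ofReal_sub, Complex.ofReal_one, coe_sig_sq, coe_vsig, smul_sub,
    neg_smul]
  simp only [sq, Complex.ofReal_mul, coe_vsig]
  refine and_congr Iff.rfl (and_congr Iff.rfl (and_congr (by rw [sub_eq_add_neg])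
    (and_congr ?_ (by rw [sub_eq_add_neg]))))
  constructor <;> (intro h; rw [← h]; abel)

variable (q ρ lam) in
theorem rel : (∀ i, star (e q ρ lam i) = e q ρ lam (-i)) ∧
    ∑ i, ∑ j, formS (q * conj q) i j • (e q ρ lam i * e q ρ lam j) = (ρ : ℂ) • 1 ∧
    ∀ m, ∑ i, ∑ j, formV (q * conj q) m i j • (e q ρ lam i * e q ρ lam j) =
      (lam : ℂ) • e q ρ lam m :=
  (eval_sphereRel_iff _).mp (UnivCStar.eval_gen_eq_zero _ (admissible_sphereRel q ρ lam))

variable (q ρ lam) in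
theorem action_rel (z : Circle) : ∀ r ∈ sphereRel q ρ lam, FreeStarAlgebra.eval
    (fun i : SignType => (z : ℂ) ^ (i : ℤ) •
      UnivCStar.gen (sphereRel q ρ lam) (admissible_sphereRel q ρ lam) i) r = 0 := by
  have hz : (z : ℂ) ≠ 0 := Circle.coe_ne_zero z
  obtain ⟨h₁, h₂, h₃⟩ := rel q ρ lam
  refine (eval_sphereRel_iff _).mpr ⟨fun i => ?_, ?_, fun m => ?_⟩
  · have hs : star ((z : ℂ) ^ (i : ℤ)) = (z : ℂ) ^ ((-i : SignType) : ℤ) := by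
      rw [star_zpow₀, SignType.coe_neg, zpow_neg, ← inv_zpow, Complex.star_def,
        ← Circle.coe_inv_eq_conj, Circle.coe_inv]
    rw [star_smul, hs]
    exact congrArg _ (h₁ i)
  · rw [sum_form_zpow_smul hz fun i j h => formS_eq_zero _ h, zpow_zero, one_smul]
    exact h₂
  · rw [sum_form_zpow_smul hz fun i j h => formV_eq_zero _ h, smul_comm]
    exact congrArg _ (h₃ m)

variable (q ρ lam) in
/-- The action of `𝕋` on `C(𝕏_{q,ρ,λ})` with `deg e_i = i`. -/
def action : CircleAction (Sphere q ρ lam) :=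
  gradedAction (fun i : SignType => (i : ℤ)) (action_rel q ρ lam)

variable (q ρ lam) in
theorem isHomogeneous_e (i : SignType) : (action q ρ lam).IsHomogeneous (i : ℤ) (e q ρ lam i) :=
  gradedAction_gen (h := admissible_sphereRel q ρ lam) _ (action_rel q ρ lam) i

section Coaction

variable (q ρ lam) (hq : q ≠ 0)

/-- The embedding of `C(SU_q(2))` into its braided tensor product with `C(𝕏_{q,ρ,λ})`. -/
abbrev κ₁ : CSU q →⋆ₐ[ℂ] Braided (zeta q hq) (CSU.action q) (action q ρ lam) :=
  Braided.j₁ _ _ _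

/-- The embedding of `C(𝕏_{q,ρ,λ})` into its braided tensor product with `C(SU_q(2))`. -/
abbrev κ₂ : Sphere q ρ lam →⋆ₐ[ℂ] Braided (zeta q hq) (CSU.action q) (action q ρ lam) :=
  Braided.j₂ _ _ _

/-- The images of the generators under the coaction of `SU_q(2)`. -/
def coactE (i : SignType) : Braided (zeta q hq) (CSU.action q) (action q ρ lam) :=
  ∑ k, κ₁ q ρ lam hq (CSU.V q i k) * κ₂ q ρ lam hq (e q ρ lam k)

theorem κ₂_mul_κ₁ {m n : ℤ} {a : CSU q} {b : Sphere q ρ lam}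
    (ha : (CSU.action q).IsHomogeneous n a) (hb : (action q ρ lam).IsHomogeneous m b) :
    κ₂ q ρ lam hq b * κ₁ q ρ lam hq a =
      (q / conj q) ^ (-(m * n)) • (κ₁ q ρ lam hq a * κ₂ q ρ lam hq b) :=
  Braided.j₂_mul_j₁ ha hb

theorem star_coactE (i : SignType) :
    star (coactE q ρ lam hq i) = coactE q ρ lam hq (-i) := by
  -- The summand of index `k` has as its adjoint the summand of index `-k` on the other side, so the
  -- second sum is reindexed before comparing.
  rw [coactE, coactE, star_sum, ← Equiv.sum_comp (Equiv.neg SignType)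
    fun k => κ₁ q ρ lam hq (CSU.V q (-i) k) * κ₂ q ρ lam hq (e q ρ lam k)]
  refine Finset.sum_congr rfl fun k _ => ?_
  rw [star_mul, ← map_star, ← map_star, (rel q ρ lam).1, Equiv.neg_apply, ← CSU.star_V hq i k,
    κ₂_mul_κ₁ q ρ lam hq (CSU.isHomogeneous_V i k).star (isHomogeneous_e q ρ lam (-k)),
    map_smul, smul_mul_assoc]
  congr 2
  rw [SignType.coe_neg]
  ring

/-- The coefficient of `e_k e_l` is collected inside `C(SU_q(2))`, where the invariance identities
for `V` apply. -/
theorem sum_form_coactE (F : SignType → SignType → ℂ) :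
    ∑ i, ∑ j, F i j • (coactE q ρ lam hq i * coactE q ρ lam hq j) =
      ∑ k, ∑ l, κ₁ q ρ lam hq (∑ i, ∑ j, (F i j * braidFactor q (conj q) k j l) •
        (CSU.V q i k * CSU.V q j l)) * κ₂ q ρ lam hq (e q ρ lam k * e q ρ lam l) := by
  simp only [map_sum, map_smul, map_mul]
  exact sum_form_mul F (fun i k => κ₁ q ρ lam hq (CSU.V q i k))
    (fun k => κ₂ q ρ lam hq (e q ρ lam k)) (braidFactor q (conj q)) fun k j l =>
      κ₂_mul_κ₁ q ρ lam hq (CSU.isHomogeneous_V j l) (isHomogeneous_e q ρ lam k)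

theorem coact_rel : ∀ r ∈ sphereRel q ρ lam,
    FreeStarAlgebra.eval (coactE q ρ lam hq) r = 0 := by
  obtain ⟨-, h₂, h₃⟩ := rel q ρ lam
  refine (eval_sphereRel_iff _).mpr ⟨star_coactE q ρ lam hq, ?_, fun m => ?_⟩
  · rw [sum_form_coactE]
    simp only [CSU.formS_V hq, map_smul, map_one, smul_mul_assoc, one_mul]
    -- Invariance has replaced the coefficients by those of `S` itself, so the sum is `κ₂` of the
    -- relation in the sphere.
    simp only [← map_smul, ← map_sum, h₂]
    rw [map_smul, map_one]
  · rw [sum_form_coactE]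
    simp only [CSU.formV_V hq]
    exact sum_form_hom (κ₁ q ρ lam hq) (κ₂ q ρ lam hq) (CSU.V q m)
      (fun k l => e q ρ lam k * e q ρ lam l) (e q ρ lam) (formV (q * conj q)) h₃

/-- The coaction of `SU_q(2)` on the braided Podleś sphere. -/
def coact : Sphere q ρ lam →⋆ₐ[ℂ] Braided (zeta q hq) (CSU.action q) (action q ρ lam) :=
  UnivCStar.lift (coactE q ρ lam hq) (coact_rel q ρ lam hq)

theorem coact_e (i : SignType) : coact q ρ lam hq (e q ρ lam i) =
    ∑ k, κ₁ q ρ lam hq (CSU.V q i k) * κ₂ q ρ lam hq (e q ρ lam k) :=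
  UnivCStar.lift_gen _ _ i

theorem coact_equivariant : CircleAction.Equivariant (action q ρ lam)
    (Braided.action (zeta q hq) (CSU.action q) (action q ρ lam)) (coact q ρ lam hq) := by
  refine UnivCStar.equivariant_of_gen (fun i : SignType => (i : ℤ)) (isHomogeneous_e q ρ lam)
    fun i => ?_
  rw [show coact q ρ lam hq (UnivCStar.gen _ _ i) = _ from coact_e q ρ lam hq i]
  exact CircleAction.IsHomogeneous.sum fun k _ =>
    ((Braided.isHomogeneous_j₁ (zeta q hq) (CSU.isHomogeneous_V i k)).mul
      (Braided.isHomogeneous_j₂ (zeta q hq) (isHomogeneous_e q ρ lam k))).congr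
        (sub_add_cancel _ _)

end Coaction

end Sphere

end BraidedSphere

end

/-! ### Coassociativity and the density condition -/

noncomputable section

open scoped ComplexConjugate

namespace BraidedSphere

namespace Braided

variable {A B D : Type} [CStarAlgebra A] [CStarAlgebra B] [CStarAlgebra D]

/-- With `x l = j₂(e_l)` the inner sums are the `Γ(e_j)`, so a left inverse of `V` recovers
`j₂(e_m)` from them. -/
theorem sum_mul_sum_eq_of_left_inverse {I : Type*} [Fintype I] [DecidableEq I] (f : A →⋆ₐ[ℂ] D)
    {U : I → A} {V : I → I → A} {m : I} (hU : ∀ l, ∑ j, U j * V j l = if l = m then 1 else 0)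
    (x : I → D) : ∑ j, f (U j) * ∑ l, f (V j l) * x l = x m := by
  simp only [Finset.mul_sum, ← mul_assoc, ← map_mul]
  rw [Finset.sum_comm]
  simp only [← Finset.sum_mul, ← map_sum, hU]
  simp only [apply_ite f, map_one, map_zero, ite_mul, one_mul, zero_mul, Finset.sum_ite_eq',
    Finset.mem_univ, if_true]

theorem sum_mul_mul_mem_bracket {I : Type*} [Fintype I] (f : A →⋆ₐ[ℂ] D) (g : B →⋆ₐ[ℂ] D)
    (U : I → A) (x : I → B) (b : B) :
    (∑ j, f (U j) * g (x j)) * g b ∈ bracket (Set.range f) (Set.range g) := by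
  rw [Finset.sum_mul]
  refine Submodule.sum_mem _ fun j _ => ?_
  rw [mul_assoc, ← map_mul]
  exact mul_mem_bracket ⟨_, rfl⟩ ⟨_, rfl⟩

theorem mul_mem_bracket_range (f : A →⋆ₐ[ℂ] D) (g : B →⋆ₐ[ℂ] D) (a : A) {y : D}
    (hy : y ∈ bracket (Set.range f) (Set.range g)) :
    f a * y ∈ bracket (Set.range f) (Set.range g) := by
  have h : bracket (Set.range f) (Set.range g) ≤
      (bracket (Set.range f) (Set.range g)).comap (LinearMap.mulLeft ℂ (f a)) := by
    refine bracket_le (isClosed_comap (isClosed_bracket _ _) _ (continuous_const_mul _)) ?_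
    rintro _ ⟨s, rfl⟩ _ ⟨t, rfl⟩
    rw [Submodule.mem_comap, LinearMap.mulLeft_apply, ← mul_assoc, ← map_mul]
    exact mul_mem_bracket ⟨_, rfl⟩ ⟨_, rfl⟩
  exact h hy

/-- If `d` commutes up to scalars with the homogeneous elements of `f(A)` and multiplies `g(B)` into
`[f(A) g(B)]`, then it multiplies all of `[f(A) g(B)]` into itself. -/
theorem mul_mem_bracket_of_comm (ρ : CircleAction A) (f : A →⋆ₐ[ℂ] D) (g : B →⋆ₐ[ℂ] D) {d : D}
    (hd : ∀ n a, ρ.IsHomogeneous n a → ∃ c : ℂ, d * f a = c • (f a * d))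
    (hg : ∀ b, d * g b ∈ bracket (Set.range f) (Set.range g)) {y : D}
    (hy : y ∈ bracket (Set.range f) (Set.range g)) :
    d * y ∈ bracket (Set.range f) (Set.range g) := by
  set N := bracket (Set.range f) (Set.range g) with hN
  have hcl : IsClosed (N : Set D) := isClosed_bracket _ _
  have h : N ≤ N.comap (LinearMap.mulLeft ℂ d) := by
    refine bracket_le (isClosed_comap hcl _ (continuous_const_mul _)) ?_
    rintro _ ⟨a, rfl⟩ _ ⟨b, rfl⟩
    let L : A →ₗ[ℂ] D := (LinearMap.mulLeft ℂ d) ∘ₗ (LinearMap.mulRight ℂ (g b)) ∘ₗ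
      f.toAlgHom.toLinearMap
    have hL : Continuous L :=
      (continuous_const_mul d).comp ((continuous_mul_const (g b)).comp (continuous_hom f))
    -- The commutation rule holds for homogeneous `a` only; their span is dense and the condition is
    -- closed and linear in `a`.
    have h1 : ⊤ ≤ N.comap L := by
      rw [← ρ.dense_span_homogeneous]
      refine Submodule.topologicalClosure_minimal _ (Submodule.span_le.mpr ?_)
        (isClosed_comap hcl L hL)
      rintro a ⟨n, ha⟩
      obtain ⟨c, hc⟩ := hd n a ha
      change d * (f a * g b) ∈ N
      rw [← mul_assoc, hc, smul_mul_assoc, mul_assoc]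
      exact N.smul_mem c (mul_mem_bracket_range f g a (hg b))
    exact h1 (Submodule.mem_top (x := a))
  exact h hy

theorem map_sum_mul {I : Type*} [Fintype I] (f : A →⋆ₐ[ℂ] D) (a b : I → A) :
    f (∑ k, a k * b k) = ∑ k, f (a k) * f (b k) := by
  simp only [map_sum, map_mul]

theorem sum_mul_sum_comm {I : Type*} [Fintype I] (x : I → D) (y : I → I → D) (z : I → D) :
    ∑ k, x k * ∑ l, y k l * z l = ∑ l, (∑ k, x k * y k l) * z l := by
  simp only [Finset.mul_sum, Finset.sum_mul, mul_assoc]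
  exact Finset.sum_comm

end Braided

/-- A closed subspace that is invariant under left multiplication by the images of the generators
and their adjoints is invariant under left multiplication by the images of all elements. -/
theorem UnivCStar.mul_mem_of_gen {ι : Type} {R : Set (FreeStarAlgebra ι)} {h : Admissible R}
    {D : Type} [CStarAlgebra D] (f : UnivCStar R h →⋆ₐ[ℂ] D) {N : Submodule ℂ D}
    (hN : IsClosed (N : Set D)) (hg : ∀ i, ∀ y ∈ N, f (gen R h i) * y ∈ N)
    (hg' : ∀ i, ∀ y ∈ N, f (star (gen R h i)) * y ∈ N) (x : UnivCStar R h) {y : D} (hy : y ∈ N) :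
    f x * y ∈ N := by
  have hcl : IsClosed {x : UnivCStar R h | ∀ y ∈ N, f x * y ∈ N} := by
    simp only [Set.ofPred_forall]
    exact isClosed_iInter fun y => isClosed_iInter fun _ =>
      hN.preimage ((continuous_hom f).mul continuous_const)
  refine (denseRange_mk (R := R) (h := h)).induction_on (p := fun x => ∀ y ∈ N, f x * y ∈ N) x hcl
    (fun w => ?_) y hy
  induction w using FreeStarAlgebra.induction with
  | hone => intro y hy; rwa [map_one, map_one, one_mul]
  | hletter i b =>
    cases b
    · exact hg i
    · rw [FreeStarAlgebra.letter_true, map_star]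
      exact hg' i
  | hadd v w hv hw =>
    intro y hy
    rw [map_add, map_add, add_mul]
    exact N.add_mem (hv y hy) (hw y hy)
  | hmul v w hv hw =>
    intro y hy
    rw [map_mul, map_mul, mul_assoc]
    exact hv _ (hw y hy)
  | hsmul c w hw =>
    intro y hy
    rw [map_smul, map_smul, smul_mul_assoc]
    exact N.smul_mem c (hw y hy)

namespace Sphere

variable (q : ℂ) (ρ lam : ℝ) (hq : q ≠ 0)

/-- By the universal property it suffices to compare the two sides at each `e_i`. Both are the
double sum of `v_{i,k} v_{k,l} e_l` over the three embedded factors, bracketed in two ways. The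
properties `h₁`, `h₂`, `h₃` are all that is used of `Θ`. -/
theorem coassoc {Θ : Braided (zeta q hq)
        (Braided.action (zeta q hq) (CSU.action q) (CSU.action q)) (action q ρ lam) ≃⋆ₐ[ℂ]
      Braided (zeta q hq) (CSU.action q)
        (Braided.action (zeta q hq) (CSU.action q) (action q ρ lam))}
    (h₁ : ∀ a, Θ (Braided.j₁ _ _ _ (Braided.j₁ _ _ _ a)) = Braided.j₁ _ _ _ a)
    (h₂ : ∀ a, Θ (Braided.j₁ _ _ _ (Braided.j₂ _ _ _ a)) =
      Braided.j₂ _ _ _ (Braided.j₁ _ _ _ a))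
    (h₃ : ∀ x, Θ (Braided.j₂ _ _ _ x) = Braided.j₂ _ _ _ (Braided.j₂ _ _ _ x))
    (x : Sphere q ρ lam) :
    Braided.map (zeta q hq) (CSU.action q).equivariant_id (coact_equivariant q ρ lam hq)
        (coact q ρ lam hq x) =
      Θ (Braided.map (zeta q hq) (CSU.comul_equivariant q hq) (action q ρ lam).equivariant_id
        (coact q ρ lam hq x)) := by
  let Θ' := StarAlgHomClass.toStarAlgHom Θ
  let M₁ := Braided.map (zeta q hq) (CSU.action q).equivariant_id (coact_equivariant q ρ lam hq)
  let M₂ := Braided.map (zeta q hq) (CSU.comul_equivariant q hq) (action q ρ lam).equivariant_id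
  let J := Braided.j₁ (zeta q hq) (Braided.action (zeta q hq) (CSU.action q) (CSU.action q))
    (action q ρ lam)
  let J' := Braided.j₂ (zeta q hq) (CSU.action q)
    (Braided.action (zeta q hq) (CSU.action q) (action q ρ lam))
  refine DFunLike.congr_fun (f := M₁.comp (coact q ρ lam hq))
    (g := (Θ'.comp M₂).comp (coact q ρ lam hq)) (UnivCStar.hom_ext fun i => ?_) x
  have hL : M₁ (coact q ρ lam hq (e q ρ lam i)) =
      ∑ k, Braided.j₁ _ _ _ (CSU.V q i k) * ∑ l, J' (κ₁ q ρ lam hq (CSU.V q k l)) *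
        J' (κ₂ q ρ lam hq (e q ρ lam l)) := by
    rw [coact_e, Braided.map_sum_mul M₁]
    refine Finset.sum_congr rfl fun k _ => ?_
    rw [Braided.map_j₁, Braided.map_j₂, coact_e]
    exact congrArg _ (Braided.map_sum_mul J' _ _)
  have hR : (Θ'.comp M₂) (coact q ρ lam hq (e q ρ lam i)) =
      ∑ l, (∑ k, Braided.j₁ _ _ _ (CSU.V q i k) * J' (κ₁ q ρ lam hq (CSU.V q k l))) *
        J' (κ₂ q ρ lam hq (e q ρ lam l)) := by
    rw [coact_e, Braided.map_sum_mul (Θ'.comp M₂)]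
    refine Finset.sum_congr rfl fun l _ => ?_
    rw [StarAlgHom.comp_apply, StarAlgHom.comp_apply, Braided.map_j₁, Braided.map_j₂,
      CSU.comul_V]
    refine congrArg₂ (· * ·) ((Braided.map_sum_mul (Θ'.comp J) _ _).trans ?_) (h₃ _)
    exact Finset.sum_congr rfl fun k _ => congrArg₂ (· * ·) (h₁ _) (h₂ _)
  exact hL.trans ((Braided.sum_mul_sum_comm _ _ _).trans hR.symm)

/-- The space `N` is not known to be an algebra, so it is shown to be stable under left
multiplication by `j₂` of the generators. This suffices: it is stable under `j₁` by construction and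
contains `1`. -/
theorem bracket_coact :
    bracket (Set.range (κ₁ q ρ lam hq)) (Set.range (coact q ρ lam hq)) = ⊤ := by
  set N := bracket (Set.range (κ₁ q ρ lam hq)) (Set.range (coact q ρ lam hq)) with hN
  have he : ∀ m, ∀ y ∈ N, κ₂ q ρ lam hq (e q ρ lam m) * y ∈ N := by
    intro m y hy
    refine Braided.mul_mem_bracket_of_comm (CSU.action q) _ _ (fun n a ha => ⟨_,
      κ₂_mul_κ₁ q ρ lam hq ha (isHomogeneous_e q ρ lam m)⟩) (fun b => ?_) hy
    -- Since `j₂(e_m) = ∑ j₁(U_j) Γ(e_j)`, the product `j₂(e_m) Γ(b)` is a sum of elements `j₁(U_j)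
    -- Γ(e_j b)`.
    obtain ⟨U, hU⟩ := CSU.exists_mul_V hq m
    have h := Braided.sum_mul_sum_eq_of_left_inverse (κ₁ q ρ lam hq) hU
      fun l => κ₂ q ρ lam hq (e q ρ lam l)
    simp only [← coact_e] at h
    rw [← h]
    exact Braided.sum_mul_mul_mem_bracket _ _ U (e q ρ lam) b
  rw [eq_top_iff, ← Braided.bracket_j₁_j₂]
  refine bracket_le (isClosed_bracket _ _) ?_
  rintro _ ⟨a, rfl⟩ _ ⟨b, rfl⟩
  refine Braided.mul_mem_bracket_range _ _ a ?_
  -- The element `j₂(b)` is reached by applying stability under `j₂` to `1`, which lies in `N`.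
  rw [← mul_one (Braided.j₂ _ _ _ b)]
  refine UnivCStar.mul_mem_of_gen _ (isClosed_bracket _ _) he (fun i y hy => ?_) b ?_
  · rw [show star (UnivCStar.gen _ _ i) = _ from (rel q ρ lam).1 i]
    exact he (-i) y hy
  · rw [← mul_one 1]
    exact mul_mem_bracket ⟨1, map_one _⟩ ⟨1, map_one _⟩

end Sphere

end BraidedSphere

end

/-! ### Comparison with Podleś's sphere -/

noncomputable section

open scoped ComplexConjugate

namespace BraidedSphere

theorem norm_ne_zero_coe {q : ℂ} (hq : q ≠ 0) : (‖q‖ : ℂ) ≠ 0 :=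
  Complex.ofReal_ne_zero.mpr (norm_ne_zero_iff.mpr hq)

theorem one_add_norm_sq_ne_zero (q : ℂ) : (1 + (‖q‖ : ℂ) ^ 2) ≠ 0 := by
  exact_mod_cast (by positivity : (0 : ℝ) < 1 + ‖q‖ ^ 2).ne'

theorem sqrt_vsig (q : ℂ) : √(vsig q) = ‖q‖ := Real.sqrt_sq (norm_nonneg q)

section Podles

variable (q : ℂ) (ρ lam : ℝ)

/-- The factors by which the generators of the two spheres differ. -/
def podlesScale : SignType → ℝ
  | .zero => ‖q‖
  | _ => 1 + ‖q‖ ^ 2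

theorem podlesScale_neg (i : SignType) : podlesScale q (-i) = podlesScale q i := by
  cases i <;> rfl

theorem podlesScale_ne_zero {q : ℂ} (hq : q ≠ 0) (i : SignType) :
    (podlesScale q i : ℂ) ≠ 0 := by
  have h : (1 + ‖q‖ ^ 2 : ℝ) ≠ 0 := by positivity
  cases i
  · exact norm_ne_zero_coe hq
  · exact Complex.ofReal_ne_zero.mpr h
  · exact Complex.ofReal_ne_zero.mpr h

theorem podlesScale_one : (podlesScale q 1 : ℂ) = 1 + (‖q‖ : ℂ) ^ 2 := by
  rw [← Complex.ofReal_one, ← Complex.ofReal_pow, ← Complex.ofReal_add]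
  rfl

theorem podlesScale_zero : (podlesScale q 0 : ℂ) = ‖q‖ := rfl

/-- After reversal of the indices and rescaling, every relation of one sphere is a scalar multiple
of one relation of the other. The reversal exchanges the second and the fourth relation, while the
first and the third keep their places. -/
theorem sphere_rel_of_podles {q : ℂ} (hq : q ≠ 0) {B : Type} [CStarAlgebra B] {x : SignType → B}
    (hx : ∀ r ∈ podlesRel ‖q‖ (lam / (√(vsig q) * sig q ^ 2)) (ρ / (vsig q * sig q ^ 2)),
      FreeStarAlgebra.eval x r = 0) :
    ∀ r ∈ sphereRel q ρ lam,
      FreeStarAlgebra.eval (fun i => (podlesScale q i : ℂ) • x (-i)) r = 0 := by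
  have h0 := norm_ne_zero_coe hq
  have h1 := one_add_norm_sq_ne_zero q
  rw [forall_podlesRel, sqrt_vsig, sig_sq] at hx
  rw [forall_sphereRel, sig_sq]
  obtain ⟨hs, e₁, e₂, e₃, e₄⟩ := hx
  simp only [map_sub, map_add, map_mul, map_star, map_smul, map_pow, FreeStarAlgebra.eval_gen,
    map_one, vsig, Complex.ofReal_mul, Complex.ofReal_add, Complex.ofReal_sub, Complex.ofReal_div,
    Complex.ofReal_pow, Complex.ofReal_one] at e₁ e₂ e₃ e₄ hs ⊢
  -- The multiples are `ςσ²` for the first and third relation and `σ⁴|q|` for the other two. They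
  -- come from clearing the denominators in `ρ'` and `λ'`; in the third relation `1 - ς² = σ²(1 -
  -- ς)` is used.
  refine ⟨fun i => ?_, Eq.trans ?_ (smul_eq_zero_of_right ((‖q‖ : ℂ) ^ 2 * (1 + (‖q‖ : ℂ) ^ 2)) e₁),
    Eq.trans ?_ (smul_eq_zero_of_right ((1 + (‖q‖ : ℂ) ^ 2) ^ 2 * (‖q‖ : ℂ)) e₄),
    Eq.trans ?_ (smul_eq_zero_of_right ((‖q‖ : ℂ) ^ 2 * (1 + (‖q‖ : ℂ) ^ 2)) e₃),
    Eq.trans ?_ (smul_eq_zero_of_right ((1 + (‖q‖ : ℂ) ^ 2) ^ 2 * (‖q‖ : ℂ)) e₂)⟩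
  · rw [star_smul, Complex.star_def, Complex.conj_ofReal, podlesScale_neg,
      sub_eq_zero.mp (hs (-i)), sub_self]
  all_goals
    simp only [podlesScale_neg, podlesScale_one, podlesScale_zero, neg_neg, neg_zero, sq (_ • _),
      sq (x _), smul_mul_smul_comm, smul_smul, smul_add, smul_sub]
    match_scalars <;> field_simp
  all_goals ring

/-- The inverse substitution multiplies the relations by the inverses of the same scalars, which are
nonzero because `q` is. -/
theorem podles_rel_of_sphere {q : ℂ} (hq : q ≠ 0) {B : Type} [CStarAlgebra B] {x : SignType → B}
    (hx : ∀ r ∈ sphereRel q ρ lam, FreeStarAlgebra.eval x r = 0) :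
    ∀ r ∈ podlesRel ‖q‖ (lam / (√(vsig q) * sig q ^ 2)) (ρ / (vsig q * sig q ^ 2)),
      FreeStarAlgebra.eval (fun i => (podlesScale q i : ℂ)⁻¹ • x (-i)) r = 0 := by
  have h0 := norm_ne_zero_coe hq
  have h1 := one_add_norm_sq_ne_zero q
  rw [forall_sphereRel, sig_sq] at hx
  rw [forall_podlesRel, sqrt_vsig, sig_sq]
  obtain ⟨hs, e₁, e₂, e₃, e₄⟩ := hx
  simp only [map_sub, map_add, map_mul, map_star, map_smul, map_pow, FreeStarAlgebra.eval_gen,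
    map_one, vsig, Complex.ofReal_mul, Complex.ofReal_add, Complex.ofReal_sub, Complex.ofReal_div,
    Complex.ofReal_pow, Complex.ofReal_one] at e₁ e₂ e₃ e₄ hs ⊢
  refine ⟨fun i => ?_, Eq.trans ?_ (smul_eq_zero_of_right ((‖q‖ : ℂ) ^ 2 * (1 + (‖q‖ : ℂ) ^ 2))⁻¹ e₁),
    Eq.trans ?_ (smul_eq_zero_of_right ((1 + (‖q‖ : ℂ) ^ 2) ^ 2 * (‖q‖ : ℂ))⁻¹ e₄),
    Eq.trans ?_ (smul_eq_zero_of_right ((‖q‖ : ℂ) ^ 2 * (1 + (‖q‖ : ℂ) ^ 2))⁻¹ e₃),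
    Eq.trans ?_ (smul_eq_zero_of_right ((1 + (‖q‖ : ℂ) ^ 2) ^ 2 * (‖q‖ : ℂ))⁻¹ e₂)⟩
  · rw [star_smul, Complex.star_def, map_inv₀, Complex.conj_ofReal, podlesScale_neg,
      sub_eq_zero.mp (hs (-i)), sub_self]
  all_goals
    simp only [podlesScale_neg, podlesScale_one, podlesScale_zero, neg_neg, neg_zero, sq (_ • _),
      sq (x _), smul_mul_smul_comm, smul_smul, smul_add, smul_sub]
    match_scalars <;> field_simp
  all_goals ring

/-- The isomorphism of the braided Podleś sphere with Podleś's sphere. -/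
theorem exists_podlesEquiv {q : ℂ} (hq : q ≠ 0) :
    ∃ Φ : Sphere q ρ lam ≃⋆ₐ[ℂ]
        Podles ‖q‖ (lam / (√(vsig q) * sig q ^ 2)) (ρ / (vsig q * sig q ^ 2)),
      ∀ i, Φ (Sphere.e q ρ lam i) = (podlesScale q i : ℂ) • Podles.E _ _ _ (-i) := by
  let f : Sphere q ρ lam →⋆ₐ[ℂ]
      Podles ‖q‖ (lam / (√(vsig q) * sig q ^ 2)) (ρ / (vsig q * sig q ^ 2)) :=
    UnivCStar.lift _ (sphere_rel_of_podles ρ lam hq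
      (UnivCStar.eval_gen_eq_zero _ (admissible_podlesRel _ _ _)))
  let g : Podles ‖q‖ (lam / (√(vsig q) * sig q ^ 2)) (ρ / (vsig q * sig q ^ 2)) →⋆ₐ[ℂ]
      Sphere q ρ lam :=
    UnivCStar.lift _ (podles_rel_of_sphere ρ lam hq
      (UnivCStar.eval_gen_eq_zero _ (admissible_sphereRel _ _ _)))
  have hf : ∀ i, f (Sphere.e q ρ lam i) = (podlesScale q i : ℂ) • Podles.E _ _ _ (-i) :=
    fun i => UnivCStar.lift_gen _ _ i
  have hg : ∀ i, g (Podles.E _ _ _ i) = (podlesScale q i : ℂ)⁻¹ • Sphere.e q ρ lam (-i) :=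
    fun i => UnivCStar.lift_gen _ _ i
  have hgf : g.comp f = StarAlgHom.id ℂ _ := UnivCStar.hom_ext fun i => by
    change g (f (Sphere.e q ρ lam i)) = Sphere.e q ρ lam i
    rw [hf, map_smul, hg, podlesScale_neg, neg_neg, smul_smul,
      mul_inv_cancel₀ (podlesScale_ne_zero hq i), one_smul]
  have hfg : f.comp g = StarAlgHom.id ℂ _ := UnivCStar.hom_ext fun i => by
    change f (g (Podles.E _ _ _ i)) = Podles.E _ _ _ i
    rw [hg, map_smul, hf, podlesScale_neg, neg_neg, smul_smul,
      inv_mul_cancel₀ (podlesScale_ne_zero hq i), one_smul]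
  exact ⟨StarAlgEquiv.ofStarAlgHom f g hgf hfg, hf⟩

end Podles

end BraidedSphere

end

/-! ### The main theorem -/

theorem mainTheorem2 (q : ℂ) (hq₀ : q ≠ 0) (hq₁ : ‖q‖ < 1) (ρ lam : ℝ) :
    -- the action of `𝕋` with `deg e_i = i`
    (∃ τ : CircleAction (Sphere q ρ lam),
      (∀ i : SignType, τ.IsHomogeneous (i : ℤ) (Sphere.e q ρ lam i)) ∧
      -- the comultiplication of `SU_q(2)`
      ∃ (Δ : CSU q →⋆ₐ[ℂ] Braided (zeta q hq₀) (CSU.action q) (CSU.action q))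
        (hΔ : CircleAction.Equivariant (CSU.action q)
          (Braided.action (zeta q hq₀) (CSU.action q) (CSU.action q)) Δ),
        Δ (CSU.α q) =
          Braided.j₁ (zeta q hq₀) (CSU.action q) (CSU.action q) (CSU.α q) *
            Braided.j₂ (zeta q hq₀) (CSU.action q) (CSU.action q) (CSU.α q) -
          q • (Braided.j₁ (zeta q hq₀) (CSU.action q) (CSU.action q) (star (CSU.γ q)) *
            Braided.j₂ (zeta q hq₀) (CSU.action q) (CSU.action q) (CSU.γ q)) ∧
        Δ (CSU.γ q) =
          Braided.j₁ (zeta q hq₀) (CSU.action q) (CSU.action q) (CSU.γ q) *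
            Braided.j₂ (zeta q hq₀) (CSU.action q) (CSU.action q) (CSU.α q) +
          Braided.j₁ (zeta q hq₀) (CSU.action q) (CSU.action q) (star (CSU.α q)) *
            Braided.j₂ (zeta q hq₀) (CSU.action q) (CSU.action q) (CSU.γ q) ∧
        -- the braided action of `SU_q(2)`
        ∃ (Γ : Sphere q ρ lam →⋆ₐ[ℂ] Braided (zeta q hq₀) (CSU.action q) τ)
          (hΓ : CircleAction.Equivariant τ (Braided.action (zeta q hq₀) (CSU.action q) τ) Γ),
          (∀ i : SignType, Γ (Sphere.e q ρ lam i) =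
            ∑ k : SignType, Braided.j₁ (zeta q hq₀) (CSU.action q) τ (CSU.V q i k) *
              Braided.j₂ (zeta q hq₀) (CSU.action q) τ (Sphere.e q ρ lam k)) ∧
          -- coassociativity, up to the canonical isomorphism of triple products
          (∃ Θ : Braided (zeta q hq₀)
                (Braided.action (zeta q hq₀) (CSU.action q) (CSU.action q)) τ ≃⋆ₐ[ℂ]
              Braided (zeta q hq₀) (CSU.action q)
                (Braided.action (zeta q hq₀) (CSU.action q) τ),
            (∀ a : CSU q,
              Θ (Braided.j₁ _ _ _ (Braided.j₁ (zeta q hq₀) (CSU.action q) (CSU.action q) a)) =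
                Braided.j₁ _ _ _ a) ∧
            (∀ a : CSU q,
              Θ (Braided.j₁ _ _ _ (Braided.j₂ (zeta q hq₀) (CSU.action q) (CSU.action q) a)) =
                Braided.j₂ _ _ _ (Braided.j₁ (zeta q hq₀) (CSU.action q) τ a)) ∧
            (∀ x : Sphere q ρ lam,
              Θ (Braided.j₂ _ _ _ x) =
                Braided.j₂ _ _ _ (Braided.j₂ (zeta q hq₀) (CSU.action q) τ x)) ∧
            ∀ x : Sphere q ρ lam,
              Braided.map (zeta q hq₀) (CSU.action q).equivariant_id hΓ (Γ x) =
                Θ (Braided.map (zeta q hq₀) hΔ τ.equivariant_id (Γ x))) ∧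
          -- the density condition
          bracket (Set.range (Braided.j₁ (zeta q hq₀) (CSU.action q) τ)) (Set.range Γ) = ⊤) ∧
    -- the isomorphism with Podleś's algebra
    ∃ Φ : Sphere q ρ lam ≃⋆ₐ[ℂ]
        Podles ‖q‖ (lam / (√(vsig q) * sig q ^ 2)) (ρ / (vsig q * sig q ^ 2)),
      Φ (Sphere.e q ρ lam (-1)) = ((sig q ^ 2 : ℝ) : ℂ) • Podles.E _ _ _ 1 ∧
      Φ (Sphere.e q ρ lam 0) = ((√(vsig q) : ℝ) : ℂ) • Podles.E _ _ _ 0 ∧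
      Φ (Sphere.e q ρ lam 1) = ((sig q ^ 2 : ℝ) : ℂ) • Podles.E _ _ _ (-1) := by
  obtain ⟨Θ, h₁, h₂, h₃⟩ := Braided.exists_assoc (zeta q hq₀) (CSU.action q) (CSU.action q)
    (Sphere.action q ρ lam)
  obtain ⟨Φ, hΦ⟩ := exists_podlesEquiv ρ lam hq₀
  refine ⟨⟨Sphere.action q ρ lam, Sphere.isHomogeneous_e q ρ lam, CSU.comul q hq₀,
    CSU.comul_equivariant q hq₀, CSU.comul_α q hq₀, CSU.comul_γ q hq₀, Sphere.coact q ρ lam hq₀,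
    Sphere.coact_equivariant q ρ lam hq₀, Sphere.coact_e q ρ lam hq₀,
    ⟨Θ, h₁, h₂, h₃, Sphere.coassoc q ρ lam hq₀ h₁ h₂ h₃⟩, Sphere.bracket_coact q ρ lam hq₀⟩,
    Φ, ?_, ?_, ?_⟩
  · exact (hΦ (-1)).trans (congrArg (fun c : ℝ => (c : ℂ) • _) (sig_sq q).symm)
  · exact (hΦ 0).trans (congrArg (fun c : ℝ => (c : ℂ) • _) (sqrt_vsig q).symm)
  · exact (hΦ 1).trans (congrArg (fun c : ℝ => (c : ℂ) • _) (sig_sq q).symm)
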